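/- Let $n\ge 1$, let $G=S_{2n}$ be the symmetric group on $\{1,\dots,2n\}$, and let $\varepsilon$ be the perfect matching of $\{1,\dots,2n\}$ in which $a$ is matched with $n+a$ for $1\le a\le n$. For $w\in G$ let $\delta(w)$ be the perfect matching in which $a$ and $b$ are matched if and only if $|w(a)-w(b)|=n$, and let $K=\{w\in G:\delta(w)=\varepsilon\}$ be the hyperoctahedral group, of order $2^n n!$. For two perfect matchings $\delta_1,\delta_2$ let $\Lambda(\delta_1,\delta_2)$ be the partition of $n$ whose parts are half the lengths of the cycles of $\delta_1\cup\delta_2$ (a common edge counts as a cycle of length $2$). Then $(G,K)$ is a Gelfand pair, i.e. the induced representation $1_K^G=\bigoplus_\lambda V_\lambda$ is multiplicity free. Let $d_\lambda=\dim V_\lambda$, let $\chi^\lambda$ be the character of $V_\lambda$, and let $$\omega_\lambda(x)=\frac1{|K|}\sum_{k\in K}\chi^\lambda(x^{-1}k)$$ be the corresponding spherical function. The Plancherel measure of $(G,K)$ is the probability measure on the set of irreducible constituents of $1_K^G$ that chooses $\lambda$ with probability $d_\lambda|K|/|G|$. Theorem. For every integer $i\ge 2$ there is a constant $A_i$, depending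 only on $i$, such that the following holds for all $n\ge i$. Let $g=g_{(i,1^{n-i})}\in G$ be any element with $\Lambda(\varepsilon,\delta(g))=(i,1^{n-i})$. Then $\omega_\lambda(g)$ is real for every $\lambda$, and if $\lambda$ is chosen from the Plancherel measure of $(G,K)$ and $$W=\sqrt{2^{i-1}\binom ni (i-1)!}\;\omega_\lambda(g),$$ then for all real $x_0$ $$\left|\mathbb P(W\le x_0)-\frac1{\sqrt{2\pi}}\int_{-\infty}^{x_0}e^{-x^2/2}\,dx\right|\le A_i\,n^{-1/4}.$$ Equivalently, let $H_{(i,1^{n-i})}$ be the graph whose vertices are the perfect matchings of $\{1,\dots,2n\}$, with $\delta_1,\delta_2$ adjacent if and only if $\Lambda(\delta_1,\delta_2)=(i,1^{n-i})$. If $r$ is chosen uniformly from the eigenvalues, counted with multiplicity, of the transition matrix of simple random walk on $H_{(i,1^{n-i})}$, then $\sqrt{2^{i-1}\binom ni(i-1)!}\;r$ has the same distribution as $W$, and hence satisfies the same bound with the same $A_i$. -/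

import Mathlib

noncomputable section

/-! ### Gelfand pairs, spherical functions and Plancherel measure -/

section GelfandPair

variable {G : Type*} [Group G]

/-- The representation `1_K^G` of `G` induced from the trivial representation of `K`, realized as
the complex permutation representation of `G` on the cosets of `K`. -/
abbrev inducedTrivial (K : Subgroup G) : Representation ℂ G (MonoidAlgebra ℂ (G ⧸ K)) :=
  Representation.ofMulAction ℂ G (G ⧸ K)

/-- The irreducible constituents (irreducible subrepresentations) of `1_K^G`. For a Gelfand pair
these are exactly the summands `V_0, …, V_s` of the multiplicity free decomposition. -/
def SphericalRep (K : Subgroup G) : Type _ :=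
  {V : Subrepresentation (inducedTrivial K) // V.toRepresentation.IsIrreducible}

/-- The representation of `G` carried by a constituent of `1_K^G`. -/
def SphericalRep.rep {K : Subgroup G} (V : SphericalRep K) :
    Representation ℂ G V.1.toSubmodule :=
  V.1.toRepresentation

/-- The dimension `d_V`. -/
def SphericalRep.dim {K : Subgroup G} (V : SphericalRep K) : ℕ :=
  Module.finrank ℂ V.1.toSubmodule

/-- `(G, K)` is a Gelfand pair if `1_K^G` is multiplicity free: distinct irreducible constituents
are never isomorphic as representations of `G`. -/
def IsGelfandPair (K : Subgroup G) : Prop :=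
  ∀ V V' : SphericalRep K, Nonempty (V.rep.Equiv V'.rep) → V = V'

open Classical in
/-- The spherical function `ω_V(x) = |K|⁻¹ ∑_{k ∈ K} χ_V(x⁻¹ k)`. -/
def sphericalFunction [Fintype G] {K : Subgroup G} (V : SphericalRep K) (x : G) : ℂ :=
  (Nat.card K : ℂ)⁻¹ * ∑ k : K, V.rep.character (x⁻¹ * (k : G))

instance (K : Subgroup G) : MeasurableSpace (SphericalRep K) := ⊤

/-- The Plancherel measure of `(G, K)`: the constituent `V` has mass `d_V |K| / |G|`. -/
def plancherelMeasure (K : Subgroup G) : MeasureTheory.Measure (SphericalRep K) :=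
  MeasureTheory.Measure.sum fun V =>
    ENNReal.ofReal ((V.dim : ℝ) * Nat.card K / Nat.card G) • MeasureTheory.Measure.dirac V

end GelfandPair

/-! ### Perfect matchings and the hyperoctahedral group -/

/-- A perfect matching of `{0, …, 2n-1}`, as a 1-regular graph. -/
abbrev PerfectMatching (n : ℕ) : Type :=
  {M : SimpleGraph (Fin (2 * n)) // ∀ v, ∃! w, M.Adj v w}

instance (n : ℕ) : Fintype (PerfectMatching n) := Fintype.ofFinite _

/-- The identity matching `ε`, in which `a` is adjacent to `n + a` for `a < n`. -/
def identityMatching (n : ℕ) : SimpleGraph (Fin (2 * n)) where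
  Adj a b := (a : ℕ) + n = b ∨ (b : ℕ) + n = a
  symm := ⟨fun _ _ h => h.symm⟩
  loopless := ⟨fun a h => by have := a.isLt; omega⟩

/-- The matching `δ(w)`, in which `a` is adjacent to `b` iff `|w(a) - w(b)| = n`. -/
def matchingOf {n : ℕ} (w : Equiv.Perm (Fin (2 * n))) : SimpleGraph (Fin (2 * n)) :=
  (identityMatching n).comap w

/-- The hyperoctahedral group of order `2^n n!` inside `S_{2n}`: the permutations that preserve
the identity matching. -/
def hyperoctahedral (n : ℕ) : Subgroup (Equiv.Perm (Fin (2 * n))) where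
  carrier := {w | matchingOf w = identityMatching n}
  one_mem' := rfl
  mul_mem' {v w} hv hw := by
    change ((identityMatching n).comap v).comap w = _
    rw [show (identityMatching n).comap v = identityMatching n from hv]
    exact hw
  inv_mem' {w} hw := by
    change (identityMatching n).comap ⇑w⁻¹ = _
    nth_rewrite 1 [← show (identityMatching n).comap w = identityMatching n from hw]
    ext a b
    simp

/-- The multiset of half the numbers of vertices of the connected components of a graph. -/
def halfComponentSizes {n : ℕ} (U : SimpleGraph (Fin (2 * n))) : Multiset ℕ :=
  letI : Fintype U.ConnectedComponent := Fintype.ofFinite _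
  (Finset.univ : Finset U.ConnectedComponent).val.map fun c => c.supp.ncard / 2

/-- `Λ(δ₁, δ₂)`: the multiset of half the cycle lengths of the union `δ₁ ∪ δ₂` of two perfect
matchings. The cycles are the connected components of the union (an edge shared by `δ₁` and `δ₂`
is a cycle of length `2`), and the length of a cycle is its number of vertices. -/
def matchingType {n : ℕ} (δ₁ δ₂ : SimpleGraph (Fin (2 * n))) : Multiset ℕ :=
  halfComponentSizes (δ₁ ⊔ δ₂)

/-- The parts of the partition `(i, 1^{n-i})` of `n`, for `1 ≤ i ≤ n`. -/
def hookType (n i : ℕ) : Multiset ℕ := i ::ₘ Multiset.replicate (n - i) 1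

/-- The graph `H_{(i,1^{n-i})}` on the perfect matchings of `2n` symbols (for `i ≥ 2`, where the
condition `δ₁ ≠ δ₂` holds automatically). -/
def matchingGraph (n i : ℕ) : SimpleGraph (PerfectMatching n) where
  Adj δ₁ δ₂ := δ₁ ≠ δ₂ ∧ matchingType δ₁.1 δ₂.1 = hookType n i
  symm := ⟨fun δ₁ δ₂ h => ⟨h.1.symm, by
    have h2 := h.2
    unfold matchingType at h2 ⊢
    rwa [sup_comm]⟩⟩
  loopless := ⟨fun _ h => h.1 rfl⟩

/-! ### Spectrum of random walk on a graph -/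

open Classical in
/-- The transition matrix of simple random walk on a finite graph. -/
def walkMatrix {V : Type*} [Fintype V] (H : SimpleGraph V) : Matrix V V ℝ :=
  Matrix.of fun v w => if H.Adj v w then (H.degree v : ℝ)⁻¹ else 0

open Classical in
/-- The proportion of those eigenvalues `r` of random walk on `H`, counted with algebraic
multiplicity among all `|V|` eigenvalues, for which `c * r ≤ x`. -/
def walkSpectralCDF {V : Type*} [Fintype V] (H : SimpleGraph V) (c x : ℝ) : ℝ :=
  (((walkMatrix H).charpoly.roots.filter fun r => c * r ≤ x).card : ℝ) / Fintype.card V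

/-! ### Normalization -/

/-- The standard normal distribution function. -/
def normalCDF (x₀ : ℝ) : ℝ :=
  1 / √(2 * Real.pi) * ∫ x in Set.Iic x₀, Real.exp (-x ^ 2 / 2)

/-- The scaling factor `√(2^{i-1} (n choose i) (i-1)!)`, for `i ≥ 1`. -/
def scaling (n i : ℕ) : ℝ :=
  √((2 : ℝ) ^ (i - 1) * (n.choose i : ℝ) * ((i - 1).factorial : ℝ))

end

/-! The law of `W` is a spectral distribution. Cosets of K are perfect matchings, and averaging over
the K-orbit of the coset of g⁻¹ is simple random walk on the matching graph
(`kernel_orbitalOperator`). On a constituent V this operator is the scalar ω_V(g)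
(`sphericalFunction_eq`), and V carries weight proportional to dim V, so the Plancherel law of ω(g)
is the eigenvalue law of the walk (`sphericalFunction_law`). The algebra rests on one combinatorial
fact: any two matchings are exchanged by some permutation (`IsMatchingPerm.exists_swap`). Kernels of
intertwining operators are therefore symmetric, so these operators commute, which forces
multiplicity one.

What remains is a central limit theorem for the eigenvalues w_j of the adjacency matrix divided by
√k, where k is the degree. Let U_j be an orthonormal eigenbasis, N the number of matchings, and
Φ(x,y) the fraction of vertices at which x and y agree. Put P(j,l) = N⁻¹ ∑ Φ(x,y)
U_j(x)U_j(y)U_l(x)U_l(y). As Φ is a Gram matrix with unit diagonal, P is the law of an exchangeable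
pair with uniform marginals. Adjacent matchings disagree at exactly 2i of the 2n vertices, so E(w_l
- w_j | j) = -a w_j with a = i/n, and Stein's method applies (`exchangeable_pair_normal`). Its error
terms become sums over pairs (x,y) of expressions in Φ and W² (`eigenvalue_normal_bound`).

The entry (W²)(x,y) is the number of two step walks from x to y, divided by k. A typical two step
walk makes disjoint steps and ends at distance 4i, where Φ - 1 + 2a vanishes; closer pairs x ≠ y
contribute O(1/n) (`sum_near_le`), so the conditional variance term is O(n^(-1/2)). In the fourth
moment a pair at distance d has weight (8i - 3d)/n, which is 8i/n on the diagonal and -4i/n at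
distance 4i. Disjoint steps can be made in either order, so the squares of W² at distance 4i sum to
at least 2 - O(1/n) in each row (`le_sum_far`) and cancel the diagonal to leading order. The fourth
moment is thus O(n⁻²) and the third O(n^(-3/2)), leaving an error of order n^(-1/2)/δ + δ, balanced
by δ = n^(-1/4). -/

noncomputable section

/-! ### The normal distribution function, its antiderivative and the Mills ratio -/

open MeasureTheory Set Filter Topology

/-- The standard normal density. -/
def normalDensity (t : ℝ) : ℝ := Real.exp (-t ^ 2 / 2) / √(2 * Real.pi)

lemma sqrt_two_pi_pos : 0 < √(2 * Real.pi) := by positivity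

lemma normalDensity_pos (t : ℝ) : 0 < normalDensity t := by unfold normalDensity; positivity

lemma normalDensity_neg (t : ℝ) : normalDensity (-t) = normalDensity t := by
  simp [normalDensity]

lemma normalDensity_le_one (t : ℝ) : normalDensity t ≤ 1 := by
  unfold normalDensity
  rw [div_le_one sqrt_two_pi_pos]
  have h1 : Real.exp (-t ^ 2 / 2) ≤ 1 := Real.exp_le_one_iff.2 (by nlinarith [sq_nonneg t])
  have h2 : 1 ≤ √(2 * Real.pi) := by
    rw [Real.one_le_sqrt]; nlinarith [Real.pi_gt_three]
  linarith

lemma hasDerivAt_normalDensity (t : ℝ) : HasDerivAt normalDensity (-t * normalDensity t) t := by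
  have h : HasDerivAt (fun t : ℝ => -t ^ 2 / 2) (-t) t := by
    have := ((hasDerivAt_id t).pow 2).neg.div_const 2
    convert! this using 1
    simp; ring
  convert! h.exp.div_const (√(2 * Real.pi)) using 1
  unfold normalDensity; ring

lemma continuous_normalDensity : Continuous normalDensity :=
  continuous_iff_continuousAt.2 fun t => (hasDerivAt_normalDensity t).continuousAt

lemma normalDensity_eq (t : ℝ) :
    normalDensity t = (√(2 * Real.pi))⁻¹ * Real.exp (-(1 / 2) * t ^ 2) := by
  unfold normalDensity
  rw [div_eq_inv_mul]; congr 2; ring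

lemma integrable_normalDensity : Integrable normalDensity := by
  simp_rw [funext normalDensity_eq]
  exact (integrable_exp_neg_mul_sq (by norm_num)).const_mul _

lemma integrable_mul_normalDensity : Integrable fun t => t * normalDensity t := by
  simp_rw [normalDensity_eq]
  convert! (integrable_mul_exp_neg_mul_sq (b := 1 / 2) (by norm_num)).const_mul
    (√(2 * Real.pi))⁻¹ using 2
  ring

lemma integrable_sq_mul_normalDensity : Integrable fun t => t ^ 2 * normalDensity t := by
  simp_rw [normalDensity_eq]
  convert! (integrable_rpow_mul_exp_neg_mul_sq (b := 1 / 2) (by norm_num) (s := 2)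
    (by norm_num)).const_mul (√(2 * Real.pi))⁻¹ using 2
  rw [Real.rpow_two]; ring

lemma integral_normalDensity : ∫ t, normalDensity t = 1 := by
  simp_rw [normalDensity_eq]
  rw [integral_const_mul, integral_gaussian, inv_mul_eq_one₀ sqrt_two_pi_pos.ne']
  congr 1; field_simp

lemma normalCDF_eq (x : ℝ) : normalCDF x = ∫ t in Iic x, normalDensity t := by
  unfold normalCDF normalDensity
  rw [integral_div]; ring

lemma normalCDF_add_neg (x : ℝ) : normalCDF x + normalCDF (-x) = 1 := by
  rw [normalCDF_eq, normalCDF_eq, ← integral_normalDensity,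
    ← intervalIntegral.integral_Iic_add_Ioi (b := x) integrable_normalDensity.integrableOn
      integrable_normalDensity.integrableOn]
  congr 1
  rw [← integral_comp_neg_Ioi]
  simp [normalDensity_neg]

lemma normalCDF_pos (x : ℝ) : 0 < normalCDF x := by
  rw [normalCDF_eq]
  refine (integral_pos_iff_support_of_nonneg (fun t => (normalDensity_pos t).le)
    integrable_normalDensity.integrableOn).2 ?_
  have : Function.support normalDensity = univ := by
    ext t; simp [(normalDensity_pos t).ne']
  rw [this]; simp

lemma normalCDF_neg (x : ℝ) : normalCDF (-x) = 1 - normalCDF x := by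
  linarith [normalCDF_add_neg x]

lemma normalCDF_sub (x y : ℝ) : normalCDF y - normalCDF x = ∫ t in x..y, normalDensity t := by
  rw [normalCDF_eq, normalCDF_eq, intervalIntegral.integral_Iic_sub_Iic
    integrable_normalDensity.integrableOn integrable_normalDensity.integrableOn]

lemma hasDerivAt_normalCDF (x : ℝ) : HasDerivAt normalCDF (normalDensity x) x := by
  have h : HasDerivAt (fun y => normalCDF 0 + ∫ t in (0 : ℝ)..y, normalDensity t)
      (normalDensity x) x :=
    (intervalIntegral.integral_hasDerivAt_right integrable_normalDensity.intervalIntegrable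
      continuous_normalDensity.stronglyMeasurable.stronglyMeasurableAtFilter
      continuous_normalDensity.continuousAt).const_add _
  convert! h using 1
  ext y
  rw [← normalCDF_sub]; ring

lemma monotone_normalCDF : Monotone normalCDF :=
  monotone_of_hasDerivAt_nonneg (fun x => hasDerivAt_normalCDF x)
    fun x => (normalDensity_pos x).le

lemma normalCDF_add_le (x : ℝ) {δ : ℝ} (hδ : 0 ≤ δ) : normalCDF (x + δ) ≤ normalCDF x + δ := by
  have h := Convex.image_sub_le_mul_sub_of_deriv_le (f := normalCDF) (D := univ) (C := 1)
    convex_univ (fun t _ => (hasDerivAt_normalCDF t).continuousAt.continuousWithinAt)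
    (fun t _ => (hasDerivAt_normalCDF t).differentiableAt.differentiableWithinAt)
    (fun t _ => by rw [(hasDerivAt_normalCDF t).deriv]; exact normalDensity_le_one t)
    x (mem_univ _) (x + δ) (mem_univ _) (by linarith)
  linarith

lemma tendsto_normalDensity_atBot : Tendsto normalDensity atBot (𝓝 0) := by
  have h : Tendsto (fun t : ℝ => Real.exp (-t ^ 2 / 2)) atBot (𝓝 0) := by
    apply Real.tendsto_exp_atBot.comp
    have : Tendsto (fun t : ℝ => t ^ 2 / 2) atBot atTop :=
      Tendsto.atTop_div_const (by norm_num)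
        (((tendsto_pow_atTop (two_ne_zero)).comp tendsto_neg_atBot_atTop).congr fun t => by simp)
    convert! tendsto_neg_atTop_atBot.comp this using 2
    simp; ring
  have := h.div_const (√(2 * Real.pi))
  rw [zero_div] at this
  exact this

lemma tendsto_mul_normalDensity_atBot : Tendsto (fun t => t * normalDensity t) atBot (𝓝 0) := by
  have h := tendsto_zero_of_hasDerivAt_of_integrableOn_Iic (a := 0)
    (f := fun t => t * normalDensity t) (f' := fun t => normalDensity t - t ^ 2 * normalDensity t)
    (fun t _ => by
      convert! (hasDerivAt_id t).mul (hasDerivAt_normalDensity t) using 1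
      simp; ring)
    (integrable_normalDensity.sub integrable_sq_mul_normalDensity).integrableOn
    integrable_mul_normalDensity.integrableOn
  exact h

lemma integral_Iic_mul_normalDensity (x : ℝ) :
    ∫ t in Iic x, t * normalDensity t = -normalDensity x := by
  have := integral_Iic_of_hasDerivAt_of_tendsto' (a := x) (f := fun t => -normalDensity t)
    (f' := fun t => t * normalDensity t) (m := 0)
    (fun t _ => by convert! (hasDerivAt_normalDensity t).neg using 1; ring)
    integrable_mul_normalDensity.integrableOn
    (by simpa using tendsto_normalDensity_atBot.neg)
  simpa using this

lemma integral_Iic_sq_mul_normalDensity (x : ℝ) :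
    ∫ t in Iic x, t ^ 2 * normalDensity t = normalCDF x - x * normalDensity x := by
  have := integral_Iic_of_hasDerivAt_of_tendsto' (a := x) (f := fun t => t * normalDensity t)
    (f' := fun t => normalDensity t - t ^ 2 * normalDensity t) (m := 0)
    (fun t _ => by
      convert! (hasDerivAt_id t).mul (hasDerivAt_normalDensity t) using 1
      simp; ring)
    (integrable_normalDensity.sub integrable_sq_mul_normalDensity).integrableOn
    tendsto_mul_normalDensity_atBot
  rw [integral_sub integrable_normalDensity.integrableOn
    integrable_sq_mul_normalDensity.integrableOn, ← normalCDF_eq] at this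
  linarith

/-- The antiderivative `x Φ(x) + φ(x)` of the normal distribution function. -/
def normalCDFPrimitive (x : ℝ) : ℝ := x * normalCDF x + normalDensity x

/-- For Z standard normal this quantity is the expectation of the positive part of x - Z. -/
lemma normalCDFPrimitive_nonneg (x : ℝ) : 0 ≤ normalCDFPrimitive x := by
  have h : normalCDFPrimitive x = ∫ t in Iic x, (x - t) * normalDensity t := by
    simp_rw [sub_mul]
    rw [integral_sub (integrable_normalDensity.const_mul x).integrableOn
      integrable_mul_normalDensity.integrableOn, integral_Iic_mul_normalDensity,
      integral_const_mul, ← normalCDF_eq, normalCDFPrimitive]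
    ring
  rw [h]
  exact setIntegral_nonneg measurableSet_Iic fun t ht =>
    mul_nonneg (sub_nonneg.2 ht) (normalDensity_pos t).le

/-- This is the second moment of the positive part of x - Z. It is what makes the Mills ratio
convex. -/
lemma mills_lower (x : ℝ) : 0 ≤ (1 + x ^ 2) * normalCDF x + x * normalDensity x := by
  have h : (1 + x ^ 2) * normalCDF x + x * normalDensity x =
      ∫ t in Iic x, (x - t) ^ 2 * normalDensity t := by
    have h1 : ∀ t, (x - t) ^ 2 * normalDensity t =
        x ^ 2 * normalDensity t - 2 * x * (t * normalDensity t) + t ^ 2 * normalDensity t := by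
      intro t; ring
    simp_rw [h1]
    have h2 : Integrable fun t => x ^ 2 * normalDensity t - 2 * x * (t * normalDensity t) :=
      (integrable_normalDensity.const_mul _).sub (integrable_mul_normalDensity.const_mul _)
    rw [integral_add h2.integrableOn integrable_sq_mul_normalDensity.integrableOn,
      integral_sub (integrable_normalDensity.const_mul _).integrableOn
        (integrable_mul_normalDensity.const_mul _).integrableOn,
      integral_const_mul, integral_const_mul, integral_Iic_mul_normalDensity,
      integral_Iic_sq_mul_normalDensity, ← normalCDF_eq]
    ring
  rw [h]
  exact setIntegral_nonneg measurableSet_Iic fun t _ =>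
    mul_nonneg (sq_nonneg _) (normalDensity_pos t).le

lemma hasDerivAt_normalCDFPrimitive (x : ℝ) :
    HasDerivAt normalCDFPrimitive (normalCDF x) x := by
  convert! ((hasDerivAt_id x).mul (hasDerivAt_normalCDF x)).add (hasDerivAt_normalDensity x)
    using 1
  simp

lemma monotone_normalCDFPrimitive : Monotone normalCDFPrimitive :=
  monotone_of_hasDerivAt_nonneg (fun x => hasDerivAt_normalCDFPrimitive x)
    fun x => (normalCDF_pos x).le

lemma normalCDFPrimitive_neg (x : ℝ) :
    normalCDFPrimitive (-x) = normalCDFPrimitive x - x := by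
  simp only [normalCDFPrimitive, normalCDF_neg, normalDensity_neg]; ring

lemma normalCDFPrimitive_sub_le {x y : ℝ} (h : x ≤ y) :
    normalCDFPrimitive y - normalCDFPrimitive x ≤ normalCDF y * (y - x) := by
  refine Convex.image_sub_le_mul_sub_of_deriv_le (f := normalCDFPrimitive) (D := Icc x y)
    (convex_Icc x y)
    (fun t _ => (hasDerivAt_normalCDFPrimitive t).continuousAt.continuousWithinAt)
    (fun t _ => (hasDerivAt_normalCDFPrimitive t).differentiableAt.differentiableWithinAt)
    (fun t ht => ?_) x (left_mem_Icc.2 h) y (right_mem_Icc.2 h) h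
  rw [(hasDerivAt_normalCDFPrimitive t).deriv]
  rw [interior_Icc] at ht
  exact monotone_normalCDF ht.2.le

lemma le_normalCDFPrimitive_sub {x y : ℝ} (h : x ≤ y) :
    normalCDF x * (y - x) ≤ normalCDFPrimitive y - normalCDFPrimitive x := by
  refine Convex.mul_sub_le_image_sub_of_le_deriv (f := normalCDFPrimitive) (D := Icc x y)
    (convex_Icc x y)
    (fun t _ => (hasDerivAt_normalCDFPrimitive t).continuousAt.continuousWithinAt)
    (fun t _ => (hasDerivAt_normalCDFPrimitive t).differentiableAt.differentiableWithinAt)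
    (fun t ht => ?_) x (left_mem_Icc.2 h) y (right_mem_Icc.2 h) h
  rw [(hasDerivAt_normalCDFPrimitive t).deriv]
  rw [interior_Icc] at ht
  exact monotone_normalCDF ht.1.le

/-- The ratio of the normal distribution function and density (the Mills ratio at `-x`). -/
def millsRatio (x : ℝ) : ℝ := normalCDF x / normalDensity x

lemma hasDerivAt_millsRatio (x : ℝ) : HasDerivAt millsRatio (1 + x * millsRatio x) x := by
  have hp := (normalDensity_pos x).ne'
  convert! (hasDerivAt_normalCDF x).div (hasDerivAt_normalDensity x) hp using 1
  unfold millsRatio; field_simp; ring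

lemma one_add_mul_millsRatio_nonneg (x : ℝ) : 0 ≤ 1 + x * millsRatio x := by
  have h : 1 + x * millsRatio x = normalCDFPrimitive x / normalDensity x := by
    have hp := (normalDensity_pos x).ne'
    unfold millsRatio normalCDFPrimitive; field_simp; ring
  rw [h]; exact div_nonneg (normalCDFPrimitive_nonneg x) (normalDensity_pos x).le

/-- Differentiating M' = 1 + xM once more gives exactly this expression, so the claim is convexity
of the Mills ratio M. -/
lemma millsRatio_second_nonneg (x : ℝ) : 0 ≤ (1 + x ^ 2) * millsRatio x + x := by
  have h : (1 + x ^ 2) * millsRatio x + x =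
      ((1 + x ^ 2) * normalCDF x + x * normalDensity x) / normalDensity x := by
    have hp := (normalDensity_pos x).ne'
    unfold millsRatio; field_simp
  rw [h]; exact div_nonneg (mills_lower x) (normalDensity_pos x).le

/-- The density is even. This symmetry cancels the terms that come from differentiating the two tail
weights in the Stein solution. -/
lemma millsRatio_neg_mul (x : ℝ) :
    millsRatio (-x) * normalCDF x = millsRatio x * normalCDF (-x) := by
  unfold millsRatio; rw [normalDensity_neg]; ring

/-- The coefficients are M''(-x) and M''(x). That the combination is constant is the source of the
uniform bound 1/δ on the second derivative of the Stein solution. -/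
lemma millsRatio_second_identity (x : ℝ) :
    ((1 + x ^ 2) * millsRatio (-x) - x) * normalCDFPrimitive x +
      ((1 + x ^ 2) * millsRatio x + x) * normalCDFPrimitive (-x) = 1 := by
  have hp := (normalDensity_pos x).ne'
  simp only [millsRatio, normalCDFPrimitive, normalCDF_neg, normalDensity_neg]
  field_simp; ring

end

noncomputable section

open Set Filter Topology

/-! ### The Stein equation for a piecewise linear test function -/

/-- The projection of `x` onto `[u, u + δ]`. -/
def rampPoint (u δ x : ℝ) : ℝ := max u (min x (u + δ))

/-- The function equal to `1` left of `u`, to `0` right of `u + δ`, and linear in between. -/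
def ramp (u δ x : ℝ) : ℝ := (u + δ - rampPoint u δ x) / δ

/-- The standard normal expectation of `ramp u δ`. -/
def rampMean (u δ : ℝ) : ℝ := (normalCDFPrimitive (u + δ) - normalCDFPrimitive u) / δ

/-- The weight of the right tail in the solution of the Stein equation. -/
def steinLeft (u δ x : ℝ) : ℝ :=
  (normalCDFPrimitive (rampPoint u δ x) - normalCDFPrimitive u) / δ

/-- The weight of the left tail in the solution of the Stein equation. -/
def steinRight (u δ x : ℝ) : ℝ :=
  (normalCDFPrimitive (-rampPoint u δ x) - normalCDFPrimitive (-(u + δ))) / δ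

/-- The bounded solution of the Stein equation `f' - x f = ramp - rampMean`. -/
def steinSolution (u δ x : ℝ) : ℝ :=
  millsRatio (-x) * steinLeft u δ x + millsRatio x * steinRight u δ x

/-- The derivative of `steinSolution`. -/
def steinDeriv (u δ x : ℝ) : ℝ :=
  x * steinSolution u δ x - steinLeft u δ x + steinRight u δ x

variable {u δ : ℝ}

lemma rampPoint_mem (hδ : 0 < δ) (x : ℝ) : u ≤ rampPoint u δ x ∧ rampPoint u δ x ≤ u + δ :=
  ⟨le_max_left _ _, max_le (by linarith) (min_le_right _ _)⟩

lemma continuous_rampPoint : Continuous (rampPoint u δ) := by unfold rampPoint; fun_prop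

lemma rampPoint_of_le {x : ℝ} (hx : x ≤ u) : rampPoint u δ x = u := by
  unfold rampPoint; exact max_eq_left ((min_le_left _ _).trans hx)

lemma rampPoint_of_mem {x : ℝ} (hx : u ≤ x) (hx' : x ≤ u + δ) : rampPoint u δ x = x := by
  unfold rampPoint; rw [min_eq_left hx', max_eq_right hx]

lemma rampPoint_of_ge (hδ : 0 < δ) {x : ℝ} (hx : u + δ ≤ x) : rampPoint u δ x = u + δ := by
  unfold rampPoint; rw [min_eq_right hx, max_eq_right (by linarith)]

lemma ramp_mem (hδ : 0 < δ) (x : ℝ) : 0 ≤ ramp u δ x ∧ ramp u δ x ≤ 1 := by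
  have := rampPoint_mem (u := u) hδ x
  unfold ramp
  constructor
  · apply div_nonneg _ hδ.le; linarith
  · rw [div_le_one hδ]; linarith

lemma ramp_of_le (hδ : 0 < δ) {x : ℝ} (hx : x ≤ u) : ramp u δ x = 1 := by
  unfold ramp; rw [rampPoint_of_le hx]; field_simp; ring

lemma ramp_of_ge (hδ : 0 < δ) {x : ℝ} (hx : u + δ ≤ x) : ramp u δ x = 0 := by
  unfold ramp; rw [rampPoint_of_ge hδ hx]; simp

lemma normalCDF_le_rampMean (hδ : 0 < δ) : normalCDF u ≤ rampMean u δ := by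
  have := le_normalCDFPrimitive_sub (x := u) (y := u + δ) (by linarith)
  unfold rampMean
  rw [le_div_iff₀ hδ]
  simpa using this

lemma rampMean_le_normalCDF (hδ : 0 < δ) : rampMean u δ ≤ normalCDF (u + δ) := by
  have := normalCDFPrimitive_sub_le (x := u) (y := u + δ) (by linarith)
  unfold rampMean
  rw [div_le_iff₀ hδ]
  simpa using this

/-- The reflection formula for the antiderivative of the distribution function reduces the
difference to an affine function of `rampPoint`. -/
lemma steinRight_sub_steinLeft (x : ℝ) (hδ : 0 < δ) :
    steinRight u δ x - steinLeft u δ x = ramp u δ x - rampMean u δ := by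
  unfold steinRight steinLeft ramp rampMean
  rw [normalCDFPrimitive_neg, normalCDFPrimitive_neg]
  field_simp; ring

lemma stein_equation (x : ℝ) (hδ : 0 < δ) :
    steinDeriv u δ x - x * steinSolution u δ x = ramp u δ x - rampMean u δ := by
  rw [← steinRight_sub_steinLeft x hδ, steinDeriv]; ring

lemma steinLeft_nonneg (hδ : 0 < δ) (x : ℝ) : 0 ≤ steinLeft u δ x :=
  div_nonneg (sub_nonneg.2 (monotone_normalCDFPrimitive (rampPoint_mem hδ x).1)) hδ.le

lemma steinRight_nonneg (hδ : 0 < δ) (x : ℝ) : 0 ≤ steinRight u δ x :=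
  div_nonneg (sub_nonneg.2 (monotone_normalCDFPrimitive
    (neg_le_neg (rampPoint_mem hδ x).2))) hδ.le

lemma steinLeft_eq_zero {x : ℝ} (hx : x ≤ u) : steinLeft u δ x = 0 := by
  unfold steinLeft; rw [rampPoint_of_le hx]; simp

lemma steinRight_eq_zero (hδ : 0 < δ) {x : ℝ} (hx : u + δ ≤ x) : steinRight u δ x = 0 := by
  unfold steinRight; rw [rampPoint_of_ge hδ hx]; simp

lemma rampPoint_le {x : ℝ} (hx : u ≤ x) : rampPoint u δ x ≤ x :=
  max_le hx (min_le_left _ _)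

lemma le_rampPoint {x : ℝ} (hx : x ≤ u + δ) : x ≤ rampPoint u δ x :=
  (le_min le_rfl hx).trans (le_max_right _ _)

/-- A difference quotient of the antiderivative is at most the larger endpoint value of the
distribution function, and `rampPoint` moves by at most δ. -/
lemma steinLeft_le_cdf (hδ : 0 < δ) (x : ℝ) : steinLeft u δ x ≤ normalCDF x := by
  rcases le_total x u with hx | hx
  · rw [steinLeft_eq_zero hx]; exact (normalCDF_pos x).le
  · unfold steinLeft
    have hm := rampPoint_mem (u := u) hδ x
    rw [div_le_iff₀ hδ]
    refine (normalCDFPrimitive_sub_le hm.1).trans ?_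
    have h1 := monotone_normalCDF (rampPoint_le (δ := δ) hx)
    have h2 := normalCDF_pos x
    have h3 := normalCDF_pos (rampPoint u δ x)
    nlinarith

lemma steinRight_le_cdf (hδ : 0 < δ) (x : ℝ) : steinRight u δ x ≤ normalCDF (-x) := by
  rcases le_total (u + δ) x with hx | hx
  · rw [steinRight_eq_zero hδ hx]; exact (normalCDF_pos _).le
  · unfold steinRight
    have hm := rampPoint_mem (u := u) hδ x
    rw [div_le_iff₀ hδ]
    refine (normalCDFPrimitive_sub_le (neg_le_neg hm.2)).trans ?_
    have h1 := monotone_normalCDF (neg_le_neg (le_rampPoint hx))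
    have h2 := normalCDF_pos (-x)
    have h3 := normalCDF_pos (-rampPoint u δ x)
    nlinarith

/-- Dropping the nonnegative subtracted term costs a factor 1/δ but matches the form in which
`millsRatio_second_identity` is applied. -/
lemma steinLeft_le_primitive (hδ : 0 < δ) (x : ℝ) :
    steinLeft u δ x ≤ normalCDFPrimitive x / δ := by
  rcases le_total x u with hx | hx
  · rw [steinLeft_eq_zero hx]; exact div_nonneg (normalCDFPrimitive_nonneg x) hδ.le
  · unfold steinLeft
    have h1 := monotone_normalCDFPrimitive (rampPoint_le (δ := δ) hx)
    have h2 := normalCDFPrimitive_nonneg u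
    gcongr; linarith

lemma steinRight_le_primitive (hδ : 0 < δ) (x : ℝ) :
    steinRight u δ x ≤ normalCDFPrimitive (-x) / δ := by
  rcases le_total (u + δ) x with hx | hx
  · rw [steinRight_eq_zero hδ hx]; exact div_nonneg (normalCDFPrimitive_nonneg _) hδ.le
  · unfold steinRight
    have h1 := monotone_normalCDFPrimitive (neg_le_neg (le_rampPoint hx))
    have h2 := normalCDFPrimitive_nonneg (-(u + δ))
    gcongr; linarith

lemma steinDeriv_eq (x : ℝ) : steinDeriv u δ x =
    -(1 + -x * millsRatio (-x)) * steinLeft u δ x +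
      (1 + x * millsRatio x) * steinRight u δ x := by
  unfold steinDeriv steinSolution; ring

/-- By `steinDeriv_eq` the derivative is a difference of two nonnegative terms. Replacing the tail
weights by Φ(x) and Φ(-x) gives upper bounds for these terms that sum to 1. -/
lemma abs_steinDeriv_le_one (hδ : 0 < δ) (x : ℝ) : |steinDeriv u δ x| ≤ 1 := by
  have h1 := one_add_mul_millsRatio_nonneg x
  have h2 := one_add_mul_millsRatio_nonneg (-x)
  have h3 := steinLeft_nonneg (u := u) hδ x
  have h4 := steinRight_nonneg (u := u) hδ x
  have h5 := mul_le_mul_of_nonneg_left (steinLeft_le_cdf (u := u) hδ x) h2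
  have h6 := mul_le_mul_of_nonneg_left (steinRight_le_cdf (u := u) hδ x) h1
  have h7 := millsRatio_neg_mul x
  have h8 := normalCDF_add_neg x
  have h9 := mul_nonneg h2 h3
  have h10 := mul_nonneg h1 h4
  have h11 : (1 + -x * millsRatio (-x)) * normalCDF x + (1 + x * millsRatio x) * normalCDF (-x)
      = 1 := by linear_combination h8 - x * h7
  rw [steinDeriv_eq, abs_le]
  constructor <;> linarith

/-- The right derivative of `rampPoint`. -/
def rampSlope (u δ x : ℝ) : ℝ := if u ≤ x ∧ x < u + δ then 1 else 0

lemma hasDerivWithinAt_rampPoint (hδ : 0 < δ) (x : ℝ) :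
    HasDerivWithinAt (rampPoint u δ) (rampSlope u δ x) (Ici x) x := by
  unfold rampSlope
  rcases lt_or_ge x u with hx | hx
  · rw [if_neg (by rintro ⟨h, -⟩; linarith)]
    refine (hasDerivAt_const x u).hasDerivWithinAt.congr_of_eventuallyEq ?_ (rampPoint_of_le hx.le)
    filter_upwards [mem_nhdsWithin_of_mem_nhds (Iio_mem_nhds hx)] with y hy
    exact rampPoint_of_le (le_of_lt hy)
  · rcases lt_or_ge x (u + δ) with hx' | hx'
    · rw [if_pos ⟨hx, hx'⟩]
      refine (hasDerivAt_id x).hasDerivWithinAt.congr_of_eventuallyEq ?_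
        (rampPoint_of_mem hx hx'.le)
      filter_upwards [mem_nhdsWithin_of_mem_nhds (Iio_mem_nhds hx'), self_mem_nhdsWithin]
        with y hy hy'
      exact rampPoint_of_mem (hx.trans hy') (le_of_lt hy)
    · rw [if_neg (by rintro ⟨-, h⟩; linarith)]
      refine (hasDerivAt_const x (u + δ)).hasDerivWithinAt.congr_of_eventuallyEq ?_
        (rampPoint_of_ge hδ hx')
      filter_upwards [self_mem_nhdsWithin] with y hy
      exact rampPoint_of_ge hδ (hx'.trans hy)

lemma continuous_normalCDFPrimitive : Continuous normalCDFPrimitive :=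
  continuous_iff_continuousAt.2 fun t => (hasDerivAt_normalCDFPrimitive t).continuousAt

lemma continuous_millsRatio : Continuous millsRatio :=
  continuous_iff_continuousAt.2 fun t => (hasDerivAt_millsRatio t).continuousAt

lemma continuous_steinLeft : Continuous (steinLeft u δ) := by
  have h1 := continuous_normalCDFPrimitive
  have h2 := continuous_rampPoint (u := u) (δ := δ)
  unfold steinLeft; fun_prop

lemma continuous_steinRight : Continuous (steinRight u δ) := by
  have h1 := continuous_normalCDFPrimitive
  have h2 := continuous_rampPoint (u := u) (δ := δ)
  unfold steinRight; fun_prop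

lemma continuous_steinSolution : Continuous (steinSolution u δ) := by
  have h1 := continuous_millsRatio
  have h2 := continuous_steinLeft (u := u) (δ := δ)
  have h3 := continuous_steinRight (u := u) (δ := δ)
  unfold steinSolution; fun_prop

lemma continuous_steinDeriv : Continuous (steinDeriv u δ) := by
  have h1 := continuous_steinSolution (u := u) (δ := δ)
  have h2 := continuous_steinLeft (u := u) (δ := δ)
  have h3 := continuous_steinRight (u := u) (δ := δ)
  unfold steinDeriv; fun_prop

lemma hasDerivWithinAt_steinLeft (hδ : 0 < δ) (x : ℝ) :
    HasDerivWithinAt (steinLeft u δ) (normalCDF x * rampSlope u δ x / δ) (Ici x) x := by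
  have h := (((hasDerivAt_normalCDFPrimitive (rampPoint u δ x)).comp_hasDerivWithinAt x
    (hasDerivWithinAt_rampPoint (u := u) hδ x)).sub_const (normalCDFPrimitive u)).div_const δ
  convert! h using 2
  unfold rampSlope
  split_ifs with hx
  · rw [rampPoint_of_mem hx.1 hx.2.le]
  · simp

lemma hasDerivWithinAt_steinRight (hδ : 0 < δ) (x : ℝ) :
    HasDerivWithinAt (steinRight u δ) (-(normalCDF (-x) * rampSlope u δ x / δ)) (Ici x) x := by
  have h := (((hasDerivAt_normalCDFPrimitive (-rampPoint u δ x)).comp_hasDerivWithinAt x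
    (hasDerivWithinAt_rampPoint (u := u) hδ x).neg).sub_const
      (normalCDFPrimitive (-(u + δ)))).div_const δ
  convert! h using 1
  unfold rampSlope
  split_ifs with hx
  · rw [rampPoint_of_mem hx.1 hx.2.le]; ring
  · simp

lemma hasDerivAt_millsRatio_neg (x : ℝ) :
    HasDerivAt (fun x => millsRatio (-x)) (-(1 + -x * millsRatio (-x))) x := by
  have := (hasDerivAt_millsRatio (-x)).comp x (hasDerivAt_neg x)
  convert! this using 1
  ring

lemma hasDerivWithinAt_steinSolution (hδ : 0 < δ) (x : ℝ) :
    HasDerivWithinAt (steinSolution u δ) (steinDeriv u δ x) (Ici x) x := by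
  have h := ((hasDerivAt_millsRatio_neg x).hasDerivWithinAt.mul
    (hasDerivWithinAt_steinLeft (u := u) hδ x)).add
    ((hasDerivAt_millsRatio x).hasDerivWithinAt.mul (hasDerivWithinAt_steinRight (u := u) hδ x))
  convert! h using 1
  rw [steinDeriv_eq]
  -- The contributions of the moving tail weights cancel, which is why the solution has no kink
  -- although the weights do.
  linear_combination (-(rampSlope u δ x / δ)) * millsRatio_neg_mul x

/-- The right derivative of `steinDeriv`. -/
def steinSecond (u δ x : ℝ) : ℝ :=
  ((1 + x ^ 2) * millsRatio (-x) - x) * steinLeft u δ x +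
    ((1 + x ^ 2) * millsRatio x + x) * steinRight u δ x - rampSlope u δ x / δ

lemma hasDerivWithinAt_steinDeriv (hδ : 0 < δ) (x : ℝ) :
    HasDerivWithinAt (steinDeriv u δ) (steinSecond u δ x) (Ici x) x := by
  have h1 : HasDerivAt (fun x => -(1 + -x * millsRatio (-x)))
      ((1 + x ^ 2) * millsRatio (-x) - x) x := by
    convert! (((hasDerivAt_id x).neg.mul (hasDerivAt_millsRatio_neg x)).const_add 1).neg using 1
    simp; ring
  have h2 : HasDerivAt (fun x => 1 + x * millsRatio x) ((1 + x ^ 2) * millsRatio x + x) x := by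
    convert! ((hasDerivAt_id x).mul (hasDerivAt_millsRatio x)).const_add 1 using 1
    simp; ring
  have h := (h1.hasDerivWithinAt.mul (hasDerivWithinAt_steinLeft (u := u) hδ x)).add
    (h2.hasDerivWithinAt.mul (hasDerivWithinAt_steinRight (u := u) hδ x))
  convert! h using 1
  · ext y; rw [steinDeriv_eq]; rfl
  · unfold steinSecond
    linear_combination (rampSlope u δ x / δ) * normalCDF_add_neg x
      - (x * rampSlope u δ x / δ) * millsRatio_neg_mul x

/-- Both the smooth part and the slope term lie in [0, 1/δ], so their difference has absolute value
at most 1/δ. -/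
lemma abs_steinSecond_le (hδ : 0 < δ) (x : ℝ) : |steinSecond u δ x| ≤ 1 / δ := by
  have h1 := millsRatio_second_nonneg x
  have h2 := millsRatio_second_nonneg (-x)
  have h2' : 0 ≤ (1 + x ^ 2) * millsRatio (-x) - x := by rw [neg_sq] at h2; linarith
  have h3 := steinLeft_nonneg (u := u) hδ x
  have h4 := steinRight_nonneg (u := u) hδ x
  have h5 := mul_le_mul_of_nonneg_left (steinLeft_le_primitive (u := u) hδ x) h2'
  have h6 := mul_le_mul_of_nonneg_left (steinRight_le_primitive (u := u) hδ x) h1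
  have h7 := millsRatio_second_identity x
  have h8 := mul_nonneg h2' h3
  have h9 := mul_nonneg h1 h4
  have h10 : ((1 + x ^ 2) * millsRatio (-x) - x) * (normalCDFPrimitive x / δ) +
      ((1 + x ^ 2) * millsRatio x + x) * (normalCDFPrimitive (-x) / δ) = 1 / δ := by
    linear_combination h7 / δ
  have h11 : 0 ≤ rampSlope u δ x / δ ∧ rampSlope u δ x / δ ≤ 1 / δ := by
    unfold rampSlope
    constructor
    · split_ifs <;> positivity
    · gcongr; split_ifs <;> norm_num
  unfold steinSecond
  rw [abs_le]
  constructor <;> linarith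

lemma abs_steinDeriv_sub_le (hδ : 0 < δ) (x y : ℝ) :
    |steinDeriv u δ y - steinDeriv u δ x| ≤ |y - x| / δ := by
  wlog hxy : x ≤ y generalizing x y
  · rw [abs_sub_comm, abs_sub_comm y]; exact this y x (le_of_not_ge hxy)
  have := norm_image_sub_le_of_norm_deriv_right_le_segment (a := x) (b := y)
    (continuous_steinDeriv (u := u) (δ := δ)).continuousOn
    (fun z _ => hasDerivWithinAt_steinDeriv hδ z)
    (fun z _ => abs_steinSecond_le hδ z) y (right_mem_Icc.2 hxy)
  rw [abs_of_nonneg (sub_nonneg.2 hxy)]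
  calc _ ≤ _ := this
    _ = _ := by ring

lemma steinSolution_taylor (hδ : 0 < δ) (x y : ℝ) :
    |steinSolution u δ y - steinSolution u δ x - (y - x) * steinDeriv u δ x| ≤
      (y - x) ^ 2 / δ := by
  -- Only right derivatives are at hand, so intervals are traversed from left to right. The
  -- expansion point is therefore left free and is taken to be either endpoint.
  have key : ∀ x y p : ℝ, x ≤ y → x ≤ p → p ≤ y →
      |steinSolution u δ y - steinSolution u δ x - (y - x) * steinDeriv u δ p| ≤
        (y - x) ^ 2 / δ := by
    intro x y p hxy hxp hpy
    have := norm_image_sub_le_of_norm_deriv_right_le_segment (a := x) (b := y)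
      (f := fun z => steinSolution u δ z - z * steinDeriv u δ p)
      (f' := fun z => steinDeriv u δ z - steinDeriv u δ p) (C := (y - x) / δ)
      ((continuous_steinSolution (u := u) (δ := δ)).sub
        (continuous_id.mul continuous_const)).continuousOn
      (fun z _ => by
        convert! (hasDerivWithinAt_steinSolution hδ z).sub
          ((hasDerivWithinAt_id z (Ici z)).mul_const (steinDeriv u δ p)) using 1
        simp)
      (fun z hz => by
        refine (abs_steinDeriv_sub_le hδ p z).trans ?_
        gcongr
        rw [abs_le]; constructor <;> linarith [hz.1, hz.2]) y (right_mem_Icc.2 hxy)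
    calc _ = ‖steinSolution u δ y - y * steinDeriv u δ p -
          (steinSolution u δ x - x * steinDeriv u δ p)‖ := by
            rw [Real.norm_eq_abs]; congr 1; ring
      _ ≤ _ := this
      _ = _ := by ring
  rcases le_total x y with h | h
  · exact key x y x h le_rfl h
  · have := key y x x h h le_rfl
    rw [← abs_neg]
    calc _ = _ := by congr 1; ring
      _ ≤ _ := this
      _ = _ := by ring

/-! ### Stein's bound for a finite exchangeable pair -/

variable {ι : Type*} [Fintype ι]

/-- **Stein's method of exchangeable pairs** for a pair with joint weights `P j l` and values
`w j`, `w l`, in terms of a smoothing parameter `δ`. -/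
lemma exchangeable_pair_ramp (P : ι → ι → ℝ) (p w : ι → ℝ) (a : ℝ)
    (hP : ∀ j l, 0 ≤ P j l) (hsymm : ∀ j l, P j l = P l j)
    (ha : 0 < a)
    (hreg : ∀ j, ∑ l, P j l * (w l - w j) = -a * w j * p j) (hδ : 0 < δ) :
    |∑ j, p j * (ramp u δ (w j) - rampMean u δ)| ≤
      ∑ j, |p j - (∑ l, P j l * (w l - w j) ^ 2) / (2 * a)| +
        (∑ j, ∑ l, P j l * |w l - w j| ^ 3) / (2 * a * δ) := by
  set f := steinSolution u δ
  set f' := steinDeriv u δ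
  -- Exchangeability: the summand changes sign when the two members of the pair are interchanged.
  have hanti : ∑ j, ∑ l, P j l * ((w l - w j) * (f (w l) + f (w j))) = 0 := by
    have : ∑ j, ∑ l, P j l * ((w l - w j) * (f (w l) + f (w j))) =
        -∑ j, ∑ l, P j l * ((w l - w j) * (f (w l) + f (w j))) := by
      conv_lhs => rw [Finset.sum_comm]
      rw [← Finset.sum_neg_distrib]
      refine Finset.sum_congr rfl fun j _ => ?_
      rw [← Finset.sum_neg_distrib]
      refine Finset.sum_congr rfl fun l _ => ?_
      rw [hsymm l j]; ring
    linarith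
  have hlin : ∑ j, ∑ l, P j l * ((w l - w j) * (2 * f (w j))) =
      -(2 * a) * ∑ j, p j * (w j * f (w j)) := by
    rw [Finset.mul_sum]
    refine Finset.sum_congr rfl fun j _ => ?_
    calc _ = (∑ l, P j l * (w l - w j)) * (2 * f (w j)) := by
          rw [Finset.sum_mul]; exact Finset.sum_congr rfl fun l _ => by ring
      _ = _ := by rw [hreg]; ring
  have hsplit : ∑ j, ∑ l, P j l * ((w l - w j) * (f (w l) - f (w j))) =
      2 * a * ∑ j, p j * (w j * f (w j)) := by
    have : ∑ j, ∑ l, P j l * ((w l - w j) * (f (w l) - f (w j))) =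
        ∑ j, ∑ l, P j l * ((w l - w j) * (f (w l) + f (w j))) -
          ∑ j, ∑ l, P j l * ((w l - w j) * (2 * f (w j))) := by
      rw [← Finset.sum_sub_distrib]
      refine Finset.sum_congr rfl fun j _ => ?_
      rw [← Finset.sum_sub_distrib]
      exact Finset.sum_congr rfl fun l _ => by ring
    rw [this, hanti, hlin]; ring
  -- Expand f(w_l) - f(w_j) to first order: the linear term gives the conditional second moment
  -- times f', and the Taylor remainder gives the third moment.
  have hmain : ∑ j, p j * (ramp u δ (w j) - rampMean u δ) =
      ∑ j, (p j - (∑ l, P j l * (w l - w j) ^ 2) / (2 * a)) * f' (w j) -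
        (∑ j, ∑ l, P j l * ((w l - w j) *
          (f (w l) - f (w j) - (w l - w j) * f' (w j)))) / (2 * a) := by
    have h1 : ∑ j, ∑ l, P j l * ((w l - w j) * (f (w l) - f (w j) - (w l - w j) * f' (w j))) =
        ∑ j, ∑ l, P j l * ((w l - w j) * (f (w l) - f (w j))) -
          ∑ j, (∑ l, P j l * (w l - w j) ^ 2) * f' (w j) := by
      rw [← Finset.sum_sub_distrib]
      refine Finset.sum_congr rfl fun j _ => ?_
      rw [Finset.sum_mul, ← Finset.sum_sub_distrib]
      exact Finset.sum_congr rfl fun l _ => by ring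
    rw [h1, hsplit, sub_div, mul_div_cancel_left₀ _ (by positivity), Finset.sum_div,
      ← sub_add, ← Finset.sum_sub_distrib, ← Finset.sum_add_distrib]
    refine Finset.sum_congr rfl fun j _ => ?_
    rw [← stein_equation (w j) hδ]
    ring
  rw [hmain]
  refine (abs_sub _ _).trans (add_le_add ?_ ?_)
  · refine (Finset.abs_sum_le_sum_abs _ _).trans (Finset.sum_le_sum fun j _ => ?_)
    rw [abs_mul]
    exact mul_le_of_le_one_right (abs_nonneg _) (abs_steinDeriv_le_one hδ _)
  · rw [abs_div, abs_of_pos (show 0 < 2 * a by positivity), mul_comm (2 * a) δ,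
      ← div_div _ δ]
    refine div_le_div_of_nonneg_right ?_ (by positivity)
    rw [Finset.sum_div]
    refine (Finset.abs_sum_le_sum_abs _ _).trans (Finset.sum_le_sum fun j _ => ?_)
    rw [Finset.sum_div]
    refine (Finset.abs_sum_le_sum_abs _ _).trans (Finset.sum_le_sum fun l _ => ?_)
    rw [abs_mul, abs_of_nonneg (hP j l), abs_mul, mul_div_assoc]
    refine mul_le_mul_of_nonneg_left ?_ (hP j l)
    calc _ ≤ |w l - w j| * ((w l - w j) ^ 2 / δ) :=
          mul_le_mul_of_nonneg_left (steinSolution_taylor hδ _ _) (abs_nonneg _)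
      _ = _ := by rw [← sq_abs]; ring

open Classical in
/-- **Stein's method of exchangeable pairs**: a Berry-Esseen bound. -/
theorem exchangeable_pair_normal (P : ι → ι → ℝ) (p w : ι → ℝ) (a : ℝ)
    (hP : ∀ j l, 0 ≤ P j l) (hsymm : ∀ j l, P j l = P l j)
    (hmarg : ∀ j, ∑ l, P j l = p j) (hp : ∑ j, p j = 1) (ha : 0 < a)
    (hreg : ∀ j, ∑ l, P j l * (w l - w j) = -a * w j * p j) (hδ : 0 < δ) (x₀ : ℝ) :
    |∑ j with w j ≤ x₀, p j - normalCDF x₀| ≤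
      ∑ j, |p j - (∑ l, P j l * (w l - w j) ^ 2) / (2 * a)| +
        (∑ j, ∑ l, P j l * |w l - w j| ^ 3) / (2 * a * δ) + δ := by
  have hpn : ∀ j, 0 ≤ p j := fun j => by rw [← hmarg]; exact Finset.sum_nonneg fun l _ => hP j l
  have hmean : ∀ u, ∑ j, p j * (ramp u δ (w j) - rampMean u δ) =
      ∑ j, p j * ramp u δ (w j) - rampMean u δ := fun u => by
    simp_rw [mul_sub]; rw [Finset.sum_sub_distrib, ← Finset.sum_mul, hp, one_mul]
  -- The indicator of w ≤ x₀ lies between the ramps starting at x₀ - δ and at x₀. Passing from their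
  -- means to Φ(x₀) costs δ, because the density is at most 1.
  have h1 := exchangeable_pair_ramp (u := x₀) P p w a hP hsymm ha hreg hδ
  have h2 := exchangeable_pair_ramp (u := x₀ - δ) P p w a hP hsymm ha hreg hδ
  rw [hmean, abs_le] at h1 h2
  have h3 : ∑ j with w j ≤ x₀, p j ≤ ∑ j, p j * ramp x₀ δ (w j) := by
    rw [Finset.sum_filter]
    refine Finset.sum_le_sum fun j _ => ?_
    split_ifs with hj
    · rw [ramp_of_le hδ hj, mul_one]
    · exact mul_nonneg (hpn j) (ramp_mem hδ _).1
  have h4 : ∑ j, p j * ramp (x₀ - δ) δ (w j) ≤ ∑ j with w j ≤ x₀, p j := by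
    rw [Finset.sum_filter]
    refine Finset.sum_le_sum fun j _ => ?_
    split_ifs with hj
    · exact mul_le_of_le_one_right (hpn j) (ramp_mem hδ _).2
    · rw [ramp_of_ge hδ (by linarith [not_le.1 hj]), mul_zero]
  have h5 := rampMean_le_normalCDF (u := x₀) hδ
  have h6 := normalCDF_add_le x₀ hδ.le
  have h7 := normalCDF_le_rampMean (u := x₀ - δ) hδ
  have h8 := normalCDF_add_le (x₀ - δ) hδ.le
  rw [sub_add_cancel] at h8
  rw [abs_le]
  constructor <;> linarith [h1.1, h1.2, h2.1, h2.2]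

end

noncomputable section

/-! ### Spectral exchangeable pairs -/

section Spectral

variable {X : Type*} [Fintype X] [DecidableEq X] {W : Matrix X X ℝ} (hW : W.IsHermitian)

namespace Matrix.IsHermitian

lemma sum_eigenvectorBasis_mul (x y : X) :
    ∑ j, hW.eigenvectorBasis j x * hW.eigenvectorBasis j y = (1 : Matrix X X ℝ) x y := by
  have h := (Matrix.mem_unitaryGroup_iff.1 hW.eigenvectorUnitary.2)
  have h2 := congrFun (congrFun h x) y
  rw [Matrix.mul_apply] at h2
  rw [← h2]
  refine Finset.sum_congr rfl fun j _ => ?_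
  rw [Matrix.star_apply, eigenvectorUnitary_apply, eigenvectorUnitary_apply, star_trivial]

lemma sum_eigenvectorBasis_sq (j : X) : ∑ x, hW.eigenvectorBasis j x ^ 2 = 1 := by
  have h := hW.eigenvectorBasis.orthonormal.1 j
  rw [EuclideanSpace.norm_eq, Real.sqrt_eq_one] at h
  simpa using h

lemma sum_mul_eigenvectorBasis (j x : X) :
    ∑ y, W x y * hW.eigenvectorBasis j y = hW.eigenvalues j * hW.eigenvectorBasis j x := by
  have := congrFun (hW.mulVec_eigenvectorBasis j) x
  simpa [Matrix.mulVec, dotProduct] using this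

lemma pow_apply (p : ℕ) (x y : X) :
    (W ^ p) x y =
      ∑ j, hW.eigenvalues j ^ p * (hW.eigenvectorBasis j x * hW.eigenvectorBasis j y) := by
  induction p generalizing x with
  | zero => simp [sum_eigenvectorBasis_mul]
  | succ p ih =>
    rw [pow_succ', Matrix.mul_apply]
    simp_rw [ih, Finset.mul_sum]
    rw [Finset.sum_comm]
    refine Finset.sum_congr rfl fun j _ => ?_
    calc _ = (∑ z, W x z * hW.eigenvectorBasis j z) *
          (hW.eigenvalues j ^ p * hW.eigenvectorBasis j y) := by
            rw [Finset.sum_mul]; exact Finset.sum_congr rfl fun z _ => by ring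
      _ = _ := by rw [sum_mul_eigenvectorBasis]; ring

lemma sum_pow_apply (p : ℕ) (j : X) :
    ∑ x, ∑ y, (W ^ p) x y * (hW.eigenvectorBasis j x * hW.eigenvectorBasis j y) =
      hW.eigenvalues j ^ p := by
  have h : ∀ x, ∑ y, (W ^ p) x y * hW.eigenvectorBasis j y =
      hW.eigenvalues j ^ p * hW.eigenvectorBasis j x := by
    induction p with
    | zero => intro x; simp [Matrix.one_apply]
    | succ p ih =>
      intro x
      rw [pow_succ']
      simp_rw [Matrix.mul_apply, Finset.sum_mul]
      rw [Finset.sum_comm]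
      calc _ = ∑ z, W x z * ∑ y, (W ^ p) z y * hW.eigenvectorBasis j y := by
            refine Finset.sum_congr rfl fun z _ => ?_
            rw [Finset.mul_sum]; exact Finset.sum_congr rfl fun y _ => by ring
        _ = hW.eigenvalues j ^ p * ∑ z, W x z * hW.eigenvectorBasis j z := by
            rw [Finset.mul_sum]
            exact Finset.sum_congr rfl fun z _ => by rw [ih]; ring
        _ = _ := by rw [sum_mul_eigenvectorBasis]; ring
  calc _ = ∑ x, hW.eigenvectorBasis j x * ∑ y, (W ^ p) x y * hW.eigenvectorBasis j y := by
        refine Finset.sum_congr rfl fun x _ => ?_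
        rw [Finset.mul_sum]; exact Finset.sum_congr rfl fun y _ => by ring
    _ = hW.eigenvalues j ^ p * ∑ x, hW.eigenvectorBasis j x ^ 2 := by
        rw [Finset.mul_sum]
        exact Finset.sum_congr rfl fun x _ => by rw [h]; ring
    _ = _ := by rw [sum_eigenvectorBasis_sq, mul_one]

/-- The joint weights of the exchangeable pair of eigenvalues of `W` driven by `Φ`. -/
def pairWeight (Φ : Matrix X X ℝ) (j l : X) : ℝ :=
  (Fintype.card X : ℝ)⁻¹ * ∑ x, ∑ y, Φ x y *
    ((hW.eigenvectorBasis j x * hW.eigenvectorBasis j y) *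
      (hW.eigenvectorBasis l x * hW.eigenvectorBasis l y))

lemma pairWeight_comm (Φ : Matrix X X ℝ) (j l : X) :
    hW.pairWeight Φ j l = hW.pairWeight Φ l j := by
  unfold pairWeight
  congr 1
  exact Finset.sum_congr rfl fun x _ => Finset.sum_congr rfl fun y _ => by ring

/-- A Gram matrix Φ turns the double sum into a sum of squares. -/
lemma pairWeight_nonneg {Φ : Matrix X X ℝ} {E : Type*} [Fintype E] {v : E → X → ℝ}
    (hΦ : ∀ x y, Φ x y = ∑ e, v e x * v e y) (j l : X) : 0 ≤ hW.pairWeight Φ j l := by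
  have h : ∑ x, ∑ y, Φ x y * ((hW.eigenvectorBasis j x * hW.eigenvectorBasis j y) *
      (hW.eigenvectorBasis l x * hW.eigenvectorBasis l y)) =
      ∑ e, (∑ x, v e x * (hW.eigenvectorBasis j x * hW.eigenvectorBasis l x)) ^ 2 := by
    simp_rw [hΦ, Finset.sum_mul, sq, Finset.sum_mul_sum]
    conv_rhs => rw [Finset.sum_comm]
    refine Finset.sum_congr rfl fun x _ => ?_
    conv_rhs => rw [Finset.sum_comm]
    exact Finset.sum_congr rfl fun y _ => Finset.sum_congr rfl fun e _ => by ring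
  unfold pairWeight
  rw [h]
  positivity

/-- Summing over l reassembles the spectral expansion of W^q. Conditional moments are thus quadratic
forms, at the j-th eigenvector, of the Schur product of Φ with W^q. -/
lemma sum_pairWeight_mul_pow (Φ : Matrix X X ℝ) (j : X) (q : ℕ) :
    ∑ l, hW.pairWeight Φ j l * hW.eigenvalues l ^ q =
      (Fintype.card X : ℝ)⁻¹ * ∑ x, ∑ y, Φ x y * (W ^ q) x y *
        (hW.eigenvectorBasis j x * hW.eigenvectorBasis j y) := by
  unfold pairWeight
  simp_rw [mul_assoc, ← Finset.mul_sum, Finset.sum_mul]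
  congr 1
  rw [Finset.sum_comm]
  refine Finset.sum_congr rfl fun x _ => ?_
  rw [Finset.sum_comm]
  refine Finset.sum_congr rfl fun y _ => ?_
  rw [hW.pow_apply, Finset.sum_mul, Finset.mul_sum]
  exact Finset.sum_congr rfl fun l _ => by ring

lemma sum_sum_pairWeight_mul_pow (Φ : Matrix X X ℝ) (p q : ℕ) :
    ∑ j, ∑ l, hW.pairWeight Φ j l * (hW.eigenvalues j ^ p * hW.eigenvalues l ^ q) =
      (Fintype.card X : ℝ)⁻¹ * ∑ x, ∑ y, Φ x y * ((W ^ p) x y * (W ^ q) x y) := by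
  calc _ = ∑ j, hW.eigenvalues j ^ p *
        ∑ l, hW.pairWeight Φ j l * hW.eigenvalues l ^ q := by
        refine Finset.sum_congr rfl fun j _ => ?_
        rw [Finset.mul_sum]; exact Finset.sum_congr rfl fun l _ => by ring
    _ = _ := by
        simp_rw [sum_pairWeight_mul_pow, hW.pow_apply p, mul_left_comm _ (Fintype.card X : ℝ)⁻¹,
          ← Finset.mul_sum]
        congr 1
        simp_rw [Finset.mul_sum]
        rw [Finset.sum_comm]
        refine Finset.sum_congr rfl fun x _ => ?_
        rw [Finset.sum_comm]
        refine Finset.sum_congr rfl fun y _ => ?_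
        rw [Finset.sum_mul, Finset.mul_sum]
        exact Finset.sum_congr rfl fun j _ => by ring

/-- The left side keeps only the diagonal entries of E in the eigenbasis, and the Hilbert–Schmidt
norm does not depend on the orthonormal basis. -/
lemma sum_sq_quadraticForm_le (E : Matrix X X ℝ) :
    ∑ j, (∑ x, ∑ y, E x y * (hW.eigenvectorBasis j x * hW.eigenvectorBasis j y)) ^ 2 ≤
      ∑ x, ∑ y, E x y ^ 2 := by
  have h1 : ∀ j, (∑ x, ∑ y, E x y * (hW.eigenvectorBasis j x * hW.eigenvectorBasis j y)) ^ 2 ≤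
      ∑ x, (∑ y, E x y * hW.eigenvectorBasis j y) ^ 2 := by
    intro j
    calc _ = (∑ x, hW.eigenvectorBasis j x * ∑ y, E x y * hW.eigenvectorBasis j y) ^ 2 := by
          congr 1
          refine Finset.sum_congr rfl fun x _ => ?_
          rw [Finset.mul_sum]; exact Finset.sum_congr rfl fun y _ => by ring
      _ ≤ (∑ x, hW.eigenvectorBasis j x ^ 2) *
            ∑ x, (∑ y, E x y * hW.eigenvectorBasis j y) ^ 2 :=
          Finset.sum_mul_sq_le_sq_mul_sq _ _ _
      _ = _ := by rw [sum_eigenvectorBasis_sq, one_mul]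
  refine (Finset.sum_le_sum fun j _ => h1 j).trans_eq ?_
  rw [Finset.sum_comm]
  refine Finset.sum_congr rfl fun x _ => ?_
  calc _ = ∑ j, ∑ y, ∑ z, E x y * E x z *
        (hW.eigenvectorBasis j y * hW.eigenvectorBasis j z) := by
        refine Finset.sum_congr rfl fun j _ => ?_
        rw [sq, Finset.sum_mul_sum]
        exact Finset.sum_congr rfl fun y _ => Finset.sum_congr rfl fun z _ => by ring
    _ = ∑ y, ∑ z, E x y * E x z * (1 : Matrix X X ℝ) y z := by
        rw [Finset.sum_comm]
        refine Finset.sum_congr rfl fun y _ => ?_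
        rw [Finset.sum_comm]
        refine Finset.sum_congr rfl fun z _ => ?_
        rw [← Finset.mul_sum, sum_eigenvectorBasis_mul]
    _ = _ := by simp [Matrix.one_apply, sq]

/-- A Berry-Esseen bound for the eigenvalues of a symmetric matrix `W` with `(W²)ₓₓ = 1` that is an
eigenvector of Schur multiplication by a Gram matrix `Φ` with unit diagonal. -/
theorem eigenvalue_normal_bound [Nonempty X] {Φ : Matrix X X ℝ} {E : Type*} [Fintype E]
    {v : E → X → ℝ} (hΦ : ∀ x y, Φ x y = ∑ e, v e x * v e y) (hdiag : ∀ x, Φ x x = 1) {a : ℝ}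
    (ha : 0 < a) (hΦW : ∀ x y, Φ x y * W x y = (1 - a) * W x y) (hunit : ∀ x, (W ^ 2) x x = 1)
    {V F : ℝ}
    (hV : (Fintype.card X : ℝ)⁻¹ * ∑ x, ∑ y,
      (if x = y then 0 else ((W ^ 2) x y * (Φ x y - 1 + 2 * a)) ^ 2) ≤ V * (2 * a) ^ 2)
    (hF : (Fintype.card X : ℝ)⁻¹ * ∑ x, ∑ y, (W ^ 2) x y ^ 2 * (8 * a - 6 + 6 * Φ x y) ≤ F)
    {δ : ℝ} (hδ : 0 < δ) (x₀ : ℝ) :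
    |(Finset.univ.filter fun j => hW.eigenvalues j ≤ x₀).card / (Fintype.card X : ℝ)
        - normalCDF x₀| ≤ √V + √(2 * a * F) / (2 * a * δ) + δ := by
  set N : ℝ := (Fintype.card X : ℝ)
  have hN : 0 < N := Nat.cast_pos.2 Fintype.card_pos
  set w := hW.eigenvalues
  set U := fun j x => hW.eigenvectorBasis j x
  set P := hW.pairWeight Φ
  have hmarg : ∀ j, ∑ l, P j l = N⁻¹ := by
    intro j
    have h := hW.sum_pairWeight_mul_pow Φ j 0
    simp only [pow_zero, mul_one, Matrix.one_apply, mul_ite, mul_zero, ite_mul, zero_mul,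
      Finset.sum_ite_eq, Finset.mem_univ, if_true, hdiag, one_mul] at h
    rw [h]
    simp_rw [← sq]
    rw [sum_eigenvectorBasis_sq, mul_one]
  have hlin : ∀ j, ∑ l, P j l * w l = N⁻¹ * ((1 - a) * w j) := by
    intro j
    have h := hW.sum_pairWeight_mul_pow Φ j 1
    simp only [pow_one, hΦW] at h
    rw [h]
    have h2 := hW.sum_pow_apply 1 j
    simp only [pow_one] at h2
    congr 1
    simp only [w]
    rw [← h2]
    simp_rw [Finset.mul_sum]
    exact Finset.sum_congr rfl fun x _ => Finset.sum_congr rfl fun y _ => by ring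
  have hsq : ∀ j, ∑ l, P j l * (w l - w j) ^ 2 = N⁻¹ * ∑ x, ∑ y,
      (W ^ 2) x y * (Φ x y - 1 + 2 * a) * (U j x * U j y) := by
    intro j
    have h1 : ∑ l, P j l * (w l - w j) ^ 2 = ∑ l, P j l * w l ^ 2 -
        2 * w j * ∑ l, P j l * w l + w j ^ 2 * ∑ l, P j l := by
      rw [Finset.mul_sum, Finset.mul_sum, ← Finset.sum_sub_distrib, ← Finset.sum_add_distrib]
      exact Finset.sum_congr rfl fun l _ => by ring
    have h2 : ∑ x, ∑ y, (W ^ 2) x y * (Φ x y - 1 + 2 * a) * (U j x * U j y) =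
        ∑ x, ∑ y, Φ x y * (W ^ 2) x y * (U j x * U j y) -
          (1 - 2 * a) * ∑ x, ∑ y, (W ^ 2) x y * (U j x * U j y) := by
      simp_rw [Finset.mul_sum, ← Finset.sum_sub_distrib]
      exact Finset.sum_congr rfl fun x _ => Finset.sum_congr rfl fun y _ => by ring
    rw [h1, hmarg, hlin, hW.sum_pairWeight_mul_pow Φ j 2, h2, hW.sum_pow_apply 2 j]
    ring
  have hreg : ∀ j, ∑ l, P j l * (w l - w j) = -a * w j * N⁻¹ := by
    intro j
    simp_rw [mul_sub]
    rw [Finset.sum_sub_distrib, ← Finset.sum_mul, hmarg, hlin]; ring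
  have hpn : ∀ j l, 0 ≤ P j l := hW.pairWeight_nonneg hΦ
  have hbound := exchangeable_pair_normal P (fun _ => N⁻¹) w a hpn (hW.pairWeight_comm Φ)
    hmarg (by simp [N]) ha hreg hδ x₀
  have hcard : ∑ j with w j ≤ x₀, N⁻¹ = (Finset.univ.filter fun j => w j ≤ x₀).card / N := by
    rw [Finset.sum_const, nsmul_eq_mul, div_eq_mul_inv]
  have hfst : ∑ j, |N⁻¹ - (∑ l, P j l * (w l - w j) ^ 2) / (2 * a)| ≤ √V := by
    -- The constant 1 is the quadratic form of the identity at a unit vector. Subtracting it as a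
    -- matrix makes the diagonal of D vanish, so only pairs x ≠ y enter V.
    set D : Matrix X X ℝ := fun x y =>
      (1 : Matrix X X ℝ) x y - (W ^ 2) x y * (Φ x y - 1 + 2 * a) / (2 * a)
    have h1 : ∀ j, N⁻¹ - (∑ l, P j l * (w l - w j) ^ 2) / (2 * a) =
        N⁻¹ * ∑ x, ∑ y, D x y * (U j x * U j y) := by
      intro j
      rw [hsq]
      simp only [D, sub_mul, Finset.sum_sub_distrib]
      have h3 : ∑ x, ∑ y, (1 : Matrix X X ℝ) x y * (U j x * U j y) = 1 := by
        simpa using hW.sum_pow_apply 0 j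
      rw [h3, mul_sub, mul_one, mul_div_assoc]
      congr 2
      simp_rw [Finset.sum_div]
      exact Finset.sum_congr rfl fun x _ => Finset.sum_congr rfl fun y _ => by ring
    have h2 : ∀ x y, D x y ^ 2 =
        (if x = y then 0 else ((W ^ 2) x y * (Φ x y - 1 + 2 * a)) ^ 2) / (2 * a) ^ 2 := by
      intro x y
      simp only [D, Matrix.one_apply]
      split_ifs with h
      · subst h
        rw [hunit, hdiag, zero_div, sq_eq_zero_iff, one_mul, sub_self, zero_add,
          div_self (by positivity), sub_self]
      · rw [zero_sub, neg_sq, div_pow]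
    simp_rw [h1, abs_mul, abs_of_pos (inv_pos.2 hN)]
    rw [← Finset.mul_sum]
    apply Real.le_sqrt_of_sq_le
    calc (N⁻¹ * ∑ j, |∑ x, ∑ y, D x y * (U j x * U j y)|) ^ 2
        = N⁻¹ ^ 2 * (∑ j, |∑ x, ∑ y, D x y * (U j x * U j y)|) ^ 2 := mul_pow _ _ _
      _ ≤ N⁻¹ ^ 2 * (N * ∑ j, |∑ x, ∑ y, D x y * (U j x * U j y)| ^ 2) := by
          gcongr
          simpa using sq_sum_le_card_mul_sum_sq (s := Finset.univ)
            (f := fun j => |∑ x, ∑ y, D x y * (U j x * U j y)|)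
      _ = N⁻¹ * ∑ j, (∑ x, ∑ y, D x y * (U j x * U j y)) ^ 2 := by
          simp_rw [sq_abs]; field_simp
      _ ≤ N⁻¹ * ∑ x, ∑ y, D x y ^ 2 := by
          exact mul_le_mul_of_nonneg_left (hW.sum_sq_quadraticForm_le D) (inv_pos.2 hN).le
      _ ≤ V := by
          simp_rw [h2, ← Finset.sum_div]
          rw [← mul_div_assoc, div_le_iff₀ (by positivity)]
          exact hV
  -- Completeness of the eigenbasis leaves only x = y, where (W²)ₓₓ = Φₓₓ = 1.
  have hsec : ∑ j, ∑ l, P j l * (w l - w j) ^ 2 = 2 * a := by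
    simp_rw [hsq]
    rw [← Finset.mul_sum, Finset.sum_comm]
    have : ∀ x, ∑ j, ∑ y, (W ^ 2) x y * (Φ x y - 1 + 2 * a) * (U j x * U j y) = 2 * a := by
      intro x
      rw [Finset.sum_comm]
      simp_rw [← Finset.mul_sum]
      simp_rw [U, hW.sum_eigenvectorBasis_mul]
      simp [Matrix.one_apply, hunit, hdiag]
    simp_rw [this]
    simp only [Finset.sum_const, Finset.card_univ, nsmul_eq_mul]
    rw [← mul_assoc, inv_mul_cancel₀ hN.ne', one_mul]
  -- In the binomial expansion every term except the middle one is a multiple of the trace of W⁴,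
  -- the mixed ones carrying a factor 1 - a. The total coefficient is 2 - 8(1 - a) = 8a - 6.
  have hfourth : ∑ j, ∑ l, P j l * (w l - w j) ^ 4 ≤ F := by
    refine le_trans (le_of_eq ?_) hF
    have h1 : ∑ j, ∑ l, P j l * (w l - w j) ^ 4 =
        ∑ j, ∑ l, P j l * (w j ^ 0 * w l ^ 4) + ∑ j, ∑ l, P j l * (w j ^ 4 * w l ^ 0)
        - 4 * ∑ j, ∑ l, P j l * (w j ^ 1 * w l ^ 3) - 4 * ∑ j, ∑ l, P j l * (w j ^ 3 * w l ^ 1)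
        + 6 * ∑ j, ∑ l, P j l * (w j ^ 2 * w l ^ 2) := by
      simp_rw [Finset.mul_sum, ← Finset.sum_add_distrib, ← Finset.sum_sub_distrib,
        ← Finset.sum_add_distrib]
      exact Finset.sum_congr rfl fun j _ => Finset.sum_congr rfl fun l _ => by ring
    have hsym : ∀ p x y, (W ^ p) x y = (W ^ p) y x := fun p x y => by
      rw [hW.pow_apply, hW.pow_apply]; exact Finset.sum_congr rfl fun j _ => by ring
    have h4 : ∑ x, (W ^ 4) x x = ∑ x, ∑ y, (W ^ 2) x y ^ 2 := by
      refine Finset.sum_congr rfl fun x _ => ?_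
      rw [show W ^ 4 = W ^ 2 * W ^ 2 by rw [← pow_add], Matrix.mul_apply]
      exact Finset.sum_congr rfl fun y _ => by rw [hsym 2 y x]; ring
    have h4' : ∑ x, ∑ y, W x y * (W ^ 3) x y = ∑ x, ∑ y, (W ^ 2) x y ^ 2 := by
      rw [← h4]
      refine Finset.sum_congr rfl fun x _ => ?_
      rw [show 4 = 1 + 3 from rfl, pow_add, Matrix.mul_apply, pow_one]
      exact Finset.sum_congr rfl fun y _ => by rw [hsym 3 y x]
    rw [h1]
    simp_rw [P, w, sum_sum_pairWeight_mul_pow, pow_zero, pow_one]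
    have e1 : ∑ x, ∑ y, Φ x y * ((1 : Matrix X X ℝ) x y * (W ^ 4) x y) =
        ∑ x, ∑ y, (W ^ 2) x y ^ 2 := by
      rw [← h4]; simp [Matrix.one_apply, hdiag]
    have e2 : ∑ x, ∑ y, Φ x y * ((W ^ 4) x y * (1 : Matrix X X ℝ) x y) =
        ∑ x, ∑ y, (W ^ 2) x y ^ 2 := by
      rw [← h4]; simp [Matrix.one_apply, hdiag]
    have e3 : ∑ x, ∑ y, Φ x y * (W x y * (W ^ 3) x y) =
        (1 - a) * ∑ x, ∑ y, (W ^ 2) x y ^ 2 := by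
      rw [← h4']
      simp_rw [← mul_assoc, hΦW, Finset.mul_sum, mul_assoc]
    have e4 : ∑ x, ∑ y, Φ x y * ((W ^ 3) x y * W x y) =
        (1 - a) * ∑ x, ∑ y, (W ^ 2) x y ^ 2 := by
      rw [← e3]
      exact Finset.sum_congr rfl fun x _ => Finset.sum_congr rfl fun y _ => by ring
    rw [e1, e2, e3, e4]
    have e5 : ∑ x, ∑ y, (W ^ 2) x y ^ 2 * (8 * a - 6 + 6 * Φ x y) =
        (8 * a - 6) * ∑ x, ∑ y, (W ^ 2) x y ^ 2 +
          6 * ∑ x, ∑ y, Φ x y * ((W ^ 2) x y * (W ^ 2) x y) := by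
      simp_rw [Finset.mul_sum, ← Finset.sum_add_distrib]
      exact Finset.sum_congr rfl fun x _ => Finset.sum_congr rfl fun y _ => by ring
    rw [e5]
    ring
  -- Cauchy–Schwarz under the weights P, applied to |w_l - w_j| and (w_l - w_j)².
  have hthird : ∑ j, ∑ l, P j l * |w l - w j| ^ 3 ≤ √(2 * a * F) := by
    apply Real.le_sqrt_of_sq_le
    rw [← Finset.sum_product', ← hsec]
    have hcs := Finset.sum_mul_sq_le_sq_mul_sq (Finset.univ ×ˢ Finset.univ : Finset (X × X))
      (fun z => √(P z.1 z.2) * |w z.2 - w z.1|) (fun z => √(P z.1 z.2) * (w z.2 - w z.1) ^ 2)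
    refine le_trans (le_of_eq ?_) (hcs.trans ?_)
    · congr 1
      refine Finset.sum_congr rfl fun z _ => ?_
      rw [← sq_abs (w z.2 - w z.1)]
      nth_rewrite 1 [← Real.mul_self_sqrt (hpn z.1 z.2)]
      ring
    · refine mul_le_mul (le_of_eq ?_) (le_trans (le_of_eq ?_) hfourth)
        (Finset.sum_nonneg fun z _ => sq_nonneg _)
        (Finset.sum_nonneg fun j _ => Finset.sum_nonneg fun l _ =>
          mul_nonneg (hpn j l) (sq_nonneg _))
      · rw [← Finset.sum_product']
        refine Finset.sum_congr rfl fun z _ => ?_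
        rw [mul_pow, Real.sq_sqrt (hpn _ _), sq_abs]
      · rw [← Finset.sum_product']
        refine Finset.sum_congr rfl fun z _ => ?_
        rw [mul_pow, Real.sq_sqrt (hpn _ _)]; ring
  rw [hcard] at hbound
  refine hbound.trans ?_
  gcongr

end Matrix.IsHermitian

end Spectral

end

noncomputable section

set_option linter.unusedSectionVars false

/-! ### Pairs of fixed point free involutions -/

section Involutions

variable {α : Type*}

/-- A fixed point free involution. -/
def IsMatchingPerm (σ : Equiv.Perm α) : Prop := (∀ v, σ (σ v) = v) ∧ ∀ v, σ v ≠ v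

variable {σ τ ρ : Equiv.Perm α}

lemma IsMatchingPerm.apply_eq_iff (hσ : IsMatchingPerm σ) {v w : α} : σ v = w ↔ v = σ w :=
  ⟨fun h => by rw [← h, hσ.1], fun h => by rw [h, hσ.1]⟩

lemma IsMatchingPerm.inv_eq (hσ : IsMatchingPerm σ) : σ⁻¹ = σ := by
  ext v; rw [Equiv.Perm.inv_eq_iff_eq, hσ.1]

/-- The two involutions generate a dihedral group, in which σ inverts the rotation τσ. -/
lemma IsMatchingPerm.apply_zpow (hσ : IsMatchingPerm σ) (hτ : IsMatchingPerm τ) (k : ℤ) (v : α) :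
    σ (((τ * σ) ^ k) v) = ((τ * σ) ^ (-k)) (σ v) := by
  have h : σ * (τ * σ) * σ⁻¹ = (τ * σ)⁻¹ := by
    rw [mul_inv_rev, hτ.inv_eq, hσ.inv_eq]
    ext w; simp [hσ.1]
  have h2 : σ * (τ * σ) ^ k * σ⁻¹ = (τ * σ) ^ (-k) := by
    rw [← conj_zpow, h, inv_zpow, zpow_neg]
  rw [← h2]; simp

/-- Otherwise the arc from v to σ v has a midpoint fixed by a reflection: by σ when k is even, by τ
when k is odd. -/
lemma IsMatchingPerm.apply_ne_zpow (hσ : IsMatchingPerm σ) (hτ : IsMatchingPerm τ) (k : ℤ)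
    (v : α) : σ v ≠ ((τ * σ) ^ k) v := by
  intro h
  obtain ⟨l, hl | hl⟩ := Int.even_or_odd' k
  · apply hσ.2 (((τ * σ) ^ l) v)
    rw [hσ.apply_zpow hτ, h, ← Equiv.Perm.mul_apply, ← zpow_add]
    congr 2; omega
  · apply hτ.2 (σ (((τ * σ) ^ l) v))
    have : σ (((τ * σ) ^ l) v) = ((τ * σ) ^ (1 + l)) v := by
      rw [hσ.apply_zpow hτ, h, ← Equiv.Perm.mul_apply, ← zpow_add]
      congr 2; omega
    nth_rewrite 2 [this]
    rw [zpow_add, zpow_one]; rfl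

/-- The union of two perfect matchings is bipartite. -/
lemma IsMatchingPerm.exists_bipartition [Finite α] (hσ : IsMatchingPerm σ)
    (hτ : IsMatchingPerm τ) :
    ∃ B : Set α, (∀ v, σ v ∈ B ↔ v ∉ B) ∧ ∀ v, τ v ∈ B ↔ v ∉ B := by
  classical
  -- Each cycle of the union splits into two orbits of τσ, exchanged by both σ and τ. The set B
  -- takes from each such pair of orbits the one with the smaller label.
  let q : α → Quotient (Equiv.Perm.SameCycle.setoid (τ * σ)) := fun v => Quotient.mk _ v
  have hq : ∀ v w, q v = q w ↔ ∃ k : ℤ, ((τ * σ) ^ k) v = w := fun v w => Quotient.eq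
  obtain ⟨N, ⟨e⟩⟩ := Finite.exists_equiv_fin (Quotient (Equiv.Perm.SameCycle.setoid (τ * σ)))
  have hne : ∀ v, e (q v) ≠ e (q (σ v)) := by
    intro v h
    obtain ⟨k, hk⟩ := (hq _ _).1 (e.injective h)
    exact hσ.apply_ne_zpow hτ k v hk.symm
  have h1 : ∀ v, q (τ v) = q (σ v) := fun v => ((hq _ _).2 ⟨1, by simp [hσ.1]⟩).symm
  have h2 : ∀ v, q (σ (τ v)) = q v := fun v => (hq _ _).2 ⟨1, by simp [hσ.1, hτ.1]⟩
  refine ⟨{v | e (q v) < e (q (σ v))}, fun v => ?_, fun v => ?_⟩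
  · simp only [Set.mem_ofPred_eq, hσ.1, not_lt]
    exact ⟨le_of_lt, fun h => lt_of_le_of_ne h (hne v).symm⟩
  · simp only [Set.mem_ofPred_eq, h1, h2, not_lt]
    exact ⟨le_of_lt, fun h => lt_of_le_of_ne h (hne v).symm⟩

/-- The normal form of a pair of perfect matchings. -/
lemma IsMatchingPerm.exists_normalForm [Fintype α] {n : ℕ} (hα : Fintype.card α = 2 * n)
    (hσ : IsMatchingPerm σ) (hτ : IsMatchingPerm τ) :
    ∃ (E : Fin n × Bool ≃ α) (ρ : Equiv.Perm (Fin n)),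
      (∀ a b, σ (E (a, b)) = E (a, !b)) ∧ ∀ a, τ (E (a, true)) = E (ρ a, false) := by
  classical
  obtain ⟨B, hσB, hτB⟩ := hσ.exists_bipartition hτ
  -- Every edge of σ has one endpoint in B, marked `false`. The permutation ρ is τσ restricted to B,
  -- so its cycles are the cycles of the union at half length.
  let F : B × Bool → α := fun z => if z.2 then σ z.1 else z.1
  have hF : Function.Bijective F := by
    constructor
    · rintro ⟨⟨a, ha⟩, b⟩ ⟨⟨a', ha'⟩, b'⟩ h
      cases b <;> cases b' <;> simp only [F] at h
      · simpa using h
      · simp at h; rw [h, hσB] at ha; exact absurd ha' ha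
      · simp at h; rw [← h, hσB] at ha'; exact absurd ha ha'
      · simpa using h
    · intro v
      by_cases hv : v ∈ B
      · exact ⟨(⟨v, hv⟩, false), by simp [F]⟩
      · exact ⟨(⟨σ v, (hσB v).2 hv⟩, true), by simp [F, hσ.1]⟩
  have hcard : Fintype.card B = n := by
    have := Fintype.card_of_bijective hF
    rw [Fintype.card_prod, Fintype.card_bool, hα] at this
    omega
  let e : B ≃ Fin n := Fintype.equivFinOfCardEq hcard
  have hr : ∀ v, (τ * σ) v ∈ B ↔ v ∈ B := fun v => by
    rw [Equiv.Perm.mul_apply, hτB, hσB, not_not]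
  refine ⟨(Equiv.prodCongr e.symm (Equiv.refl Bool)).trans (Equiv.ofBijective F hF),
    e.permCongr ((τ * σ).subtypePerm fun v => (hr v)), ?_, ?_⟩
  · intro a b; cases b <;> simp [F, hσ.1]
  · intro a; simp [F]

/-- Pairs of perfect matchings whose normal forms agree up to conjugation are isomorphic. -/
lemma exists_perm_of_isConj {n : ℕ} {σ' τ' : Equiv.Perm α} (hτ : IsMatchingPerm τ)
    (hτ' : IsMatchingPerm τ') {E E' : Fin n × Bool ≃ α} {ρ ρ' : Equiv.Perm (Fin n)}
    (h1 : ∀ a b, σ (E (a, b)) = E (a, !b)) (h2 : ∀ a, τ (E (a, true)) = E (ρ a, false))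
    (h1' : ∀ a b, σ' (E' (a, b)) = E' (a, !b)) (h2' : ∀ a, τ' (E' (a, true)) = E' (ρ' a, false))
    (hconj : IsConj ρ ρ') :
    ∃ g : Equiv.Perm α, (∀ v, g (σ v) = σ' (g v)) ∧ ∀ v, g (τ v) = τ' (g v) := by
  obtain ⟨π, hπ⟩ := isConj_iff.1 hconj
  have hπ' : ∀ a, π (ρ a) = ρ' (π a) := fun a => by rw [← hπ]; simp
  have h3 : ∀ a, τ (E (a, false)) = E (ρ⁻¹ a, true) := fun a => by
    rw [hτ.apply_eq_iff, h2]; simp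
  have h3' : ∀ a, τ' (E' (a, false)) = E' (ρ'⁻¹ a, true) := fun a => by
    rw [hτ'.apply_eq_iff, h2']; simp
  refine ⟨E.symm.trans ((Equiv.prodCongr π (Equiv.refl Bool)).trans E'), fun v => ?_, fun v => ?_⟩
  · obtain ⟨⟨a, b⟩, rfl⟩ := E.surjective v
    simp [h1, h1']
  · obtain ⟨⟨a, b⟩, rfl⟩ := E.surjective v
    cases b
    · simp only [h3, Equiv.trans_apply, Equiv.symm_apply_apply, Equiv.prodCongr_apply, Prod.map,
        Equiv.refl_apply, h3']
      congr 2
      rw [Equiv.Perm.eq_inv_iff_eq, ← hπ']; simp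
    · simp [h2, h2', hπ']

/-- Two perfect matchings can be exchanged by a permutation. -/
lemma IsMatchingPerm.exists_swap [Fintype α] {n : ℕ} (hα : Fintype.card α = 2 * n)
    (hσ : IsMatchingPerm σ) (hτ : IsMatchingPerm τ) :
    ∃ g : Equiv.Perm α, (∀ v, g (σ v) = τ (g v)) ∧ ∀ v, g (τ v) = σ (g v) := by
  obtain ⟨E, ρ, h1, h2⟩ := hσ.exists_normalForm hα hτ
  have h3 : ∀ a, τ (E (a, false)) = E (ρ⁻¹ a, true) := fun a => by
    rw [hτ.apply_eq_iff, h2]; simp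
  -- With the half marked `true` relabelled by ρ⁻¹, the pair (τ, σ) has normal form ρ⁻¹, and a
  -- permutation is conjugate to its inverse.
  have hconj : IsConj ρ ρ⁻¹ := by
    rw [Equiv.Perm.isConj_iff_cycleType_eq, Equiv.Perm.cycleType_inv]
  let F : Fin n × Bool ≃ Fin n × Bool :=
    { toFun := fun z => if z.2 then (ρ⁻¹ z.1, true) else z
      invFun := fun z => if z.2 then (ρ z.1, true) else z
      left_inv := by rintro ⟨a, b⟩; cases b <;> simp
      right_inv := by rintro ⟨a, b⟩; cases b <;> simp }
  refine exists_perm_of_isConj (σ' := τ) (τ' := σ) (E := E) (E' := F.trans E) hτ hσ h1 h2 ?_ ?_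
    hconj
  · intro a b; cases b <;> simp [F, h2, h3]
  · intro a; simp [F, h1]

/-- Two perfect matchings are conjugate by a permutation that fixes the common edges. -/
lemma IsMatchingPerm.exists_conj [Fintype α] {n : ℕ} (hα : Fintype.card α = 2 * n)
    (hσ : IsMatchingPerm σ) (hτ : IsMatchingPerm τ) :
    ∃ c : Equiv.Perm α, (∀ v, c (σ v) = τ (c v)) ∧ ∀ v, σ v = τ v → c v = v := by
  obtain ⟨E, ρ, h1, h2⟩ := hσ.exists_normalForm hα hτ
  have h3 : ∀ a, τ (E (a, false)) = E (ρ⁻¹ a, true) := fun a => by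
    rw [hτ.apply_eq_iff, h2]; simp
  -- Shifting only the half marked `false` by ρ carries edges of σ to edges of τ. A common edge
  -- belongs to a fixed point of ρ, so it does not move.
  let F : Fin n × Bool ≃ Fin n × Bool :=
    { toFun := fun z => if z.2 then z else (ρ z.1, false)
      invFun := fun z => if z.2 then z else (ρ⁻¹ z.1, false)
      left_inv := by rintro ⟨a, b⟩; cases b <;> simp
      right_inv := by rintro ⟨a, b⟩; cases b <;> simp }
  refine ⟨E.symm.trans (F.trans E), fun v => ?_, fun v => ?_⟩
  · obtain ⟨⟨a, b⟩, rfl⟩ := E.surjective v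
    cases b <;> simp [F, h1, h2, h3]
  · obtain ⟨⟨a, b⟩, rfl⟩ := E.surjective v
    cases b
    · intro h
      rw [h1, h3, E.apply_eq_iff_eq] at h
      have h4 : a = ρ⁻¹ a := by simpa using h
      simp only [F, Equiv.trans_apply, Equiv.symm_apply_apply, Equiv.coe_fn_mk]
      simp only [Bool.false_eq_true, if_false]
      congr 2
      rw [Equiv.Perm.eq_inv_iff_eq] at h4; exact h4
    · intro _; simp [F]

/-! ### Matchings whose union with a given one has one long cycle -/

/-- `s` traverses, in steps of two, a cycle of the union of `σ` and `τ`, all of whose other cycles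
are common edges. -/
structure IsHookPath {i : ℕ} (σ τ : Equiv.Perm α) (s : Fin i ↪ α) : Prop where
  transversal : ∀ j k, σ (s j) ≠ s k
  step : ∀ j, τ (σ (s j)) = s (finRotate i j)
  common : ∀ w, w ∉ Set.range s → σ w ∉ Set.range s → τ w = σ w

/-- The union of `σ` and `τ` consists of a cycle of length `2i` and common edges. -/
def HookRel (i : ℕ) (σ τ : Equiv.Perm α) : Prop := ∃ s : Fin i ↪ α, IsHookPath σ τ s

variable {i : ℕ} {s s' : Fin i ↪ α}

lemma IsHookPath.step' (hτ : IsMatchingPerm τ) (h : IsHookPath σ τ s) (j : Fin i) :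
    τ (s (finRotate i j)) = σ (s j) := by rw [← h.step, hτ.1]

lemma IsHookPath.iterate (h : IsHookPath σ τ s) (j : Fin i) (k : ℕ) :
    ((τ * σ) ^ k) (s j) = s ((finRotate i ^ k) j) := by
  induction k with
  | zero => simp
  | succ k ih => rw [pow_succ', Equiv.Perm.mul_apply, ih, Equiv.Perm.mul_apply, h.step,
      pow_succ', Equiv.Perm.mul_apply]

lemma exists_finRotate_pow (hi : 2 ≤ i) (j k : Fin i) : ∃ m : ℕ, (finRotate i ^ m) j = k := by
  have hne : ∀ j, finRotate i j ≠ j := fun j => by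
    have := support_finRotate_of_le hi
    exact Equiv.Perm.mem_support.1 (this ▸ Finset.mem_univ j)
  exact (isCycle_finRotate_of_le hi).exists_pow_eq (hne j) (hne k)

lemma finRotate_ne (hi : 2 ≤ i) (j : Fin i) : finRotate i j ≠ j := by
  have := support_finRotate_of_le hi
  exact Equiv.Perm.mem_support.1 (this ▸ Finset.mem_univ j)

/-- The vertices at which two matchings disagree. -/
def disagreement [Fintype α] [DecidableEq α] (σ τ : Equiv.Perm α) : Finset α :=
  {v | σ v ≠ τ v}

section Disagreement

variable [Fintype α] [DecidableEq α]

@[simp] lemma mem_disagreement {v : α} : v ∈ disagreement σ τ ↔ σ v ≠ τ v := by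
  simp [disagreement]

lemma disagreement_comm : disagreement σ τ = disagreement τ σ := by
  ext v; simp [ne_comm]

lemma IsMatchingPerm.apply_mem_disagreement_left (hσ : IsMatchingPerm σ) (hτ : IsMatchingPerm τ)
    {v : α} : σ v ∈ disagreement σ τ ↔ v ∈ disagreement σ τ := by
  rw [mem_disagreement, mem_disagreement, hσ.1, ne_eq, ne_eq, eq_comm, hτ.apply_eq_iff]

lemma IsMatchingPerm.apply_mem_disagreement_right (hσ : IsMatchingPerm σ)
    (hτ : IsMatchingPerm τ) {v : α} : τ v ∈ disagreement σ τ ↔ v ∈ disagreement σ τ := by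
  rw [disagreement_comm]; exact hτ.apply_mem_disagreement_left hσ

lemma IsHookPath.mem_disagreement_iff (hi : 2 ≤ i) (hσ : IsMatchingPerm σ)
    (hτ : IsMatchingPerm τ) (h : IsHookPath σ τ s) {v : α} :
    v ∈ disagreement σ τ ↔ v ∈ Set.range s ∨ σ v ∈ Set.range s := by
  have key : ∀ j, s j ∈ disagreement σ τ := by
    intro j
    rw [← hσ.apply_mem_disagreement_left hτ, mem_disagreement, hσ.1, h.step]
    exact fun h' => finRotate_ne hi j (s.injective h').symm
  constructor
  · rw [mem_disagreement]
    intro hv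
    by_contra! hc
    exact hv (h.common v hc.1 hc.2).symm
  · rintro (⟨j, rfl⟩ | ⟨j, hj⟩)
    · exact key j
    · rw [← hσ.apply_mem_disagreement_left hτ, ← hj]; exact key j

lemma IsHookPath.disagreement_eq (hi : 2 ≤ i) (hσ : IsMatchingPerm σ)
    (hτ : IsMatchingPerm τ) (h : IsHookPath σ τ s) :
    disagreement σ τ = Finset.univ.map s ∪ (Finset.univ.map s).map σ.toEmbedding := by
  ext v
  rw [h.mem_disagreement_iff hi hσ hτ]
  simp only [Finset.mem_union, Finset.mem_map, Finset.mem_univ, true_and, Set.mem_range,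
    Equiv.coe_toEmbedding, exists_exists_eq_and]
  refine or_congr Iff.rfl (exists_congr fun j => ?_)
  rw [eq_comm, eq_comm (b := v), hσ.apply_eq_iff]

lemma IsHookPath.card_disagreement (hi : 2 ≤ i) (hσ : IsMatchingPerm σ)
    (hτ : IsMatchingPerm τ) (h : IsHookPath σ τ s) : (disagreement σ τ).card = 2 * i := by
  rw [h.disagreement_eq hi hσ hτ, Finset.card_union_of_disjoint]
  · simp; ring
  · rw [Finset.disjoint_left]
    intro v hv hv'
    simp only [Finset.mem_map, Finset.mem_univ, true_and, Equiv.coe_toEmbedding,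
      exists_exists_eq_and] at hv hv'
    obtain ⟨j, rfl⟩ := hv
    obtain ⟨k, hk⟩ := hv'
    exact h.transversal k j hk

/-- The long cycle is connected. -/
lemma IsHookPath.disagreement_subset (hi : 2 ≤ i) (hσ : IsMatchingPerm σ)
    (hτ : IsMatchingPerm τ) (h : IsHookPath σ τ s) {Q : Set α} (hQσ : ∀ v ∈ Q, σ v ∈ Q)
    (hQτ : ∀ v ∈ Q, τ v ∈ Q) {v : α} (hv : v ∈ Q) (hvD : v ∈ disagreement σ τ) :
    ∀ w ∈ disagreement σ τ, w ∈ Q := by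
  have hbase : ∃ j, s j ∈ Q := by
    rcases (h.mem_disagreement_iff hi hσ hτ).1 hvD with ⟨j, hj⟩ | ⟨j, hj⟩
    · exact ⟨j, hj ▸ hv⟩
    · exact ⟨j, hj ▸ hQσ v hv⟩
  obtain ⟨j, hj⟩ := hbase
  have hpow : ∀ k : ℕ, ((τ * σ) ^ k) (s j) ∈ Q := by
    intro k
    induction k with
    | zero => simpa using hj
    | succ k ih => rw [pow_succ', Equiv.Perm.mul_apply]; exact hQτ _ (hQσ _ ih)
  have hall : ∀ k, s k ∈ Q := by
    intro k
    obtain ⟨m, rfl⟩ := exists_finRotate_pow hi j k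
    rw [← h.iterate]; exact hpow m
  intro w hw
  rcases (h.mem_disagreement_iff hi hσ hτ).1 hw with ⟨k, hk⟩ | ⟨k, hk⟩
  · exact hk ▸ hall k
  · have := hQσ _ (hall k)
    rwa [hk, hσ.1] at this

lemma IsHookPath.unique_path (hi : 2 ≤ i) (h : IsHookPath σ τ s) (h' : IsHookPath σ τ s')
    (j : Fin i) (hj : s j = s' j) : s = s' := by
  ext k
  obtain ⟨m, rfl⟩ := exists_finRotate_pow hi j k
  rw [← h.iterate, ← h'.iterate, hj]

/-- The path prescribes τ on its own vertices and on their σ-partners; elsewhere τ agrees with σ. -/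
lemma IsHookPath.unique_perm {τ' : Equiv.Perm α} (hσ : IsMatchingPerm σ) (hτ : IsMatchingPerm τ)
    (hτ' : IsMatchingPerm τ') (h : IsHookPath σ τ s) (h' : IsHookPath σ τ' s) : τ = τ' := by
  ext v
  by_cases h1 : v ∈ Set.range s
  · obtain ⟨j, rfl⟩ := h1
    obtain ⟨k, rfl⟩ := (finRotate i).surjective j
    rw [h.step' hτ, h'.step' hτ']
  · by_cases h2 : σ v ∈ Set.range s
    · obtain ⟨j, hj⟩ := h2
      have := (h.step j).trans (h'.step j).symm
      rwa [hj, hσ.1] at this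
    · rw [h.common v h1 h2, h'.common v h1 h2]

/-- The cyclic permutation of the values of `s`. -/
def rotatePerm (s : Fin i ↪ α) : Equiv.Perm α := (finRotate i).viaFintypeEmbedding s

lemma rotatePerm_apply (s : Fin i ↪ α) (j : Fin i) : rotatePerm s (s j) = s (finRotate i j) :=
  Equiv.Perm.viaFintypeEmbedding_apply_image _ _ _

lemma rotatePerm_apply_notMem (s : Fin i ↪ α) {v : α} (hv : v ∉ Set.range s) :
    rotatePerm s v = v := Equiv.Perm.viaFintypeEmbedding_apply_notMem_range _ _ hv

lemma IsMatchingPerm.conj (hσ : IsMatchingPerm σ) (g : Equiv.Perm α) :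
    IsMatchingPerm (g * σ * g⁻¹) := by
  refine ⟨fun v => by simp [hσ.1], fun v h => hσ.2 (g⁻¹ v) ?_⟩
  rw [Equiv.Perm.eq_inv_iff_eq]; exact h

/-- Rotating one endpoint from each of i edges joins these edges into a single cycle. With
`IsHookPath.unique_perm`, every neighbour of σ arises in this way. -/
lemma isHookPath_rotatePerm (hσ : IsMatchingPerm σ) (hs : ∀ j k, σ (s j) ≠ s k) :
    IsHookPath σ (rotatePerm s * σ * (rotatePerm s)⁻¹) s := by
  have hfix : ∀ v, v ∉ Set.range s → (rotatePerm s)⁻¹ v = v := fun v hv => by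
    rw [Equiv.Perm.inv_eq_iff_eq, rotatePerm_apply_notMem s hv]
  refine ⟨hs, fun j => ?_, fun w hw hw' => ?_⟩
  · rw [Equiv.Perm.mul_apply, Equiv.Perm.mul_apply, hfix, hσ.1, rotatePerm_apply]
    rintro ⟨k, hk⟩; exact hs j k hk.symm
  · rw [Equiv.Perm.mul_apply, Equiv.Perm.mul_apply, hfix w hw, rotatePerm_apply_notMem s hw']

lemma IsHookPath.exists_start_of_mem_range (hi : 2 ≤ i) (h : IsHookPath σ τ s) {v : α}
    (hv : v ∈ Set.range s) (j : Fin i) : ∃ s' : Fin i ↪ α, IsHookPath σ τ s' ∧ s' j = v := by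
  obtain ⟨k, hk⟩ := hv
  obtain ⟨m, hm⟩ := exists_finRotate_pow hi j k
  have hr : Set.range ((finRotate i ^ m).toEmbedding.trans s) = Set.range s := by
    ext w
    simp only [Set.mem_range, Function.Embedding.trans_apply, Equiv.coe_toEmbedding]
    exact ((finRotate i ^ m).surjective.exists (p := fun y => s y = w)).symm
  refine ⟨(finRotate i ^ m).toEmbedding.trans s,
    ⟨fun j k => h.transversal _ _, fun j => ?_, fun w => ?_⟩, ?_⟩
  · simp only [Function.Embedding.trans_apply, Equiv.coe_toEmbedding, h.step]
    rw [← Equiv.Perm.mul_apply, ← Equiv.Perm.mul_apply, ← pow_succ', ← pow_succ]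
  · rw [hr]; exact h.common w
  · simp [hm, hk]

lemma finRotate_rev (j : Fin i) : finRotate i (finRotate i j).rev = j.rev := by
  obtain _ | m := i
  · exact j.elim0
  · rw [finRotate_apply, finRotate_apply, ← Fin.last_sub, ← Fin.last_sub]
    abel

/-- The cycle traversed in the opposite direction runs through the σ-partners. This supplies
starting points in the other half of the cycle. -/
lemma IsHookPath.reverse (hσ : IsMatchingPerm σ) (hτ : IsMatchingPerm τ)
    (h : IsHookPath σ τ s) :
    IsHookPath σ τ (Fin.revPerm.toEmbedding.trans (s.trans σ.toEmbedding)) := by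
  have hr : ∀ w, w ∈ Set.range (Fin.revPerm.toEmbedding.trans (s.trans σ.toEmbedding)) ↔
      σ w ∈ Set.range s := by
    intro w
    simp only [Set.mem_range, Function.Embedding.trans_apply, Equiv.coe_toEmbedding,
      Fin.revPerm_apply]
    exact (Fin.revPerm.surjective.exists (p := fun y => σ (s y) = w)).symm.trans
      (exists_congr fun j => hσ.apply_eq_iff)
  refine ⟨fun j k h' => h.transversal k.rev j.rev ?_, fun j => ?_, fun w hw hw' => ?_⟩
  · simpa [hσ.1] using h'.symm
  · simp only [Function.Embedding.trans_apply, Equiv.coe_toEmbedding, Fin.revPerm_apply, hσ.1]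
    rw [← h.step' hτ, finRotate_rev]
  · rw [hr] at hw hw'
    rw [hσ.1] at hw'
    exact h.common w hw' hw

/-- A path can be started at any vertex of the long cycle. -/
lemma IsHookPath.exists_start (hi : 2 ≤ i) (hσ : IsMatchingPerm σ) (hτ : IsMatchingPerm τ)
    (h : IsHookPath σ τ s) {v : α} (hv : v ∈ disagreement σ τ) (j : Fin i) :
    ∃ s' : Fin i ↪ α, IsHookPath σ τ s' ∧ s' j = v := by
  rcases (h.mem_disagreement_iff hi hσ hτ).1 hv with hk | ⟨k, hk⟩
  · exact h.exists_start_of_mem_range hi hk j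
  · exact (h.reverse hσ hτ).exists_start_of_mem_range hi ⟨k.rev, by simp [hk, hσ.1]⟩ j

/-- The pairs of matchings whose union has one long cycle of length `2i` are all isomorphic. -/
lemma HookRel.exists_perm {n : ℕ} (hα : Fintype.card α = 2 * n) (hi : 2 ≤ i)
    {σ' τ' : Equiv.Perm α} (hσ : IsMatchingPerm σ) (hτ : IsMatchingPerm τ)
    (hσ' : IsMatchingPerm σ') (hτ' : IsMatchingPerm τ') (h : HookRel i σ τ)
    (h' : HookRel i σ' τ') :
    ∃ g : Equiv.Perm α, (∀ v, g (σ v) = σ' (g v)) ∧ ∀ v, g (τ v) = τ' (g v) := by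
  -- In normal form the long cycle becomes an i-cycle ρ: the disagreement set lies over the support
  -- of ρ, and connectedness makes the support one orbit. Any two i-cycles are conjugate.
  have key : ∀ σ τ : Equiv.Perm α, IsMatchingPerm σ → IsMatchingPerm τ → HookRel i σ τ →
      ∀ (E : Fin n × Bool ≃ α) (ρ : Equiv.Perm (Fin n)), (∀ a b, σ (E (a, b)) = E (a, !b)) →
      (∀ a, τ (E (a, true)) = E (ρ a, false)) → ρ.IsCycle ∧ ρ.support.card = i := by
    rintro σ τ hσ hτ ⟨s, hs⟩ E ρ h1 h2
    have h3 : ∀ a, τ (E (a, false)) = E (ρ⁻¹ a, true) := fun a => by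
      rw [hτ.apply_eq_iff, h2]; simp
    have hD : ∀ a b, E (a, b) ∈ disagreement σ τ ↔ ρ a ≠ a := by
      intro a b
      have h0 : E (a, true) ∈ disagreement σ τ ↔ ρ a ≠ a := by
        rw [mem_disagreement, h1, h2, ne_eq, E.apply_eq_iff_eq]
        simp [eq_comm]
      cases b
      · rw [← h0, ← hσ.apply_mem_disagreement_left hτ, h1]; rfl
      · exact h0
    have hcard : (disagreement σ τ).card = 2 * ρ.support.card := by
      have : disagreement σ τ = (ρ.support ×ˢ Finset.univ).map E.toEmbedding := by
        ext v
        obtain ⟨⟨a, b⟩, rfl⟩ := E.surjective v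
        rw [hD, Finset.mem_map_equiv]
        simp
      rw [this]; simp [mul_comm]
    rw [hs.card_disagreement hi hσ hτ] at hcard
    refine ⟨?_, by omega⟩
    have hne : (disagreement σ τ).Nonempty := by
      rw [← Finset.card_pos, hs.card_disagreement hi hσ hτ]; omega
    obtain ⟨v, hv⟩ := hne
    obtain ⟨⟨a, b⟩, rfl⟩ := E.surjective v
    refine ⟨a, (hD a b).1 hv, fun c hc => ?_⟩
    have := hs.disagreement_subset hi hσ hτ (Q := {v | ρ.SameCycle a (E.symm v).1}) ?_ ?_
      (v := E (a, b)) ?_ hv (E (c, true)) ((hD c true).2 hc)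
    · simpa using this
    · intro v hv
      obtain ⟨⟨a, b⟩, rfl⟩ := E.surjective v
      simpa [h1] using hv
    · intro v hv
      obtain ⟨⟨a, b⟩, rfl⟩ := E.surjective v
      cases b
      · simpa [h3] using hv
      · simpa [h2] using hv
    · simp [Equiv.Perm.SameCycle.refl]
  obtain ⟨E, ρ, h1, h2⟩ := hσ.exists_normalForm hα hτ
  obtain ⟨E', ρ', h1', h2'⟩ := hσ'.exists_normalForm hα hτ'
  obtain ⟨hc, hn⟩ := key σ τ hσ hτ h E ρ h1 h2
  obtain ⟨hc', hn'⟩ := key σ' τ' hσ' hτ' h' E' ρ' h1' h2'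
  exact exists_perm_of_isConj hτ hτ' h1 h2 h1' h2' ((hc.isConj_iff hc').2 (hn.trans hn'.symm))

/-- The relation is preserved by conjugation. -/
lemma HookRel.conj (h : HookRel i σ τ) (g : Equiv.Perm α) {σ' τ' : Equiv.Perm α}
    (hσ : ∀ v, g (σ v) = σ' (g v)) (hτ : ∀ v, g (τ v) = τ' (g v)) : HookRel i σ' τ' := by
  obtain ⟨s, hs⟩ := h
  have hr : ∀ w, w ∈ Set.range s ↔ g w ∈ Set.range (s.trans g.toEmbedding) := by
    intro w; simp
  refine ⟨s.trans g.toEmbedding, fun j k h' => hs.transversal j k ?_, fun j => ?_,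
    fun w hw hw' => ?_⟩
  · apply g.injective; rw [hσ]; exact h'
  · simp only [Function.Embedding.trans_apply, Equiv.coe_toEmbedding]
    rw [← hσ, ← hτ, hs.step]
  · obtain ⟨w, rfl⟩ := g.surjective w
    rw [← hσ, ← hr] at hw'
    rw [← hr] at hw
    rw [← hσ, ← hτ, hs.common w hw hw']

end Disagreement

end Involutions

end

noncomputable section

set_option linter.unusedSectionVars false

/-! ### Counting the neighbours of a matching -/

section Degree

variable {α : Type*} [Fintype α] [DecidableEq α] {σ τ : Equiv.Perm α} {i : ℕ}

/-- Such a sequence is an ordered choice of i distinct edges of σ together with an endpoint of each.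
-/
lemma IsMatchingPerm.card_transversal {n : ℕ} (hα : Fintype.card α = 2 * n)
    (hσ : IsMatchingPerm σ) :
    Fintype.card {s : Fin i ↪ α // ∀ j k, σ (s j) ≠ s k} = n.descFactorial i * 2 ^ i := by
  obtain ⟨E, ρ, h1, -⟩ := hσ.exists_normalForm hα hσ
  let e : {s : Fin i ↪ α // ∀ j k, σ (s j) ≠ s k} ≃ (Fin i ↪ Fin n) × (Fin i → Bool) :=
    { toFun := fun s => ⟨⟨fun j => (E.symm (s.1 j)).1, fun j k h => by
        by_contra hjk
        obtain ⟨⟨a, b⟩, hj⟩ := E.surjective (s.1 j)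
        obtain ⟨⟨a', b'⟩, hk⟩ := E.surjective (s.1 k)
        simp only [← hj, ← hk, Equiv.symm_apply_apply] at h
        subst h
        by_cases hb : b = b'
        · subst hb
          exact hjk (s.1.injective (hj.symm.trans hk))
        · apply s.2 j k
          rw [← hj, ← hk, h1, E.apply_eq_iff_eq]
          cases b <;> cases b' <;> simp_all⟩, fun j => (E.symm (s.1 j)).2⟩
      invFun := fun z => ⟨⟨fun j => E (z.1 j, z.2 j), fun j k h => by
        rw [E.apply_eq_iff_eq, Prod.mk.injEq] at h
        exact z.1.injective h.1⟩, fun j k h => by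
        have h : σ (E (z.1 j, z.2 j)) = E (z.1 k, z.2 k) := h
        rw [h1, E.apply_eq_iff_eq, Prod.mk.injEq] at h
        have h2 := z.1.injective h.1
        subst h2
        simp at h⟩
      left_inv := fun s => Subtype.ext (DFunLike.ext _ _ fun j => E.apply_symm_apply _)
      right_inv := fun z => Prod.ext
        (DFunLike.ext _ _ fun j => congrArg Prod.fst (E.symm_apply_apply (z.1 j, z.2 j)))
        (funext fun j => congrArg Prod.snd (E.symm_apply_apply (z.1 j, z.2 j))) }
  rw [Fintype.card_congr e, Fintype.card_prod, Fintype.card_embedding_eq]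
  simp

open Classical in
-- A path is determined by its first vertex, which may be any of the 2i vertices of the long cycle.
lemma IsHookPath.card_paths (hi : 2 ≤ i) (hσ : IsMatchingPerm σ) (hτ : IsMatchingPerm τ)
    (h : HookRel i σ τ) :
    (Finset.univ.filter fun s : Fin i ↪ α => IsHookPath σ τ s).card = 2 * i := by
  obtain ⟨s₀, hs₀⟩ := h
  rw [← hs₀.card_disagreement hi hσ hτ]
  let z : Fin i := ⟨0, by omega⟩
  refine Finset.card_bij (fun s _ => s z) (fun s hs => ?_) (fun s hs s' hs' h => ?_)
    fun v hv => ?_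
  · exact ((Finset.mem_filter.1 hs).2.mem_disagreement_iff hi hσ hτ).2 (Or.inl ⟨z, rfl⟩)
  · exact (Finset.mem_filter.1 hs).2.unique_path hi (Finset.mem_filter.1 hs').2 z h
  · obtain ⟨s', h', hz⟩ := hs₀.exists_start hi hσ hτ hv z
    exact ⟨s', Finset.mem_filter.2 ⟨Finset.mem_univ _, h'⟩, hz⟩

open Classical in
/-- The neighbours of `σ` in the matching graph. -/
def hookNeighbors (i : ℕ) (σ : Equiv.Perm α) : Finset (Equiv.Perm α) :=
  {τ | IsMatchingPerm τ ∧ HookRel i σ τ}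

lemma mem_hookNeighbors : τ ∈ hookNeighbors i σ ↔ IsMatchingPerm τ ∧ HookRel i σ τ := by
  simp [hookNeighbors]

/-- The degree of the matching graph. -/
def hookDegree (n i : ℕ) : ℕ := 2 ^ (i - 1) * n.choose i * (i - 1).factorial

open Classical in
-- Double counting: each transversal sequence produces one neighbour, and each neighbour arises from
-- 2i sequences.
lemma IsMatchingPerm.card_hookNeighbors {n : ℕ} (hα : Fintype.card α = 2 * n) (hi : 2 ≤ i)
    (hσ : IsMatchingPerm σ) : (hookNeighbors i σ).card = hookDegree n i := by
  have h1 : (Finset.univ.filter fun s : Fin i ↪ α => ∀ j k, σ (s j) ≠ s k).card =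
      ∑ τ ∈ hookNeighbors i σ, ((Finset.univ.filter fun s : Fin i ↪ α =>
        ∀ j k, σ (s j) ≠ s k).filter
          fun s => rotatePerm s * σ * (rotatePerm s)⁻¹ = τ).card := by
    refine Finset.card_eq_sum_card_fiberwise fun s hs => ?_
    have hs := (Finset.mem_filter.1 hs).2
    exact mem_hookNeighbors.2 ⟨hσ.conj _, s, isHookPath_rotatePerm hσ hs⟩
  have h2 : ∀ τ ∈ hookNeighbors i σ, ((Finset.univ.filter fun s : Fin i ↪ α =>
        ∀ j k, σ (s j) ≠ s k).filter
          fun s => rotatePerm s * σ * (rotatePerm s)⁻¹ = τ).card = 2 * i := by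
    intro τ hτ
    obtain ⟨hτ, h⟩ := mem_hookNeighbors.1 hτ
    rw [← IsHookPath.card_paths hi hσ hτ h, Finset.filter_filter]
    congr 1
    refine Finset.filter_congr fun s _ => ⟨?_, fun hs => ⟨hs.transversal, ?_⟩⟩
    · rintro ⟨hs, rfl⟩; exact isHookPath_rotatePerm hσ hs
    · exact (isHookPath_rotatePerm hσ hs.transversal).unique_perm hσ (hσ.conj _) hτ hs
  rw [Finset.sum_congr rfl h2, Finset.sum_const, smul_eq_mul, ← Fintype.card_subtype] at h1
  have h3 := hσ.card_transversal hα (i := i)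
  have h4 : (hookNeighbors i σ).card * (2 * i) = hookDegree n i * (2 * i) := by
    rw [← h1]
    convert! h3 using 1
    rw [Nat.descFactorial_eq_factorial_mul_choose, hookDegree]
    obtain ⟨m, rfl⟩ : ∃ m, i = m + 1 := ⟨i - 1, by omega⟩
    rw [Nat.add_sub_cancel, Nat.factorial_succ, pow_succ]
    ring
  exact Nat.eq_of_mul_eq_mul_right (by omega) h4

/-! ### Connected components of the union of two matchings -/

/-- The path is the orbit of v under τσ, with p its minimal period. -/
lemma IsMatchingPerm.exists_cycle (hσ : IsMatchingPerm σ) (hτ : IsMatchingPerm τ) (v : α) :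
    ∃ (p : ℕ) (s : Fin p ↪ α), 0 < p ∧ (∀ j k, σ (s j) ≠ s k) ∧
      (∀ j, τ (σ (s j)) = s (finRotate p j)) ∧ (∀ j, s j = ((τ * σ) ^ (j : ℕ)) v) := by
  have hp : 0 < Function.minimalPeriod (τ * σ) v :=
    Function.minimalPeriod_pos_of_mem_periodicPts
      ((τ * σ).injective.mem_periodicPts v)
  have hper : ((τ * σ) ^ Function.minimalPeriod (τ * σ) v) v = v := by
    rw [← Equiv.Perm.iterate_eq_pow]; exact Function.iterate_minimalPeriod
  set p := Function.minimalPeriod (τ * σ) v with hpdef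
  have hinj : Function.Injective fun j : Fin p => ((τ * σ) ^ (j : ℕ)) v := by
    intro j k h
    simp only [← Equiv.Perm.iterate_eq_pow] at h
    exact Fin.ext (Function.iterate_injOn_Iio_minimalPeriod j.2 k.2 h)
  refine ⟨p, ⟨_, hinj⟩, hp, fun j k h => ?_, fun j => ?_, fun j => rfl⟩
  · simp only [Function.Embedding.coeFn_mk] at h
    refine hσ.apply_ne_zpow hτ ((k : ℤ) - j) (((τ * σ) ^ (j : ℕ)) v) ?_
    rw [h, ← zpow_natCast _ (j : ℕ), ← Equiv.Perm.mul_apply, ← zpow_add, sub_add_cancel,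
      zpow_natCast]
  · simp only [Function.Embedding.coeFn_mk]
    have h1 : τ (σ (((τ * σ) ^ (j : ℕ)) v)) = ((τ * σ) ^ ((j : ℕ) + 1)) v := by
      rw [pow_succ']; rfl
    rw [h1]
    clear_value p
    obtain _ | m := p
    · exact j.elim0
    · by_cases hj : (j : ℕ) < m
      · rw [finRotate_of_lt hj]
      · have : j = Fin.last m := Fin.ext (by have := j.2; simp; omega)
        subst this
        rw [finRotate_last]; simpa using hper

end Degree

namespace PerfectMatching

variable {n : ℕ}

/-- The involution exchanging the endpoints of each edge of a perfect matching. -/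
def partner (M : PerfectMatching n) : Equiv.Perm (Fin (2 * n)) :=
  Function.Involutive.toPerm (fun v => (M.2 v).choose) fun v => by
    have h1 := (M.2 v).choose_spec.1
    exact ((M.2 _).choose_spec.2 v (M.1.adj_symm h1)).symm

lemma adj_iff (M : PerfectMatching n) {v w : Fin (2 * n)} :
    M.1.Adj v w ↔ M.partner v = w :=
  ⟨fun h => ((M.2 v).choose_spec.2 w h).symm, fun h => h ▸ (M.2 v).choose_spec.1⟩

lemma isMatchingPerm (M : PerfectMatching n) : IsMatchingPerm M.partner :=
  ⟨fun v => (M.adj_iff.1 (M.adj_iff.2 rfl : M.1.Adj v (M.partner v)).symm),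
    fun v h => M.1.loopless.irrefl v (M.adj_iff.2 h)⟩

lemma partner_injective : Function.Injective (partner (n := n)) := by
  intro M M' h
  apply Subtype.ext
  ext v w
  rw [M.adj_iff, M'.adj_iff, h]

/-- The perfect matching of a fixed point free involution. -/
def ofPerm (σ : Equiv.Perm (Fin (2 * n))) (hσ : IsMatchingPerm σ) : PerfectMatching n :=
  ⟨{ Adj := fun v w => σ v = w
     symm := ⟨fun v w h => by rw [← h, hσ.1]⟩
     loopless := ⟨fun v h => hσ.2 v h⟩ }, fun v => ⟨σ v, rfl, fun _ h => Eq.symm h⟩⟩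

lemma partner_ofPerm (σ : Equiv.Perm (Fin (2 * n))) (hσ : IsMatchingPerm σ) :
    (ofPerm σ hσ).partner = σ := by
  ext v; rw [(ofPerm σ hσ).adj_iff.1 (show (ofPerm σ hσ).1.Adj v (σ v) from rfl)]

/-- Components of the union of two perfect matchings are even cycles. -/
lemma exists_component_cycle (M M' : PerfectMatching n) (v : Fin (2 * n)) :
    ∃ (p : ℕ) (s : Fin p ↪ Fin (2 * n)), 0 < p ∧ (∀ j k, M.partner (s j) ≠ s k) ∧
      (∀ j, M'.partner (M.partner (s j)) = s (finRotate p j)) ∧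
      (∀ w, w ∈ ((M.1 ⊔ M'.1).connectedComponentMk v).supp ↔
        w ∈ Set.range s ∨ M.partner w ∈ Set.range s) ∧
      ((M.1 ⊔ M'.1).connectedComponentMk v).supp.ncard = 2 * p ∧
      (M'.partner (M.partner v) = v → p = 1) := by
  set σ := M.partner
  set τ := M'.partner
  have hσ : IsMatchingPerm σ := M.isMatchingPerm
  have hτ : IsMatchingPerm τ := M'.isMatchingPerm
  obtain ⟨p, s, hp, h1, h2, h3⟩ := hσ.exists_cycle hτ v
  have hadj : ∀ v w, (M.1 ⊔ M'.1).Adj v w ↔ σ v = w ∨ τ v = w := fun v w => by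
    rw [SimpleGraph.sup_adj, M.adj_iff, M'.adj_iff]
  have hv : s ⟨0, hp⟩ = v := by simp [h3]
  -- The orbit together with its σ-partners is closed under adjacency, so a walk from v cannot leave
  -- it.
  have hstep : ∀ u w, (u ∈ Set.range s ∨ σ u ∈ Set.range s) → (M.1 ⊔ M'.1).Adj u w →
      (w ∈ Set.range s ∨ σ w ∈ Set.range s) := by
    intro u w hu hw
    rcases (hadj u w).1 hw with rfl | rfl
    · rw [hσ.1]; exact hu.symm
    · rcases hu with ⟨j, rfl⟩ | ⟨j, hj⟩
      · right
        obtain ⟨k, rfl⟩ := (finRotate p).surjective j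
        rw [← h2, hτ.1, hσ.1]; exact ⟨k, rfl⟩
      · left
        refine ⟨finRotate p j, ?_⟩
        rw [← h2, hj, hσ.1]
  have hsupp : ∀ w, w ∈ ((M.1 ⊔ M'.1).connectedComponentMk v).supp ↔
      w ∈ Set.range s ∨ σ w ∈ Set.range s := by
    intro w
    rw [SimpleGraph.ConnectedComponent.mem_supp_iff, SimpleGraph.ConnectedComponent.eq]
    constructor
    · rintro hr
      obtain ⟨q⟩ := hr.symm
      have key : ∀ u w (q : (M.1 ⊔ M'.1).Walk u w), (u ∈ Set.range s ∨ σ u ∈ Set.range s) →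
          (w ∈ Set.range s ∨ σ w ∈ Set.range s) := by
        intro u w q
        induction q with
        | nil => exact id
        | cons h _ ih => exact fun hu => ih (hstep _ _ hu h)
      exact key _ _ q (Or.inl ⟨_, hv⟩)
    · have hpow : ∀ k : ℕ, (M.1 ⊔ M'.1).Reachable (((τ * σ) ^ k) v) v := by
        intro k
        induction k with
        | zero => simp
        | succ k ih =>
          refine SimpleGraph.Reachable.trans ?_ ih
          rw [pow_succ']
          have e1 : (M.1 ⊔ M'.1).Adj (((τ * σ) ^ k) v) (σ (((τ * σ) ^ k) v)) :=
            (hadj _ _).2 (Or.inl rfl)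
          have e2 : (M.1 ⊔ M'.1).Adj (σ (((τ * σ) ^ k) v)) (τ (σ (((τ * σ) ^ k) v))) :=
            (hadj _ _).2 (Or.inr rfl)
          exact (e1.reachable.trans e2.reachable).symm
      rintro (⟨j, rfl⟩ | ⟨j, hj⟩)
      · rw [h3]; exact hpow _
      · have e1 : (M.1 ⊔ M'.1).Adj w (σ w) := (hadj _ _).2 (Or.inl rfl)
        refine e1.reachable.trans ?_
        rw [← hj, h3]; exact hpow _
  refine ⟨p, s, hp, h1, h2, hsupp, ?_, fun h => ?_⟩
  · have hset : ((M.1 ⊔ M'.1).connectedComponentMk v).supp =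
        ((Finset.univ.map s ∪ (Finset.univ.map s).map σ.toEmbedding : Finset _) : Set _) := by
      ext w
      rw [hsupp]
      simp only [Finset.coe_union, Finset.coe_map, Finset.coe_univ, Set.image_univ,
        Set.mem_union, Set.mem_range, Set.mem_image, Equiv.coe_toEmbedding,
        exists_exists_eq_and]
      refine or_congr Iff.rfl (exists_congr fun j => ?_)
      rw [eq_comm, eq_comm (b := w), hσ.apply_eq_iff, eq_comm]
    rw [hset, Set.ncard_coe_finset, Finset.card_union_of_disjoint]
    · simp; ring
    · rw [Finset.disjoint_left]
      intro v hv hv'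
      simp only [Finset.mem_map, Finset.mem_univ, true_and, Equiv.coe_toEmbedding,
        exists_exists_eq_and] at hv hv'
      obtain ⟨j, rfl⟩ := hv
      obtain ⟨k, hk⟩ := hv'
      exact h1 k j hk
  · by_contra hp1
    have hp2 : 2 ≤ p := by omega
    have := h2 ⟨0, hp⟩
    rw [hv, h, ← hv] at this
    exact finRotate_ne hp2 _ (s.injective this).symm

/-- The matchings adjacent to a given one in the matching graph. -/
lemma matchingType_eq_hookType_iff {i : ℕ} (hi : 2 ≤ i) (hin : i ≤ n)
    (M M' : PerfectMatching n) :
    matchingType M.1 M'.1 = hookType n i ↔ HookRel i M.partner M'.partner := by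
  classical
  set U := M.1 ⊔ M'.1 with hU
  let _ : Fintype U.ConnectedComponent := Fintype.ofFinite _
  let f : U.ConnectedComponent → ℕ := fun c => c.supp.ncard / 2
  have htype : matchingType M.1 M'.1 = Finset.univ.val.map f := rfl
  have hσ := M.isMatchingPerm
  have hτ := M'.isMatchingPerm
  constructor
  · intro h
    rw [htype] at h
    have hmem : i ∈ Finset.univ.val.map f := by rw [h]; simp [hookType]
    obtain ⟨c₀, -, hc₀⟩ := Multiset.mem_map.1 hmem
    -- Cancelling the part of `c₀` from both multisets leaves only ones.
    have hrest : ∀ c, c ≠ c₀ → f c = 1 := by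
      intro c hc
      have h1 : Finset.univ.val.map f = f c₀ ::ₘ (Finset.univ.erase c₀).val.map f := by
        rw [← Multiset.map_cons, ← Finset.insert_val_of_notMem (Finset.notMem_erase _ _),
          Finset.insert_erase (Finset.mem_univ _)]
      rw [h1, hc₀, hookType, Multiset.cons_inj_right] at h
      have h2 : f c ∈ (Finset.univ.erase c₀).val.map f :=
        Multiset.mem_map_of_mem f
          (Finset.mem_erase.2 ⟨hc, Finset.mem_univ _⟩ : c ∈ Finset.univ.erase c₀)
      rw [h] at h2
      exact Multiset.eq_of_mem_replicate h2
    obtain ⟨v, rfl⟩ := c₀.exists_rep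
    obtain ⟨p, s, hp, h1, h2, h3, h4, -⟩ := exists_component_cycle M M' v
    have hpi : p = i := by
      have : f (U.connectedComponentMk v) = i := hc₀
      simp only [f, U, h4] at this
      omega
    subst hpi
    refine ⟨s, h1, h2, fun w hw hw' => ?_⟩
    have hne : U.connectedComponentMk w ≠ Quot.mk _ v := by
      intro hc
      have : w ∈ (U.connectedComponentMk v).supp :=
        SimpleGraph.ConnectedComponent.mem_supp_iff _ _ |>.2 hc
      rcases (h3 w).1 this with h | h
      · exact hw h
      · exact hw' h
    obtain ⟨q, t, hq, g1, g2, g3, g4, -⟩ := exists_component_cycle M M' w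
    have hq1 : q = 1 := by
      have := hrest _ hne
      simp only [f, U, g4] at this
      omega
    subst hq1
    have hr : ∀ j, M'.partner (M.partner (t j)) = t j := fun j => by
      rw [g2]; congr 1; exact Subsingleton.elim _ _
    have hw : w ∈ (U.connectedComponentMk w).supp :=
      SimpleGraph.ConnectedComponent.mem_supp_iff _ _ |>.2 rfl
    rcases (g3 w).1 hw with ⟨j, rfl⟩ | ⟨j, hj⟩
    · rw [← hτ.apply_eq_iff.1 (hr j)]
    · have := hr j
      rw [hj, hσ.1] at this
      exact this
  · rintro ⟨s, hs⟩
    have hD := fun {v} => hs.mem_disagreement_iff hi hσ hτ (v := v)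
    let v := s ⟨0, by omega⟩
    have hv : v ∈ disagreement M.partner M'.partner := hD.2 (Or.inl ⟨_, rfl⟩)
    have hone : ∀ w, w ∉ disagreement M.partner M'.partner →
        (U.connectedComponentMk w).supp.ncard = 2 := by
      intro w hw
      obtain ⟨q, t, hq, g1, g2, g3, g4, g5⟩ := exists_component_cycle M M' w
      have hq1 : q = 1 := g5 (by rw [hτ.apply_eq_iff]; simpa using hw)
      rw [g4, hq1]
    have hadj : ∀ v w, U.Adj v w ↔ M.partner v = w ∨ M'.partner v = w := fun v w => by
      rw [hU, SimpleGraph.sup_adj, M.adj_iff, M'.adj_iff]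
    have hmem : ∀ w u, w ∈ (U.connectedComponentMk u).supp ↔
        U.connectedComponentMk w = U.connectedComponentMk u := fun w u =>
      SimpleGraph.ConnectedComponent.mem_supp_iff _ _
    have hstep : ∀ w u, U.Adj w u → w ∈ (U.connectedComponentMk v).supp →
        u ∈ (U.connectedComponentMk v).supp := by
      intro w u h hw
      rw [hmem] at hw ⊢
      rw [← hw, SimpleGraph.ConnectedComponent.eq]
      exact h.symm.reachable
    have hsub : ∀ w ∈ disagreement M.partner M'.partner,
        w ∈ (U.connectedComponentMk v).supp :=
      hs.disagreement_subset hi hσ hτ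
        (fun w hw => hstep _ _ ((hadj _ _).2 (Or.inl rfl)) hw)
        (fun w hw => hstep _ _ ((hadj _ _).2 (Or.inr rfl)) hw)
        (v := v) ((hmem _ _).2 rfl) hv
    have hge : 2 * i ≤ (U.connectedComponentMk v).supp.ncard := by
      rw [← hs.card_disagreement hi hσ hτ, ← Set.ncard_coe_finset]
      exact Set.ncard_le_ncard hsub (Set.toFinite _)
    have hsupp : (U.connectedComponentMk v).supp =
        (disagreement M.partner M'.partner : Set (Fin (2 * n))) := by
      refine Set.Subset.antisymm (fun w hw => ?_) hsub
      by_contra hw'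
      have h1 := hone w hw'
      rw [(hmem _ _).1 hw] at h1
      omega
    have hcv : (U.connectedComponentMk v).supp.ncard = 2 * i := by
      rw [hsupp, Set.ncard_coe_finset, hs.card_disagreement hi hσ hτ]
    have hother : ∀ c, c ≠ U.connectedComponentMk v → c.supp.ncard = 2 := by
      intro c hc
      obtain ⟨w, rfl⟩ := c.exists_rep
      refine hone w fun hw => hc ?_
      exact (hmem _ _).1 (hsub w hw)
    -- Counting vertices component by component determines how many common edges there are, namely n
    -- - i.
    have hsum : ∑ c : U.ConnectedComponent, c.supp.ncard = 2 * n := by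
      have h1 := Finset.card_eq_sum_card_fiberwise (s := (Finset.univ : Finset (Fin (2 * n))))
        (t := Finset.univ) (f := U.connectedComponentMk) (fun _ _ => Finset.mem_coe.2 (Finset.mem_univ _))
      rw [Finset.card_univ, Fintype.card_fin] at h1
      refine Eq.trans (Finset.sum_congr rfl fun c _ => ?_) h1.symm
      rw [← Set.ncard_coe_finset]
      congr 1
      ext w; simp
    rw [← Finset.add_sum_erase _ _ (Finset.mem_univ (U.connectedComponentMk v)), hcv,
      Finset.sum_congr rfl fun c hc => hother c (Finset.ne_of_mem_erase hc), Finset.sum_const,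
      smul_eq_mul] at hsum
    have h1 : Finset.univ.val.map f = f (U.connectedComponentMk v) ::ₘ
        (Finset.univ.erase (U.connectedComponentMk v)).val.map f := by
      rw [← Multiset.map_cons, ← Finset.insert_val_of_notMem (Finset.notMem_erase _ _),
        Finset.insert_erase (Finset.mem_univ _)]
    have h2 : (Finset.univ.erase (U.connectedComponentMk v)).val.map f =
        Multiset.replicate (n - i) 1 := by
      rw [Multiset.eq_replicate]
      refine ⟨?_, fun b hb => ?_⟩
      · rw [Multiset.card_map, Finset.card_val]; omega
      · obtain ⟨c, hc, rfl⟩ := Multiset.mem_map.1 hb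
        simp only [f]
        rw [hother c (Finset.ne_of_mem_erase hc)]
    rw [htype, h1, h2, hookType]
    congr 1
    simp only [f]
    rw [hcv]; omega

end PerfectMatching

end

/-! ### Counting matchings with prescribed disagreements, and two step walks -/

noncomputable section

set_option linter.unusedSectionVars false

section Counting

variable {α : Type*} [Fintype α] [DecidableEq α] {σ τ ζ : Equiv.Perm α} {i : ℕ}

lemma HookRel.symm {n : ℕ} (hα : Fintype.card α = 2 * n) (hσ : IsMatchingPerm σ)
    (hτ : IsMatchingPerm τ) (h : HookRel i σ τ) : HookRel i τ σ := by
  obtain ⟨g, h1, h2⟩ := hσ.exists_swap hα hτ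
  exact h.conj g h1 h2

/-- The number of permutations that agree with `σ` outside of `E`. -/
lemma card_agree_off_le (hσ : IsMatchingPerm σ) (E : Finset α) :
    (Finset.univ.filter fun τ : Equiv.Perm α => ∀ v, v ∉ E → τ v = σ v).card ≤
      E.card.factorial := by
  have h1 : Fintype.card {π : Equiv.Perm α // ∀ v, v ∉ E → π v = v} = E.card.factorial := by
    rw [← Fintype.card_congr (Equiv.Perm.subtypeEquivSubtypePerm fun v => v ∈ E),
      Fintype.card_perm, Fintype.card_coe]
  rw [← h1, Fintype.card_subtype]
  refine Finset.card_le_card_of_injOn (fun τ => σ * τ) (fun τ hτ => ?_)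
    fun _ _ _ _ h => mul_left_cancel h
  have hτ := (Finset.mem_filter.1 (Finset.mem_coe.1 hτ)).2
  refine Finset.mem_coe.2 (Finset.mem_filter.2 ⟨Finset.mem_univ _, fun v hv => ?_⟩)
  rw [Equiv.Perm.mul_apply, hτ v hv, hσ.1]

lemma exists_subset_image_of_card_le {F : Finset α} {m : ℕ} (hF : F.card ≤ m) [Nonempty α] :
    ∃ w : Fin m → α, F ⊆ Finset.univ.image w := by
  have h : Nonempty (F ↪ Fin m) := by
    rw [Function.Embedding.nonempty_iff_card_le]; simpa using hF
  obtain ⟨e⟩ := h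
  refine ⟨fun j => if h : ∃ v : F, e v = j then h.choose else Classical.arbitrary α,
    fun v hv => ?_⟩
  refine Finset.mem_image.2 ⟨e ⟨v, hv⟩, Finset.mem_univ _, ?_⟩
  have h : ∃ u : F, e u = e ⟨v, hv⟩ := ⟨_, rfl⟩
  rw [dif_pos h, e.injective h.choose_spec]

/-- An invariant set for a fixed point free involution is covered by half as many edges. -/
lemma IsMatchingPerm.exists_cover [Nonempty α] (hσ : IsMatchingPerm σ) {D : Finset α}
    (hD : ∀ v ∈ D, σ v ∈ D) {m : ℕ} (hm : D.card < 2 * m + 2) :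
    ∃ w : Fin m → α, D ⊆ Finset.univ.image w ∪ Finset.univ.image (σ ∘ w) := by
  -- B contains one endpoint of each edge of σ. Hence D has exactly twice as many elements as its
  -- part in B, and the bound on D leaves at most m edges.
  obtain ⟨B, hB, -⟩ := hσ.exists_bipartition hσ
  classical
  set F := D.filter (· ∈ B)
  set F' := D.filter (· ∉ B)
  have h1 : F.card = F'.card := by
    refine Finset.card_bij (fun v _ => σ v) (fun v hv => ?_) (fun v _ w _ h => σ.injective h)
      fun v hv => ?_
    · obtain ⟨h2, h3⟩ := Finset.mem_filter.1 hv
      refine Finset.mem_filter.2 ⟨hD v h2, fun h => (hB v).1 h h3⟩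
    · obtain ⟨h2, h3⟩ := Finset.mem_filter.1 hv
      exact ⟨σ v, Finset.mem_filter.2 ⟨hD v h2, (hB v).2 h3⟩, hσ.1 v⟩
  have h2 : F.card + F'.card = D.card := Finset.card_filter_add_card_filter_not _
  obtain ⟨w, hw⟩ := exists_subset_image_of_card_le (F := F) (m := m) (by omega)
  refine ⟨w, fun v hv => ?_⟩
  by_cases hvB : v ∈ B
  · exact Finset.mem_union_left _ (hw (Finset.mem_filter.2 ⟨hv, hvB⟩))
  · refine Finset.mem_union_right _ ?_
    have h3 : σ v ∈ F := Finset.mem_filter.2 ⟨hD v hv, (hB v).2 hvB⟩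
    obtain ⟨j, -, hj⟩ := Finset.mem_image.1 (hw h3)
    exact Finset.mem_image.2 ⟨j, Finset.mem_univ _, by rw [Function.comp_apply, hj, hσ.1]⟩

open Classical in
/-- The number of matchings that agree with `σ` at all but a bounded number of vertices
outside of `S`. -/
lemma IsMatchingPerm.card_disagreement_sdiff_le [Nonempty α] (hσ : IsMatchingPerm σ)
    {S : Finset α} (hS : ∀ v ∈ S, σ v ∈ S) {c : ℕ} (hc : S.card ≤ c) (m : ℕ) :
    (Finset.univ.filter fun τ : Equiv.Perm α =>
      IsMatchingPerm τ ∧ (disagreement σ τ \ S).card < 2 * m + 2).card ≤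
      Fintype.card α ^ m * (c + 2 * m).factorial := by
  -- A matching in question differs from σ only on S and on at most m further edges of σ. Choosing
  -- an endpoint of each costs |α|^m, and rearranging the exceptional set costs a bounded factorial.
  let E : (Fin m → α) → Finset α := fun w =>
    S ∪ (Finset.univ.image w ∪ Finset.univ.image (σ ∘ w))
  have hE : ∀ w, (E w).card ≤ c + 2 * m := by
    intro w
    refine (Finset.card_union_le _ _).trans (add_le_add hc ((Finset.card_union_le _ _).trans ?_))
    have h1 := Finset.card_image_le (s := Finset.univ) (f := w)
    have h2 := Finset.card_image_le (s := Finset.univ) (f := σ ∘ w)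
    rw [Finset.card_univ, Fintype.card_fin] at h1 h2
    omega
  have hsub : (Finset.univ.filter fun τ : Equiv.Perm α =>
      IsMatchingPerm τ ∧ (disagreement σ τ \ S).card < 2 * m + 2) ⊆
      Finset.univ.biUnion fun w : Fin m → α =>
        Finset.univ.filter fun τ : Equiv.Perm α => ∀ v, v ∉ E w → τ v = σ v := by
    intro τ hτ
    obtain ⟨-, hτ, hcard⟩ := Finset.mem_filter.1 hτ
    have hinv : ∀ v ∈ disagreement σ τ \ S, σ v ∈ disagreement σ τ \ S := by
      intro v hv
      rw [Finset.mem_sdiff] at hv ⊢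
      refine ⟨(hσ.apply_mem_disagreement_left hτ).2 hv.1, fun h => hv.2 ?_⟩
      rw [← hσ.1 v]; exact hS _ h
    obtain ⟨w, hw⟩ := hσ.exists_cover hinv hcard
    refine Finset.mem_biUnion.2 ⟨w, Finset.mem_univ _, Finset.mem_filter.2
      ⟨Finset.mem_univ _, fun v hv => ?_⟩⟩
    by_contra h
    apply hv
    by_cases hvS : v ∈ S
    · exact Finset.mem_union_left _ hvS
    · exact Finset.mem_union_right _ (hw (Finset.mem_sdiff.2
        ⟨mem_disagreement.2 fun h' => h h'.symm, hvS⟩))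
  refine (Finset.card_le_card hsub).trans (Finset.card_biUnion_le.trans ?_)
  refine (Finset.sum_le_sum fun w _ => (card_agree_off_le hσ (E w)).trans
    (Nat.factorial_le (hE w))).trans_eq ?_
  simp

/-- In a path `σ`, `ζ`, `τ` of the matching graph, more than half of the disagreement of `σ` and
`τ` lies in that of `σ` and `ζ`, unless the two steps are disjoint or cancel. -/
lemma HookRel.disagreement_inter (hi : 2 ≤ i) (hσ : IsMatchingPerm σ) (hζ : IsMatchingPerm ζ)
    (hτ : IsMatchingPerm τ) (h1 : HookRel i σ ζ) (h2 : HookRel i ζ τ)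
    (hpos : 0 < (disagreement σ τ).card) (hlt : (disagreement σ τ).card < 4 * i) :
    2 * (disagreement σ ζ \ disagreement σ τ).card + (disagreement σ τ).card + 1 ≤ 4 * i := by
  obtain ⟨s, hs⟩ := h1
  obtain ⟨t, ht⟩ := h2
  have hT := hs.card_disagreement hi hσ hζ
  have hR := ht.card_disagreement hi hζ hτ
  set S := disagreement σ τ with hSdef
  set T := disagreement σ ζ with hTdef
  set R := disagreement ζ τ with hRdef
  have hSR : S \ T ⊆ R := by
    intro v hv
    simp only [S, T, R, Finset.mem_sdiff, mem_disagreement, not_not] at hv ⊢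
    rw [← hv.2]; exact hv.1
  have hTR : T \ S ⊆ R := by
    intro v hv
    simp only [S, T, R, Finset.mem_sdiff, mem_disagreement, not_not] at hv ⊢
    rw [← hv.2]; exact fun h => hv.1 h.symm
  have hdisj : Disjoint (S \ T) (T \ S) := by
    rw [Finset.disjoint_left]
    intro v hv hv'
    exact (Finset.mem_sdiff.1 hv').2 (Finset.mem_sdiff.1 hv).1
  have e1 := Finset.card_sdiff_add_card_inter T S
  have e2 := Finset.card_sdiff_add_card_inter S T
  rw [Finset.inter_comm] at e2
  -- The symmetric difference of S and T lies in R, which has 2i elements. If T \ S is nonempty and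
  -- closed under ζ, connectedness of the cycle gives T \ S = T, which forces S to be empty. If it
  -- is not closed, some ζ v lies in R but in T ∩ S, and this extra vertex provides the +1.
  by_cases hQ : ∀ v ∈ T \ S, ζ v ∈ T \ S
  · rcases (T \ S).eq_empty_or_nonempty with he | ⟨v, hv⟩
    · rw [he]; simp only [Finset.card_empty]; omega
    · have hall := hs.disagreement_subset hi hσ hζ (Q := ((T \ S : Finset α) : Set α))
        (fun v hv => by
          have hv := Finset.mem_sdiff.1 (Finset.mem_coe.1 hv)
          exact Finset.mem_coe.2 (Finset.mem_sdiff.2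
            ⟨(hσ.apply_mem_disagreement_left hζ).2 hv.1,
              fun h => hv.2 ((hσ.apply_mem_disagreement_left hτ).1 h)⟩))
        (fun v hv => hQ v hv) (v := v) hv (Finset.mem_sdiff.1 hv).1
      have hTS : T \ S = T := Finset.Subset.antisymm Finset.sdiff_subset fun v hv => hall v hv
      have h3 := Finset.card_le_card (Finset.union_subset hSR hTR)
      rw [Finset.card_union_of_disjoint hdisj] at h3
      rw [hTS] at e1 h3
      omega
  · push Not at hQ
    obtain ⟨v, hv, hζv⟩ := hQ
    have hR' : insert (ζ v) (S \ T ∪ T \ S) ⊆ R := by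
      refine Finset.insert_subset ?_ (Finset.union_subset hSR hTR)
      exact (hζ.apply_mem_disagreement_left hτ).2 (hTR hv)
    have hζT : ζ v ∈ T := (hσ.apply_mem_disagreement_right hζ).2 (Finset.mem_sdiff.1 hv).1
    have hnot : ζ v ∉ S \ T ∪ T \ S := by
      rw [Finset.mem_union, not_or]
      exact ⟨fun h => (Finset.mem_sdiff.1 h).2 hζT, hζv⟩
    have h3 := Finset.card_le_card hR'
    rw [Finset.card_insert_of_notMem hnot, Finset.card_union_of_disjoint hdisj] at h3
    omega

/-- Two disjoint steps in the matching graph can be performed in the other order. -/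
lemma HookRel.exists_other {n : ℕ} (hα : Fintype.card α = 2 * n) (hi : 2 ≤ i)
    (hσ : IsMatchingPerm σ) (hζ : IsMatchingPerm ζ)
    (hτ : IsMatchingPerm τ) (h1 : HookRel i σ ζ) (h2 : HookRel i ζ τ)
    (hcard : (disagreement σ τ).card = 4 * i) :
    ∃ ζ', IsMatchingPerm ζ' ∧ HookRel i σ ζ' ∧ HookRel i ζ' τ ∧ ζ' ≠ ζ := by
  have hT : (disagreement σ ζ).card = 2 * i := by
    obtain ⟨s, hs⟩ := h1; exact hs.card_disagreement hi hσ hζ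
  have hR : (disagreement ζ τ).card = 2 * i := by
    obtain ⟨s, hs⟩ := h2; exact hs.card_disagreement hi hζ hτ
  have hsub : disagreement σ τ ⊆ disagreement σ ζ ∪ disagreement ζ τ := by
    intro v hv
    rw [Finset.mem_union, mem_disagreement, mem_disagreement]
    rw [mem_disagreement] at hv
    by_contra! h
    exact hv (h.1.trans h.2)
  -- Two sets of size 2i can cover 4i vertices only if they are disjoint.
  have hdisj : Disjoint (disagreement σ ζ) (disagreement ζ τ) := by
    rw [← Finset.card_union_eq_card_add_card]
    have h3 := Finset.card_le_card hsub
    have h4 := Finset.card_union_le (disagreement σ ζ) (disagreement ζ τ)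
    omega
  obtain ⟨c, hc, hcf⟩ := hσ.exists_conj hα hζ
  obtain ⟨c', hc', hcf'⟩ := hζ.exists_conj hα hτ
  have hcomm : Commute c c' := by
    apply Equiv.Perm.Disjoint.commute
    intro v
    by_cases hv : v ∈ disagreement σ ζ
    · right
      refine hcf' v (by_contra fun h => Finset.disjoint_left.1 hdisj hv (mem_disagreement.2 h))
    · left
      exact hcf v (by simpa using hv)
  have hcomm' : ∀ v, c (c' v) = c' (c v) := fun v => by
    rw [← Equiv.Perm.mul_apply, hcomm.eq, Equiv.Perm.mul_apply]
  -- The conjugators c and c' have disjoint supports and commute, so applying the second step to σ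
  -- first gives another midpoint.
  refine ⟨c' * σ * c'⁻¹, hσ.conj c', h2.conj c⁻¹ ?_ ?_, h1.conj c' ?_ hc', ?_⟩
  · intro v
    rw [Equiv.Perm.inv_eq_iff_eq, hc]; simp
  · intro v
    obtain ⟨u, rfl⟩ := c.surjective v
    obtain ⟨u, rfl⟩ := c'.surjective u
    rw [Equiv.Perm.inv_eq_iff_eq]
    suffices h : τ (c (c' u)) = c (c' (σ u)) by simpa using h
    rw [hcomm', hcomm', hc, hc']
  · intro v; simp
  · intro h
    have hne : (disagreement σ ζ).Nonempty := by rw [← Finset.card_pos]; omega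
    obtain ⟨t, ht⟩ := hne
    have hfix : ∀ u ∈ disagreement σ ζ, c' u = u := fun u hu =>
      hcf' u (by_contra fun h => Finset.disjoint_left.1 hdisj hu (mem_disagreement.2 h))
    have ht' := (hσ.apply_mem_disagreement_left hζ).2 ht
    have h3 : (c' * σ * c'⁻¹) (c' t) = σ t := by
      simp [hfix _ ht']
    rw [h, hfix t ht] at h3
    exact mem_disagreement.1 ht h3.symm

lemma disagreement_card_of_disjoint (hdisj : Disjoint (disagreement σ ζ) (disagreement ζ τ)) :
    (disagreement σ τ).card = (disagreement σ ζ).card + (disagreement ζ τ).card := by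
  rw [← Finset.card_union_of_disjoint hdisj]
  congr 1
  ext v
  have := fun h : v ∈ disagreement σ ζ => Finset.disjoint_left.1 hdisj h
  simp only [mem_disagreement, Finset.mem_union, not_not, ne_eq] at this ⊢
  by_cases h1 : σ v = ζ v
  · simp [h1]
  · simp [h1, ← this h1]

end Counting

end

/-! ### The matching graph: distances and numbers of two step walks -/

noncomputable section

set_option linter.unusedSectionVars false

namespace PerfectMatching

variable {n i : ℕ}

/-- The number of vertices at which two matchings disagree. -/
def dist (M M' : PerfectMatching n) : ℕ := (disagreement M.partner M'.partner).card

open Classical in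
/-- The number of two step walks in the matching graph. -/
def walks (i : ℕ) (M M' : PerfectMatching n) : ℕ :=
  (Finset.univ.filter fun Z : PerfectMatching n =>
    HookRel i M.partner Z.partner ∧ HookRel i Z.partner M'.partner).card

lemma dist_eq_zero_iff {M M' : PerfectMatching n} : dist M M' = 0 ↔ M = M' := by
  unfold dist
  rw [Finset.card_eq_zero]
  constructor
  · intro h
    apply partner_injective
    ext v
    by_contra hv
    have : v ∈ disagreement M.partner M'.partner :=
      mem_disagreement.2 fun h' => hv (by rw [h'])
    rw [h] at this
    simp at this
  · rintro rfl; ext v; simp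

lemma dist_triangle (M Z M' : PerfectMatching n) : dist M M' ≤ dist M Z + dist Z M' := by
  unfold dist
  refine (Finset.card_le_card fun v hv => ?_).trans (Finset.card_union_le _ _)
  rw [mem_disagreement] at hv
  rw [Finset.mem_union, mem_disagreement, mem_disagreement]
  by_contra! h
  exact hv (h.1.trans h.2)

lemma dist_of_hookRel (hi : 2 ≤ i) {M M' : PerfectMatching n}
    (h : HookRel i M.partner M'.partner) : dist M M' = 2 * i := by
  obtain ⟨s, hs⟩ := h
  exact hs.card_disagreement hi M.isMatchingPerm M'.isMatchingPerm

lemma hookRel_comm {M M' : PerfectMatching n} :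
    HookRel i M.partner M'.partner ↔ HookRel i M'.partner M.partner :=
  ⟨fun h => h.symm (Fintype.card_fin _) M.isMatchingPerm M'.isMatchingPerm,
    fun h => h.symm (Fintype.card_fin _) M'.isMatchingPerm M.isMatchingPerm⟩

lemma matchingGraph_adj_iff (hi : 2 ≤ i) (hin : i ≤ n) {M M' : PerfectMatching n} :
    (matchingGraph n i).Adj M M' ↔ HookRel i M.partner M'.partner := by
  rw [← matchingType_eq_hookType_iff hi hin]
  refine ⟨fun h => h.2, fun h => ⟨?_, h⟩⟩
  rw [matchingType_eq_hookType_iff hi hin] at h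
  rintro rfl
  have h1 := dist_of_hookRel hi h
  rw [dist_eq_zero_iff.2 rfl] at h1
  omega

open Classical in
lemma card_neighbors (hi : 2 ≤ i) (M : PerfectMatching n) :
    (Finset.univ.filter fun M' : PerfectMatching n => HookRel i M.partner M'.partner).card =
      hookDegree n i := by
  rw [← M.isMatchingPerm.card_hookNeighbors (Fintype.card_fin _) hi]
  refine Finset.card_bij (fun M' _ => M'.partner) (fun M' h => ?_)
    (fun _ _ _ _ h => partner_injective h) fun τ hτ => ?_
  · exact mem_hookNeighbors.2 ⟨M'.isMatchingPerm, (Finset.mem_filter.1 h).2⟩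
  · obtain ⟨h1, h2⟩ := mem_hookNeighbors.1 hτ
    exact ⟨ofPerm τ h1, Finset.mem_filter.2 ⟨Finset.mem_univ _, by rwa [partner_ofPerm]⟩,
      partner_ofPerm τ h1⟩

open Classical in
lemma walks_self (hi : 2 ≤ i) (M : PerfectMatching n) : walks i M M = hookDegree n i := by
  rw [← card_neighbors hi M]
  unfold walks
  congr 1
  refine Finset.filter_congr fun Z _ => ⟨fun h => h.1, fun h => ⟨h, hookRel_comm.1 h⟩⟩

open Classical in
lemma walks_eq_zero (hi : 2 ≤ i) {M M' : PerfectMatching n} (h : 4 * i < dist M M') :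
    walks i M M' = 0 := by
  unfold walks
  rw [Finset.card_eq_zero, Finset.filter_eq_empty_iff]
  rintro Z - ⟨h1, h2⟩
  have := dist_triangle M Z M'
  rw [dist_of_hookRel hi h1, dist_of_hookRel hi h2] at this
  omega

open Classical in
lemma sum_walks_filter (i : ℕ) (M : PerfectMatching n) (p : PerfectMatching n → Prop)
    [DecidablePred p] : ∑ M' with p M', walks i M M' =
      ∑ Z : PerfectMatching n with HookRel i M.partner Z.partner,
        (Finset.univ.filter fun M' : PerfectMatching n =>
          HookRel i Z.partner M'.partner ∧ p M').card := by
  unfold walks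
  simp_rw [Finset.card_filter]
  rw [Finset.sum_filter, Finset.sum_filter]
  have e1 : ∀ M' : PerfectMatching n,
      (if p M' then ∑ Z : PerfectMatching n, (if HookRel i M.partner Z.partner ∧
        HookRel i Z.partner M'.partner then 1 else 0) else 0) =
      ∑ Z : PerfectMatching n, if HookRel i M.partner Z.partner ∧
        HookRel i Z.partner M'.partner ∧ p M' then 1 else 0 := by
    intro M'
    by_cases h : p M' <;> simp [h]
  have e2 : ∀ Z : PerfectMatching n,
      (if HookRel i M.partner Z.partner then ∑ M' : PerfectMatching n,
        (if HookRel i Z.partner M'.partner ∧ p M' then 1 else 0) else 0) =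
      ∑ M' : PerfectMatching n, if HookRel i M.partner Z.partner ∧
        HookRel i Z.partner M'.partner ∧ p M' then 1 else 0 := by
    intro Z
    by_cases h : HookRel i M.partner Z.partner <;> simp [h]
  rw [Finset.sum_congr rfl fun M' _ => e1 M', Finset.sum_congr rfl fun Z _ => e2 Z,
    Finset.sum_comm]

open Classical in
lemma sum_walks (hi : 2 ≤ i) (M : PerfectMatching n) :
    ∑ M', walks i M M' = hookDegree n i ^ 2 := by
  have h := sum_walks_filter i M fun _ => True
  simp only [Finset.filter_true, and_true] at h
  rw [h, Finset.sum_congr rfl fun Z _ => card_neighbors hi Z, Finset.sum_const, card_neighbors hi,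
    smul_eq_mul, sq]

open Classical in
lemma card_dist_sdiff_le (hn : 1 ≤ n) (M : PerfectMatching n) {S : Finset (Fin (2 * n))}
    (hS : ∀ v ∈ S, M.partner v ∈ S) {c : ℕ} (hc : S.card ≤ c) (m : ℕ) :
    (Finset.univ.filter fun M' : PerfectMatching n =>
      (disagreement M.partner M'.partner \ S).card < 2 * m + 2).card ≤
      (2 * n) ^ m * (c + 2 * m).factorial := by
  have : Nonempty (Fin (2 * n)) := ⟨⟨0, by omega⟩⟩
  have h := M.isMatchingPerm.card_disagreement_sdiff_le hS hc m
  rw [Fintype.card_fin] at h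
  refine le_trans ?_ h
  refine Finset.card_le_card_of_injOn partner (fun M' hM' => ?_)
    fun _ _ _ _ h => partner_injective h
  exact Finset.mem_coe.2 (Finset.mem_filter.2 ⟨Finset.mem_univ _, M'.isMatchingPerm,
    (Finset.mem_filter.1 (Finset.mem_coe.1 hM')).2⟩)

open Classical in
-- There are O(n^(d/2)) matchings at distance d, each reached through O(n^e) midpoints with e = ⌊(4i
-- - d - 1)/4⌋. Since d/2 + 2e ≤ 2i - 1/2, the integral exponent is at most 2i - 1, one less than
-- that of the squared degree.
lemma sum_sq_walks_near_le (hi : 2 ≤ i) (hn : 1 ≤ n) (M : PerfectMatching n) :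
    ∑ M' with 0 < dist M M' ∧ dist M M' < 4 * i, walks i M M' ^ 2 ≤
      4 * i * ((2 * n) ^ (2 * i - 1) * (6 * i).factorial ^ 3) := by
  -- The first halving comes from `HookRel.disagreement_inter`; the second passes from vertices to
  -- edges.
  have h1 : ∀ M', 0 < dist M M' → dist M M' < 4 * i →
      walks i M M' ≤ (2 * n) ^ ((4 * i - dist M M' - 1) / 2 / 2) * (6 * i).factorial := by
    intro M' h0 h4
    have h2 := card_dist_sdiff_le hn M (S := disagreement M.partner M'.partner)
      (fun v hv => (M.isMatchingPerm.apply_mem_disagreement_left M'.isMatchingPerm).2 hv)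
      (c := 4 * i) h4.le ((4 * i - dist M M' - 1) / 2 / 2)
    refine le_trans (Finset.card_le_card fun Z hZ => ?_) (h2.trans ?_)
    · obtain ⟨-, h5, h6⟩ := Finset.mem_filter.1 hZ
      have h7 := HookRel.disagreement_inter hi M.isMatchingPerm Z.isMatchingPerm
        M'.isMatchingPerm h5 h6 h0 h4
      refine Finset.mem_filter.2 ⟨Finset.mem_univ _, ?_⟩
      change 2 * _ + dist M M' + 1 ≤ _ at h7
      omega
    · exact Nat.mul_le_mul_left _ (Nat.factorial_le (by omega))
  have h2 : ∀ d, (Finset.univ.filter fun M' : PerfectMatching n => dist M M' = d).card ≤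
      (2 * n) ^ (d / 2) * (2 * (d / 2)).factorial := by
    intro d
    have h3 := card_dist_sdiff_le hn M (S := ∅) (by simp) (c := 0) (by simp) (d / 2)
    rw [zero_add] at h3
    refine le_trans (Finset.card_le_card fun Z hZ => ?_) h3
    refine Finset.mem_filter.2 ⟨Finset.mem_univ _, ?_⟩
    have h4 : (disagreement M.partner Z.partner).card = d := (Finset.mem_filter.1 hZ).2
    rw [Finset.sdiff_empty, h4]
    omega
  have hmaps : Set.MapsTo (dist M)
      (Finset.univ.filter fun M' => 0 < dist M M' ∧ dist M M' < 4 * i : Finset _)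
      (Finset.range (4 * i) : Finset ℕ) := by
    intro M' h
    exact Finset.mem_coe.2 (Finset.mem_range.2 (Finset.mem_filter.1 (Finset.mem_coe.1 h)).2.2)
  rw [← Finset.sum_fiberwise_of_maps_to (fun M' h => hmaps (Finset.mem_coe.2 h))]
  refine (Finset.sum_le_card_nsmul _ _ ((2 * n) ^ (2 * i - 1) * (6 * i).factorial ^ 3)
    fun d hd => ?_).trans_eq (by simp)
  rw [Finset.mem_range] at hd
  rw [Finset.filter_filter]
  calc _ ≤ (Finset.univ.filter fun M' : PerfectMatching n =>
        (0 < dist M M' ∧ dist M M' < 4 * i) ∧ dist M M' = d).card •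
          ((2 * n) ^ ((4 * i - d - 1) / 2 / 2) * (6 * i).factorial) ^ 2 := by
        refine Finset.sum_le_card_nsmul _ _ _ fun M' h => ?_
        obtain ⟨-, ⟨h3, h4⟩, rfl⟩ := Finset.mem_filter.1 h
        exact Nat.pow_le_pow_left (h1 M' h3 h4) 2
    _ ≤ ((2 * n) ^ (d / 2) * (6 * i).factorial) *
          ((2 * n) ^ ((4 * i - d - 1) / 2 / 2) * (6 * i).factorial) ^ 2 := by
        rw [smul_eq_mul]
        refine Nat.mul_le_mul_right _ ((Finset.card_le_card fun M' h => ?_).trans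
          ((h2 d).trans (Nat.mul_le_mul_left _ (Nat.factorial_le (by omega)))))
        exact Finset.mem_filter.2 ⟨Finset.mem_univ _, (Finset.mem_filter.1 h).2.2⟩
    _ = (2 * n) ^ (d / 2 + 2 * ((4 * i - d - 1) / 2 / 2)) * (6 * i).factorial ^ 3 := by
        rw [pow_add, mul_comm 2 ((4 * i - d - 1) / 2 / 2), pow_mul]; ring
    _ ≤ _ := Nat.mul_le_mul_right _ (Nat.pow_le_pow_right (by omega) (by omega))

open Classical in
-- A pair at distance 4i joined by one walk is joined by a second, with the steps interchanged, so
-- w² ≥ 2w there. Nearly all of the k² two step walks, k the degree, end at distance 4i: for any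
-- other the second step meets the first, leaving at most i - 1 free edges.
lemma le_sum_sq_walks_far (hi : 2 ≤ i) (hn : 1 ≤ n) (M : PerfectMatching n) :
    2 * hookDegree n i ^ 2 ≤ ∑ M' with dist M M' = 4 * i, walks i M M' ^ 2 +
      2 * (hookDegree n i * ((2 * n) ^ (i - 1) * (6 * i).factorial)) := by
  have h1 : ∑ M' with dist M M' = 4 * i, 2 * walks i M M' ≤
      ∑ M' with dist M M' = 4 * i, walks i M M' ^ 2 := by
    refine Finset.sum_le_sum fun M' h => ?_
    have hd := (Finset.mem_filter.1 h).2
    rw [sq]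
    rcases Nat.eq_zero_or_pos (walks i M M') with h0 | h0
    · simp [h0]
    · refine Nat.mul_le_mul_right _ ?_
      obtain ⟨Z, hZ⟩ := Finset.card_pos.1 h0
      obtain ⟨-, h5, h6⟩ := Finset.mem_filter.1 hZ
      obtain ⟨ζ, g1, g2, g3, g4⟩ := HookRel.exists_other (Fintype.card_fin _) hi
        M.isMatchingPerm Z.isMatchingPerm M'.isMatchingPerm h5 h6 hd
      refine Nat.succ_le_of_lt (Finset.one_lt_card.2 ⟨Z, hZ, ofPerm ζ g1, ?_, fun h => ?_⟩)
      · refine Finset.mem_filter.2 ⟨Finset.mem_univ _, ?_⟩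
        rw [partner_ofPerm]; exact ⟨g2, g3⟩
      · apply g4
        rw [h, partner_ofPerm]
  have h2 : ∑ M' with dist M M' ≠ 4 * i, walks i M M' ≤
      hookDegree n i * ((2 * n) ^ (i - 1) * (6 * i).factorial) := by
    rw [sum_walks_filter i M fun M' => dist M M' ≠ 4 * i, ← card_neighbors hi M]
    refine (Finset.sum_le_card_nsmul _ _ ((2 * n) ^ (i - 1) * (6 * i).factorial)
      fun Z hZ => ?_).trans_eq (smul_eq_mul _ _)
    have hZ := (Finset.mem_filter.1 hZ).2
    have h3 := card_dist_sdiff_le hn Z (S := disagreement Z.partner M.partner)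
      (fun v hv => (Z.isMatchingPerm.apply_mem_disagreement_left M.isMatchingPerm).2 hv)
      (c := 2 * i) (dist_of_hookRel hi (hookRel_comm.1 hZ)).le (i - 1)
    refine le_trans (Finset.card_le_card fun M' hM' => ?_)
      (h3.trans (Nat.mul_le_mul_left _ (Nat.factorial_le (by omega))))
    obtain ⟨-, h4, h5⟩ := Finset.mem_filter.1 hM'
    refine Finset.mem_filter.2 ⟨Finset.mem_univ _, ?_⟩
    by_contra hge
    apply h5
    have h6 : (disagreement Z.partner M'.partner).card = 2 * i := dist_of_hookRel hi h4
    have h7 : (disagreement M.partner Z.partner).card = 2 * i := dist_of_hookRel hi hZ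
    have h8 := Finset.card_sdiff_add_card_inter (disagreement Z.partner M'.partner)
      (disagreement Z.partner M.partner)
    have h9 : Disjoint (disagreement M.partner Z.partner)
        (disagreement Z.partner M'.partner) := by
      rw [Finset.disjoint_iff_inter_eq_empty, ← Finset.card_eq_zero, Finset.inter_comm,
        disagreement_comm (σ := M.partner)]
      omega
    have h10 := disagreement_card_of_disjoint h9
    change _ = 4 * i
    unfold dist
    omega
  have h3 := sum_walks hi M
  rw [← Finset.sum_filter_add_sum_filter_not Finset.univ fun M' => dist M M' = 4 * i] at h3
  rw [← Finset.mul_sum] at h1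
  simp only [ne_eq] at h2
  omega

end PerfectMatching

lemma pow_le_hookDegree {n i : ℕ} (hi : 1 ≤ i) (hin : i ≤ n) :
    n ^ i ≤ i ^ i * i.factorial * hookDegree n i := by
  -- The smallest factor of the falling factorial n(n-1)⋯(n-i+1) is n + 1 - i, and it is at least
  -- n/i.
  have h1 : n ≤ i * (n + 1 - i) := by
    obtain ⟨a, rfl⟩ := Nat.exists_eq_add_of_le hi
    obtain ⟨b, rfl⟩ := Nat.exists_eq_add_of_le hin
    rw [show 1 + a + b + 1 - (1 + a) = b + 1 by omega]
    nlinarith [Nat.zero_le (a * b)]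
  have h2 : (n + 1 - i) ^ i ≤ i.factorial * n.choose i := by
    have := Nat.pow_sub_le_descFactorial n i
    rwa [Nat.descFactorial_eq_factorial_mul_choose] at this
  have h3 : n.choose i ≤ hookDegree n i := by
    unfold hookDegree
    have h4 : 1 ≤ 2 ^ (i - 1) := Nat.one_le_two_pow
    have h5 : 1 ≤ (i - 1).factorial := Nat.factorial_pos _
    calc n.choose i = 1 * n.choose i * 1 := by ring
      _ ≤ _ := Nat.mul_le_mul (Nat.mul_le_mul_right _ h4) h5
  calc n ^ i ≤ (i * (n + 1 - i)) ^ i := Nat.pow_le_pow_left h1 i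
    _ = i ^ i * (n + 1 - i) ^ i := mul_pow _ _ _
    _ ≤ i ^ i * (i.factorial * hookDegree n i) :=
        Nat.mul_le_mul_left _ (h2.trans (Nat.mul_le_mul_left _ h3))
    _ = _ := by ring

end

/-! ### The normalized adjacency matrix and the central limit theorem for its spectrum -/

noncomputable section

set_option linter.unusedSectionVars false

lemma Matrix.IsHermitian.roots_charpoly_smul {X : Type*} [Fintype X] [DecidableEq X]
    {P : Matrix X X ℝ} (hP : P.IsHermitian) (c : ℝ) :
    (c • P).charpoly.roots = P.charpoly.roots.map (c * ·) := by
  have h : (c • P).charpoly =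
      ∏ j, (Polynomial.X - Polynomial.C (c * hP.eigenvalues j)) := by
    conv_lhs => rw [hP.spectral_theorem, ← map_smul, Unitary.conjStarAlgAut_apply,
      Matrix.charpoly_mul_comm, ← mul_assoc]
    rw [Unitary.coe_star_mul_self, one_mul, ← Matrix.diagonal_smul, Matrix.charpoly_diagonal]
    rfl
  rw [h, hP.roots_charpoly_eq_eigenvalues, Polynomial.roots_prod]
  · simp only [Polynomial.roots_X_sub_C, Multiset.bind_singleton, Multiset.map_map]
    rfl
  · exact Finset.prod_ne_zero_iff.2 fun _ _ => Polynomial.X_sub_C_ne_zero _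

lemma hookDegree_pos {n i : ℕ} (hin : i ≤ n) : 0 < hookDegree n i := by
  unfold hookDegree
  have := Nat.choose_pos hin
  have := Nat.factorial_pos (i - 1)
  positivity

lemma scaling_eq (n i : ℕ) : scaling n i = √(hookDegree n i) := by
  unfold scaling hookDegree; push_cast; rfl

namespace PerfectMatching

variable {n i : ℕ}

open Classical in
/-- The adjacency matrix of the matching graph, normalized by the square root of the degree. -/
def hookMatrix (n i : ℕ) : Matrix (PerfectMatching n) (PerfectMatching n) ℝ :=
  Matrix.of fun M M' => if HookRel i M.partner M'.partner then (√(hookDegree n i))⁻¹ else 0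

lemma isHermitian_hookMatrix : (hookMatrix n i).IsHermitian := by
  ext M M'
  simp only [Matrix.conjTranspose_apply, hookMatrix, Matrix.of_apply, star_trivial]
  rw [hookRel_comm]

open Classical in
lemma walkMatrix_apply (hi : 2 ≤ i) (hin : i ≤ n) (M M' : PerfectMatching n) :
    walkMatrix (matchingGraph n i) M M' =
      if HookRel i M.partner M'.partner then (hookDegree n i : ℝ)⁻¹ else 0 := by
  unfold walkMatrix
  rw [Matrix.of_apply]
  have hdeg : (matchingGraph n i).degree M = hookDegree n i := by
    rw [← card_neighbors hi M, ← SimpleGraph.card_neighborFinset_eq_degree]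
    congr 1
    ext M'
    rw [SimpleGraph.mem_neighborFinset, matchingGraph_adj_iff hi hin]
    simp
  rw [hdeg]
  simp only [matchingGraph_adj_iff hi hin]

lemma isHermitian_walkMatrix (hi : 2 ≤ i) (hin : i ≤ n) :
    (walkMatrix (matchingGraph n i)).IsHermitian := by
  ext M M'
  rw [Matrix.conjTranspose_apply, star_trivial, walkMatrix_apply hi hin, walkMatrix_apply hi hin,
    hookRel_comm]

lemma scaling_smul_walkMatrix (hi : 2 ≤ i) (hin : i ≤ n) :
    scaling n i • walkMatrix (matchingGraph n i) = hookMatrix n i := by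
  ext M M'
  rw [Matrix.smul_apply, walkMatrix_apply hi hin, scaling_eq, hookMatrix, Matrix.of_apply]
  have hk : (0 : ℝ) < hookDegree n i := by exact_mod_cast hookDegree_pos hin
  split_ifs
  · rw [smul_eq_mul]
    have h2 := Real.mul_self_sqrt hk.le
    have h1 := (Real.sqrt_pos.2 hk).ne'
    field_simp
    rw [sq, h2]
  · simp

open Classical in
lemma walkSpectralCDF_eq (hi : 2 ≤ i) (hin : i ≤ n) (x : ℝ) :
    walkSpectralCDF (matchingGraph n i) (scaling n i) x =
      (Finset.univ.filter fun j => (isHermitian_hookMatrix (n := n) (i := i)).eigenvalues j ≤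
        x).card / (Fintype.card (PerfectMatching n) : ℝ) := by
  have h := (isHermitian_walkMatrix hi hin).roots_charpoly_smul (scaling n i)
  rw [scaling_smul_walkMatrix hi hin,
    isHermitian_hookMatrix.roots_charpoly_eq_eigenvalues] at h
  unfold walkSpectralCDF
  congr 2
  have h2 := congrArg (fun s => Multiset.card (s.filter (· ≤ x))) h
  simp only [Multiset.filter_map, Multiset.card_map] at h2
  simp only [Function.comp_def] at h2
  convert! h2.symm using 1
  congr!

open Classical in
lemma hookMatrix_sq_apply (M M' : PerfectMatching n) :
    (hookMatrix n i ^ 2) M M' = walks i M M' / hookDegree n i := by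
  rw [sq, Matrix.mul_apply, walks, Finset.card_filter, Nat.cast_sum, Finset.sum_div]
  refine Finset.sum_congr rfl fun Z _ => ?_
  simp only [hookMatrix, Matrix.of_apply]
  have h2 := Real.mul_self_sqrt (Nat.cast_nonneg (hookDegree n i) : (0 : ℝ) ≤ hookDegree n i)
  by_cases h : HookRel i M.partner Z.partner <;> by_cases h' : HookRel i Z.partner M'.partner <;>
    simp [h, h', ← mul_inv, h2]

/-- The identity matching as a perfect matching. -/
def identity (n : ℕ) : PerfectMatching n :=
  ⟨identityMatching n, fun v => by
    have hv := v.isLt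
    by_cases h : (v : ℕ) < n
    · refine ⟨⟨v + n, by omega⟩, Or.inl rfl, ?_⟩
      rintro w (hw | hw)
      · exact Fin.ext hw.symm
      · omega
    · refine ⟨⟨v - n, by omega⟩, Or.inr (show (v : ℕ) - n + n = v by omega), ?_⟩
      rintro w (hw | hw)
      · have := w.isLt; omega
      · exact Fin.ext (show (w : ℕ) = v - n by omega)⟩

/-- The fraction of vertices at which two matchings agree. -/
def agreement (n : ℕ) : Matrix (PerfectMatching n) (PerfectMatching n) ℝ :=
  Matrix.of fun M M' => 1 - (dist M M' : ℝ) / (2 * n)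

/-- The Gram vectors are the normalized indicators of the oriented edges of a matching. -/
lemma agreement_eq_sum (hn : 1 ≤ n) (M M' : PerfectMatching n) :
    agreement n M M' = ∑ e : Fin (2 * n) × Fin (2 * n),
      (if M.partner e.1 = e.2 then (√(2 * n : ℝ))⁻¹ else 0) *
        (if M'.partner e.1 = e.2 then (√(2 * n : ℝ))⁻¹ else 0) := by
  have hn' : (0 : ℝ) < 2 * n := by positivity
  have h1 : ∀ v : Fin (2 * n), ∑ w : Fin (2 * n),
      (if M.partner v = w then (√(2 * n : ℝ))⁻¹ else 0) *
        (if M'.partner v = w then (√(2 * n : ℝ))⁻¹ else 0) =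
      (1 - if M.partner v ≠ M'.partner v then 1 else 0) / (2 * n : ℝ) := by
    intro v
    simp only [ite_mul, zero_mul, Finset.sum_ite_eq, Finset.mem_univ, if_true]
    by_cases h : M.partner v = M'.partner v
    · rw [if_pos h.symm, if_neg (not_not.2 h), ← mul_inv, Real.mul_self_sqrt hn'.le]
      simp
    · rw [if_neg (fun h' => h h'.symm), if_pos h]; simp
  rw [Fintype.sum_prod_type, Finset.sum_congr rfl fun v _ => h1 v, ← Finset.sum_div,
    Finset.sum_sub_distrib]
  simp only [agreement, Matrix.of_apply, dist, disagreement]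
  rw [Finset.sum_boole]
  simp only [Finset.sum_const, Finset.card_univ, Fintype.card_fin, nsmul_eq_mul, mul_one]
  push_cast
  rw [sub_div, div_self hn'.ne']

lemma agreement_self (M : PerfectMatching n) : agreement n M M = 1 := by
  simp [agreement, dist_eq_zero_iff.2 rfl]

/-- All neighbours are at the same distance 2i, so the agreement is constant on the support of the
matrix. This is the linear regression condition with a = i/n. -/
lemma agreement_mul_hookMatrix (hi : 2 ≤ i) (M M' : PerfectMatching n) :
    agreement n M M' * hookMatrix n i M M' = (1 - (i : ℝ) / n) * hookMatrix n i M M' := by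
  simp only [hookMatrix, Matrix.of_apply]
  split_ifs with h
  · rw [agreement, Matrix.of_apply, dist_of_hookRel hi h]
    push_cast
    rw [mul_div_mul_left _ _ two_ne_zero]
  · simp

/-- The constant in the bound for close pairs. -/
def nearConst (i : ℕ) : ℝ :=
  4 * i * 2 ^ (2 * i - 1) * (6 * i).factorial ^ 3 * (i ^ i * i.factorial) ^ 2

/-- The constant in the bound for distant pairs. -/
def farConst (i : ℕ) : ℝ := 2 ^ i * (6 * i).factorial * (i ^ i * i.factorial)

lemma pow_le_hookDegree_real (hi : 2 ≤ i) (hin : i ≤ n) :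
    (n : ℝ) ^ i ≤ i ^ i * i.factorial * hookDegree n i := by
  exact_mod_cast pow_le_hookDegree (by omega) hin

open Classical in
lemma sum_near_le (hi : 2 ≤ i) (hin : i ≤ n) (M : PerfectMatching n) :
    ∑ M' with 0 < dist M M' ∧ dist M M' < 4 * i, ((walks i M M' : ℝ) / hookDegree n i) ^ 2 ≤
      nearConst i / n := by
  have hk : (0 : ℝ) < hookDegree n i := by exact_mod_cast hookDegree_pos hin
  have hn : (0 : ℝ) < n := by exact_mod_cast (show 0 < n by omega)
  have h1 : ∑ M' with 0 < dist M M' ∧ dist M M' < 4 * i, (walks i M M' : ℝ) ^ 2 ≤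
      4 * i * ((2 * n) ^ (2 * i - 1) * (6 * i).factorial ^ 3) := by
    exact_mod_cast sum_sq_walks_near_le hi (by omega) M
  have h2 := pow_le_pow_left₀ (by positivity) (pow_le_hookDegree_real hi hin) 2
  simp_rw [div_pow]
  rw [← Finset.sum_div, div_le_div_iff₀ (by positivity) hn]
  calc _ ≤ (4 * i * ((2 * n) ^ (2 * i - 1) * (6 * i).factorial ^ 3) : ℝ) * n :=
        mul_le_mul_of_nonneg_right h1 hn.le
    _ = (4 * i * 2 ^ (2 * i - 1) * (6 * i).factorial ^ 3) * ((n : ℝ) ^ i) ^ 2 := by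
        rw [← pow_mul, mul_comm i 2]
        obtain ⟨m, hm⟩ : ∃ m, 2 * i = m + 1 := ⟨2 * i - 1, by omega⟩
        rw [hm, Nat.add_sub_cancel, pow_succ, mul_pow]
        ring
    _ ≤ (4 * i * 2 ^ (2 * i - 1) * (6 * i).factorial ^ 3) *
          (i ^ i * i.factorial * hookDegree n i) ^ 2 :=
        mul_le_mul_of_nonneg_left h2 (by positivity)
    _ = _ := by unfold nearConst; ring

open Classical in
lemma le_sum_far (hi : 2 ≤ i) (hin : i ≤ n) (M : PerfectMatching n) :
    2 - farConst i / n ≤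
      ∑ M' with dist M M' = 4 * i, ((walks i M M' : ℝ) / hookDegree n i) ^ 2 := by
  have hk : (0 : ℝ) < hookDegree n i := by exact_mod_cast hookDegree_pos hin
  have hn : (0 : ℝ) < n := by exact_mod_cast (show 0 < n by omega)
  have h1 : (2 : ℝ) * hookDegree n i ^ 2 ≤
      ∑ M' with dist M M' = 4 * i, (walks i M M' : ℝ) ^ 2 +
      2 * (hookDegree n i * ((2 * n) ^ (i - 1) * (6 * i).factorial)) := by
    exact_mod_cast le_sum_sq_walks_far hi (by omega) M
  have h2 := pow_le_hookDegree_real hi hin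
  have h3 : (2 : ℝ) * (hookDegree n i * ((2 * n) ^ (i - 1) * (6 * i).factorial)) ≤
      farConst i / n * hookDegree n i ^ 2 := by
    rw [div_mul_eq_mul_div, le_div_iff₀ hn]
    calc _ = (2 ^ i * (6 * i).factorial * hookDegree n i) * (n : ℝ) ^ i := by
          obtain ⟨m, hm⟩ : ∃ m, i = m + 1 := ⟨i - 1, by omega⟩
          rw [hm, Nat.add_sub_cancel, pow_succ, pow_succ, mul_pow]
          ring
      _ ≤ (2 ^ i * (6 * i).factorial * hookDegree n i) *
            (i ^ i * i.factorial * hookDegree n i) :=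
          mul_le_mul_of_nonneg_left h2 (by positivity)
      _ = _ := by unfold farConst; ring
  simp_rw [div_pow]
  rw [← Finset.sum_div, le_div_iff₀ (by positivity)]
  linarith

/-- The constant in the central limit theorem. -/
def cltConst (i : ℕ) : ℝ :=
  √(nearConst i) + √(2 * i * (8 * i * nearConst i + 4 * i * farConst i)) / (2 * i) + 1

/-- With a = i/n, V = O(1/n) and F = O(1/n²), the three error terms have orders n^(-1/2), n^(-1/2)/δ
and δ. The choice δ = n^(-1/4) balances the last two. -/
theorem abs_walkSpectralCDF_sub_le (hi : 2 ≤ i) (hin : i ≤ n) (x₀ : ℝ) :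
    |walkSpectralCDF (matchingGraph n i) (scaling n i) x₀ - normalCDF x₀| ≤
      cltConst i * (n : ℝ) ^ (-(1 / 4) : ℝ) := by
  classical
  have hk : (0 : ℝ) < hookDegree n i := by exact_mod_cast hookDegree_pos hin
  have hn : (0 : ℝ) < n := by exact_mod_cast (show 0 < n by omega)
  have hi0 : (0 : ℝ) < i := by exact_mod_cast (show 0 < i by omega)
  have hB1 : 0 ≤ nearConst i := by unfold nearConst; positivity
  have hB2 : 0 ≤ farConst i := by unfold farConst; positivity
  have hne : Nonempty (PerfectMatching n) := ⟨identity n⟩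
  have hN : (0 : ℝ) < Fintype.card (PerfectMatching n) := by exact_mod_cast Fintype.card_pos
  have havg : ∀ (f : PerfectMatching n → ℝ) (b : ℝ), (∀ M, f M ≤ b) →
      (Fintype.card (PerfectMatching n) : ℝ)⁻¹ * ∑ M, f M ≤ b := by
    intro f b h
    rw [inv_mul_le_iff₀ hN]
    refine (Finset.sum_le_card_nsmul _ _ b fun M _ => h M).trans_eq ?_
    rw [nsmul_eq_mul, Finset.card_univ]
  set q : ℝ := (n : ℝ) ^ (-(1 / 4) : ℝ) with hq
  have hq0 : 0 < q := Real.rpow_pos_of_pos hn _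
  have hq4 : q ^ 4 = (n : ℝ)⁻¹ := by
    rw [hq, ← Real.rpow_natCast, ← Real.rpow_mul hn.le, ← Real.rpow_neg_one]
    norm_num
  have hq1 : q ≤ 1 := Real.rpow_le_one_of_one_le_of_nonpos
    (by exact_mod_cast (show 1 ≤ n by omega)) (by norm_num)
  have hdist : ∀ M M' : PerfectMatching n, M ≠ M' → 0 < dist M M' := fun M M' h =>
    Nat.pos_of_ne_zero fun h' => h (dist_eq_zero_iff.1 h')
  have h := (isHermitian_hookMatrix (n := n) (i := i)).eigenvalue_normal_bound
    (Φ := agreement n) (agreement_eq_sum (by omega)) agreement_self (a := i / n)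
    (by positivity) (agreement_mul_hookMatrix hi)
    (fun M => by rw [hookMatrix_sq_apply, walks_self hi, div_self hk.ne'])
    (V := nearConst i / n) (F := (8 * i * nearConst i + 4 * i * farConst i) / n ^ 2)
    (havg _ _ fun M => ?_) (havg _ _ fun M => ?_) hq0 x₀
  · rw [walkSpectralCDF_eq hi hin]
    refine h.trans ?_
    have e1 : √(nearConst i / n) ≤ √(nearConst i) * q := by
      rw [div_eq_mul_inv, ← hq4, Real.sqrt_mul hB1]
      refine mul_le_mul_of_nonneg_left ?_ (Real.sqrt_nonneg _)
      rw [Real.sqrt_le_left hq0.le]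
      exact pow_le_pow_of_le_one hq0.le hq1 (by norm_num)
    have e2 : √(2 * (i / n) * ((8 * i * nearConst i + 4 * i * farConst i) / n ^ 2)) /
        (2 * (i / n) * q) =
        √(2 * i * (8 * i * nearConst i + 4 * i * farConst i)) / (2 * i) * q := by
      have e3 : 2 * (i / n) * ((8 * i * nearConst i + 4 * i * farConst i) / n ^ 2) =
          2 * i * (8 * i * nearConst i + 4 * i * farConst i) * (q ^ 6) ^ 2 := by
        rw [← pow_mul, show 6 * 2 = 4 * 3 from rfl, pow_mul, hq4]
        field_simp
      rw [e3, Real.sqrt_mul' _ (by positivity), Real.sqrt_sq (by positivity), div_eq_mul_inv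
        (i : ℝ), ← hq4]
      field_simp
    rw [e2]
    unfold cltConst
    linarith
  -- The factor Φ - 1 + 2a equals (4i - d)/(2n): it vanishes at d = 4i and is at most 2a for smaller
  -- d, while there are no walks beyond 4i.
  · refine (Finset.sum_le_sum (g := fun M' => (if 0 < dist M M' ∧ dist M M' < 4 * i then
      ((walks i M M' : ℝ) / hookDegree n i) ^ 2 else 0) * (2 * (i / n)) ^ 2)
      fun M' _ => ?_).trans ?_
    · by_cases hM : M = M'
      · rw [if_pos hM]; positivity
      · rw [if_neg hM, hookMatrix_sq_apply, mul_pow]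
        have hpos := hdist M M' hM
        rcases lt_trichotomy (dist M M') (4 * i) with hlt | heq | hgt
        · rw [if_pos ⟨hpos, hlt⟩]
          refine mul_le_mul_of_nonneg_left ?_ (sq_nonneg _)
          have hlt' : (dist M M' : ℝ) < 4 * i := by exact_mod_cast hlt
          have hpos' : (0 : ℝ) < dist M M' := by exact_mod_cast hpos
          rw [agreement, Matrix.of_apply]
          have e1 : 1 - (dist M M' : ℝ) / (2 * n) - 1 + 2 * (i / n) =
              (4 * i - dist M M') / (2 * n) := by field_simp; ring
          have e2 : 2 * ((i : ℝ) / n) = 4 * i / (2 * n) := by field_simp; ring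
          rw [e1, e2]
          exact pow_le_pow_left₀ (div_nonneg (by linarith) (by positivity))
            (div_le_div_of_nonneg_right (by linarith) (by positivity)) 2
        · rw [agreement, Matrix.of_apply, heq]
          have : 1 - ((4 * i : ℕ) : ℝ) / (2 * n) - 1 + 2 * (i / n) = 0 := by
            push_cast; field_simp; ring
          rw [this]
          simp
        · rw [walks_eq_zero hi hgt]
          simp
    · rw [← Finset.sum_mul, ← Finset.sum_filter]
      exact mul_le_mul_of_nonneg_right (sum_near_le hi hin M) (sq_nonneg _)
  · have hnear := sum_near_le hi hin M
    have hfar := le_sum_far hi hin M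
    set C := fun M' => ((walks i M M' : ℝ) / hookDegree n i) ^ 2
    -- The weight (8i - 3d)/n is at most 8i/n at close pairs and equals -4i/n at d = 4i. The
    -- diagonal 8i then cancels against 4i · 2, up to O(1/n).
    refine (Finset.sum_le_sum (g := fun M' => (8 * i * (if M' = M then 1 else 0) +
      8 * i * (if 0 < dist M M' ∧ dist M M' < 4 * i then C M' else 0) -
      4 * i * (if dist M M' = 4 * i then C M' else 0)) / n) fun M' _ => ?_).trans ?_
    · have e1 : 8 * ((i : ℝ) / n) - 6 + 6 * agreement n M M' = (8 * i - 3 * dist M M') / n := by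
        rw [agreement, Matrix.of_apply]; field_simp; ring
      have hC : 0 ≤ C M' := sq_nonneg _
      rw [e1, hookMatrix_sq_apply, ← mul_div_assoc]
      change C M' * _ / _ ≤ _
      refine div_le_div_of_nonneg_right ?_ hn.le
      by_cases hM : M' = M
      · subst hM
        have hz : dist M' M' = 0 := dist_eq_zero_iff.2 rfl
        have hC1 : C M' = 1 := by
          simp only [C]; rw [walks_self hi, div_self hk.ne', one_pow]
        rw [hz, hC1, if_pos rfl, if_neg (by omega), if_neg (by omega)]
        simp
      · have hpos := hdist M M' (Ne.symm hM)
        rw [if_neg hM]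
        rcases lt_trichotomy (dist M M') (4 * i) with hlt | heq | hgt
        · rw [if_pos ⟨hpos, hlt⟩, if_neg hlt.ne]
          have hpos' : (0 : ℝ) < dist M M' := by exact_mod_cast hpos
          nlinarith
        · rw [if_neg (by omega), if_pos heq, heq]
          push_cast
          nlinarith
        · have : C M' = 0 := by simp only [C]; rw [walks_eq_zero hi hgt]; simp
          rw [this, if_neg (by omega), if_neg (by omega)]
          simp
    · rw [← Finset.sum_div, Finset.sum_sub_distrib, Finset.sum_add_distrib, ← Finset.mul_sum,
        ← Finset.mul_sum, ← Finset.mul_sum, ← Finset.sum_filter (p := fun M' => _ ∧ _),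
        ← Finset.sum_filter (p := fun M' => dist M M' = 4 * i)]
      rw [Finset.sum_ite_eq' Finset.univ M, if_pos (Finset.mem_univ _)]
      rw [div_le_div_iff₀ hn (by positivity)]
      have g1 := mul_le_mul_of_nonneg_left hnear (show 0 ≤ 8 * (i : ℝ) by positivity)
      have g2 := mul_le_mul_of_nonneg_left hfar (show 0 ≤ 4 * (i : ℝ) by positivity)
      have g3 : 8 * (i : ℝ) * 1 + 8 * i * (nearConst i / n) - 4 * i * (2 - farConst i / n) =
          (8 * i * nearConst i + 4 * i * farConst i) / n := by field_simp; ring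
      calc _ ≤ (8 * i * nearConst i + 4 * i * farConst i) / n * (n : ℝ) ^ 2 := by
            refine mul_le_mul_of_nonneg_right ?_ (sq_nonneg _)
            linarith
        _ = _ := by field_simp

end PerfectMatching

end

noncomputable section

set_option linter.unusedSectionVars false

/-! ### Gelfand pairs with symmetric orbitals -/

section Gelfand

open Representation

variable {G : Type*} [Group G] {K : Subgroup G}

/-- Any two cosets are exchanged by some group element. -/
def HasSwaps (K : Subgroup G) : Prop := ∀ x y : G ⧸ K, ∃ g : G, g • x = y ∧ g • y = x

/-- The endomorphism algebra of the induced representation. -/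
abbrev Commutant (K : Subgroup G) := IntertwiningMap (inducedTrivial K) (inducedTrivial K)

namespace Commutant

/-- The matrix coefficients of an intertwining operator. -/
def kernel (f : Commutant K) (x y : G ⧸ K) : ℂ := (f (MonoidAlgebra.single y 1)).coeff x

lemma kernel_smul (f : Commutant K) (g : G) (x y : G ⧸ K) :
    f.kernel (g • x) (g • y) = f.kernel x y := by
  unfold kernel
  rw [← ofMulAction_single g y, f.isIntertwining, coeff_ofMulAction, inv_smul_smul]

/-- The kernel is invariant under G, and some element of G exchanges x and y. -/
lemma kernel_comm (hK : HasSwaps K) (f : Commutant K) (x y : G ⧸ K) :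
    f.kernel x y = f.kernel y x := by
  obtain ⟨g, h1, h2⟩ := hK x y
  rw [← f.kernel_smul g x y, h1, h2]

lemma ext_kernel {f f' : Commutant K} (h : ∀ x y, f.kernel x y = f'.kernel x y) : f = f' := by
  apply IntertwiningMap.ext
  refine MonoidAlgebra.lhom_ext' fun y => LinearMap.ext_ring ?_
  exact MonoidAlgebra.ext (Finsupp.ext fun x => h x y)

lemma apply_eq_sum [Fintype (G ⧸ K)] (f : Commutant K) (w : MonoidAlgebra ℂ (G ⧸ K)) (x : G ⧸ K) :
    (f w).coeff x = ∑ z, w.coeff z * f.kernel x z := by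
  induction w using MonoidAlgebra.induction_linear with
  | zero => simp
  | add a b ha hb =>
    rw [map_add, MonoidAlgebra.coeff_add, Finsupp.add_apply, ha, hb, ← Finset.sum_add_distrib]
    simp [add_mul]
  | single y a =>
    have : (MonoidAlgebra.single y a : MonoidAlgebra ℂ (G ⧸ K)) = a • MonoidAlgebra.single y 1 := by
      simp
    rw [this, map_smul]
    classical
    simp [kernel, Finsupp.single_apply]

lemma kernel_mul [Fintype (G ⧸ K)] (f f' : Commutant K) (x y : G ⧸ K) :
    (f * f').kernel x y = ∑ z, f.kernel x z * f'.kernel z y := by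
  change (f (f' (MonoidAlgebra.single y 1))).coeff x = _
  rw [apply_eq_sum]
  exact Finset.sum_congr rfl fun z _ => mul_comm _ _

/-- If two symmetric kernels have a symmetric product, transposing the product shows that they
commute. -/
lemma mul_comm [Finite G] (hK : HasSwaps K) (f f' : Commutant K) : f * f' = f' * f := by
  have := Fintype.ofFinite (G ⧸ K)
  refine ext_kernel fun x y => ?_
  rw [kernel_comm hK, kernel_mul, kernel_mul]
  refine Finset.sum_congr rfl fun z _ => ?_
  rw [kernel_comm hK f, kernel_comm hK f', _root_.mul_comm]

end Commutant

/-- By complete reducibility V has an invariant complement, and projecting along it is equivariant.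
-/
lemma exists_projection [Finite G] (V : Subrepresentation (inducedTrivial K)) :
    ∃ p : Commutant K, (∀ w, p w ∈ V.toSubmodule) ∧ ∀ v ∈ V.toSubmodule, p v = v := by
  obtain ⟨V', h⟩ := exists_isCompl V
  have hc : IsCompl V.toSubmodule V'.toSubmodule := by
    refine IsCompl.of_eq ?_ ?_
    · rw [← Subrepresentation.toSubmodule_inf, h.inf_eq_bot]; rfl
    · rw [← Subrepresentation.toSubmodule_sup, h.sup_eq_top]; rfl
  have hl : ∀ v ∈ V.toSubmodule, (V.toSubmodule.projectionOnto V'.toSubmodule hc v :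
      MonoidAlgebra ℂ (G ⧸ K)) = v := fun v hv => by
    rw [Submodule.projectionOnto_apply_left hc ⟨v, hv⟩]
  have hr : ∀ v ∈ V'.toSubmodule, (V.toSubmodule.projectionOnto V'.toSubmodule hc v :
      MonoidAlgebra ℂ (G ⧸ K)) = 0 := fun v hv => by
    rw [Submodule.projectionOnto_apply_right hc ⟨v, hv⟩]; rfl
  refine ⟨⟨V.toSubmodule.subtype ∘ₗ V.toSubmodule.projectionOnto V'.toSubmodule hc,
    fun g => LinearMap.ext fun w => ?_⟩, fun w => Subtype.prop _, fun v hv => hl v hv⟩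
  obtain ⟨v, hv, v', hv', rfl⟩ := Submodule.mem_sup.1
    (show w ∈ V.toSubmodule ⊔ V'.toSubmodule by rw [hc.sup_eq_top]; trivial)
  simp only [LinearMap.comp_apply, map_add, Submodule.subtype_apply]
  rw [hl v hv, hr v' hv', hl _ (V.apply_mem_toSubmodule g hv),
    hr _ (V'.apply_mem_toSubmodule g hv'), map_zero]

lemma exists_sphericalRep_le [Finite G] (U : Subrepresentation (inducedTrivial K))
    (hU : U.toSubmodule ≠ ⊥) : ∃ V : SphericalRep K, V.1.toSubmodule ≤ U.toSubmodule := by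
  induction hd : Module.finrank ℂ U.toSubmodule using Nat.strong_induction_on generalizing U with
  | _ d ih =>
    subst hd
    by_cases h : U.toRepresentation.IsIrreducible
    · exact ⟨⟨U, h⟩, le_rfl⟩
    have hne : (⊥ : Subrepresentation U.toRepresentation) ≠ ⊤ := by
      intro h'
      apply hU
      rw [Submodule.eq_bot_iff]
      intro v hv
      have : (⟨v, hv⟩ : U.toSubmodule) ∈
          (⊥ : Subrepresentation U.toRepresentation).toSubmodule := by
        rw [h']; trivial
      exact congrArg Subtype.val ((Submodule.mem_bot ℂ).1 this)
    have hS : ∃ S : Subrepresentation U.toRepresentation, S ≠ ⊥ ∧ S ≠ ⊤ := by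
      by_contra! hS
      have : Nontrivial (Subrepresentation U.toRepresentation) := ⟨⟨_, _, hne⟩⟩
      exact h ⟨fun S => or_iff_not_imp_left.2 (hS S)⟩
    obtain ⟨S, h1, h2⟩ := hS
    let U' : Subrepresentation (inducedTrivial K) :=
      ⟨S.toSubmodule.map U.toSubmodule.subtype, fun g v hv => by
        obtain ⟨s, hs, rfl⟩ := Submodule.mem_map.1 hv
        exact Submodule.mem_map.2 ⟨_, S.apply_mem_toSubmodule g hs, rfl⟩⟩
    have hle : U'.toSubmodule ≤ U.toSubmodule := Submodule.map_subtype_le _ _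
    have hfr : Module.finrank ℂ U'.toSubmodule = Module.finrank ℂ S.toSubmodule :=
      LinearEquiv.finrank_eq (Submodule.equivMapOfInjective _
        (Submodule.subtype_injective _) _).symm
    have h1' : S.toSubmodule ≠ ⊥ := fun h' => h1 (Subrepresentation.toSubmodule_injective h')
    have h2' : S.toSubmodule ≠ ⊤ := fun h' => h2 (Subrepresentation.toSubmodule_injective h')
    obtain ⟨V, hV⟩ := ih _ (hfr.trans_lt (Submodule.finrank_lt h2')) U' (fun h' => h1' (by
      rw [Submodule.eq_bot_iff] at h' ⊢
      exact fun s hs => Subtype.ext (h' s ⟨s, hs, rfl⟩))) rfl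
    exact ⟨V, hV.trans hle⟩

namespace SphericalRep

/-- An equivariant projection onto a constituent. -/
def proj [Finite G] (V : SphericalRep K) : Commutant K := (exists_projection V.1).choose

variable [Finite G] (V V' : SphericalRep K)

lemma proj_mem (w : MonoidAlgebra ℂ (G ⧸ K)) : V.proj w ∈ V.1.toSubmodule :=
  (exists_projection V.1).choose_spec.1 w

lemma proj_apply {v : MonoidAlgebra ℂ (G ⧸ K)} (hv : v ∈ V.1.toSubmodule) : V.proj v = v :=
  (exists_projection V.1).choose_spec.2 v hv

/-- The operator f commutes with the projection onto V, hence preserves its range. -/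
lemma apply_mem (hK : HasSwaps K) (f : Commutant K) {v : MonoidAlgebra ℂ (G ⧸ K)}
    (hv : v ∈ V.1.toSubmodule) : f v ∈ V.1.toSubmodule := by
  have h : (f * V.proj) v = (V.proj * f) v := by rw [Commutant.mul_comm hK]
  rw [IntertwiningMap.mul_apply, IntertwiningMap.mul_apply, V.proj_apply hv] at h
  rw [h]; exact V.proj_mem _

/-- Composed with the projection onto V, an isomorphism onto V' is an element of the commutant. It
therefore preserves V, so its image V' lies in V. -/
lemma le_of_equiv (hK : HasSwaps K) (T : V.rep.Equiv V'.rep) :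
    V'.1.toSubmodule ≤ V.1.toSubmodule := by
  let f : Commutant K := ⟨V'.1.toSubmodule.subtype ∘ₗ T.toIntertwiningMap.toLinearMap ∘ₗ
      V.proj.toLinearMap.codRestrict V.1.toSubmodule V.proj_mem, fun g => LinearMap.ext fun w => by
    have h1 : V.proj.toLinearMap.codRestrict V.1.toSubmodule V.proj_mem (inducedTrivial K g w) =
        V.rep g (V.proj.toLinearMap.codRestrict V.1.toSubmodule V.proj_mem w) :=
      Subtype.ext (IntertwiningMap.isIntertwining _ _ V.proj g w)
    simp only [LinearMap.comp_apply]
    rw [h1]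
    exact congrArg Subtype.val (IntertwiningMap.isIntertwining _ _ T.toIntertwiningMap g _)⟩
  intro v hv
  obtain ⟨u, hu⟩ := T.toLinearEquiv.surjective ⟨v, hv⟩
  have h2 : f u = v := by
    have h3 : V.proj.toLinearMap.codRestrict V.1.toSubmodule V.proj_mem u = u :=
      Subtype.ext (V.proj_apply u.2)
    change ((T.toIntertwiningMap.toLinearMap
      (V.proj.toLinearMap.codRestrict V.1.toSubmodule V.proj_mem u) : V'.1.toSubmodule) :
        MonoidAlgebra ℂ (G ⧸ K)) = v
    rw [h3]
    exact congrArg Subtype.val hu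
  rw [← h2]
  exact V.apply_mem hK f u.2

lemma eq_of_equiv (hK : HasSwaps K) (T : V.rep.Equiv V'.rep) : V = V' :=
  Subtype.ext (Subrepresentation.toSubmodule_injective
    (le_antisymm (V'.le_of_equiv V hK T.symm) (V.le_of_equiv V' hK T)))

lemma proj_apply_of_ne (hK : HasSwaps K) (h : V ≠ V') {v : MonoidAlgebra ℂ (G ⧸ K)}
    (hv : v ∈ V'.1.toSubmodule) : V.proj v = 0 := by
  have := V.2
  have := V'.2
  let f : IntertwiningMap V'.rep V.rep :=
    ⟨V.proj.toLinearMap.codRestrict V.1.toSubmodule V.proj_mem ∘ₗ V'.1.toSubmodule.subtype,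
      fun g => LinearMap.ext fun w => Subtype.ext (IntertwiningMap.isIntertwining _ _ V.proj g w)⟩
  have h2 : IsIrreducible V'.rep := V'.2
  have h3 : IsIrreducible V.rep := V.2
  rcases IsIrreducible.bijective_or_eq_zero f with hf | hf
  · exact absurd (V'.eq_of_equiv V hK (IntertwiningMap.ofBijective f hf)).symm h
  · have h4 : f ⟨v, hv⟩ = 0 := by rw [hf]; rfl
    exact congrArg Subtype.val h4

lemma exists_scalar (hK : HasSwaps K) (f : Commutant K) :
    ∃ c : ℂ, ∀ v ∈ V.1.toSubmodule, f v = c • v := by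
  have h3 : IsIrreducible V.rep := V.2
  let f' : IntertwiningMap V.rep V.rep :=
    ⟨f.toLinearMap.restrict fun v hv => V.apply_mem hK f hv,
      fun g => LinearMap.ext fun w => Subtype.ext (IntertwiningMap.isIntertwining _ _ f g w)⟩
  obtain ⟨c, hc⟩ :=
    (IsIrreducible.algebraMap_intertwiningMap_bijective_of_isAlgClosed (ρ := V.rep)).2 f'
  refine ⟨c, fun v hv => ?_⟩
  have h4 : f' ⟨v, hv⟩ = c • ⟨v, hv⟩ := by rw [← hc]; rfl
  exact congrArg Subtype.val h4

lemma exists_mem_ne_zero : ∃ v ∈ V.1.toSubmodule, v ≠ 0 := by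
  have h3 : IsIrreducible V.rep := V.2
  by_contra! h
  obtain ⟨S, T, hST⟩ := h3.toNontrivial
  refine hST (Subrepresentation.toSubmodule_injective (Submodule.ext fun v => ?_))
  have : v = 0 := Subtype.ext (h v v.2)
  simp [this]

lemma dim_pos : 0 < V.dim := by
  obtain ⟨v, hv, h0⟩ := V.exists_mem_ne_zero
  have : Nontrivial V.1.toSubmodule := ⟨⟨⟨v, hv⟩, 0, fun h => h0 (congrArg Subtype.val h)⟩⟩
  exact Module.finrank_pos

/-- The projections onto distinct constituents are linearly independent in a finite dimensional
algebra. -/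
lemma finite (hK : HasSwaps K) : Finite (SphericalRep K) := by
  have h : LinearIndependent ℂ fun V : SphericalRep K => V.proj := by
    rw [linearIndependent_iff']
    intro s c hc V hV
    obtain ⟨v, hv, h0⟩ := V.exists_mem_ne_zero
    have h1 := congrArg (fun f : Commutant K => f v) hc
    simp only [IntertwiningMap.sum_apply] at h1
    rw [Finset.sum_eq_single V] at h1
    · rw [IntertwiningMap.smul_apply, V.proj_apply hv] at h1
      exact (smul_eq_zero.1 h1).resolve_right h0
    · intro V' _ hne
      rw [IntertwiningMap.smul_apply, V'.proj_apply_of_ne V hK hne hv, smul_zero]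
    · exact fun h => absurd hV h
  exact h.finite

lemma sum_proj [Fintype (SphericalRep K)] (hK : HasSwaps K) :
    ∑ V : SphericalRep K, V.proj = 1 := by
  set e : Commutant K := ∑ V : SphericalRep K, V.proj with he
  have h1 : ∀ V : SphericalRep K, ∀ v ∈ V.1.toSubmodule, e v = v := by
    intro V v hv
    rw [he, IntertwiningMap.sum_apply, Finset.sum_eq_single V, V.proj_apply hv]
    · exact fun V' _ hne => V'.proj_apply_of_ne V hK hne hv
    · simp
  by_contra hne
  -- If e ≠ 1, the range of 1 - e contains a constituent. There 1 - e acts as the identity, because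
  -- e is idempotent, and also as zero, because e fixes every constituent.
  obtain ⟨V, hV⟩ := exists_sphericalRep_le (1 - e).range (by
    intro h
    apply hne
    symm
    rw [← sub_eq_zero]
    refine IntertwiningMap.ext (LinearMap.ext fun w => ?_)
    have : (1 - e) w ∈ (1 - e).range.toSubmodule := ⟨w, rfl⟩
    rw [h] at this
    exact this)
  obtain ⟨v, hv, h0⟩ := V.exists_mem_ne_zero
  obtain ⟨w, hw⟩ := hV hv
  have h2 : (1 - e) v = v := by
    have h3 : e ((1 - e) w) = 0 := by
      have he' : e w = ∑ V : SphericalRep K, V.proj w := by rw [he, IntertwiningMap.sum_apply]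
      change e (w - e w) = 0
      rw [map_sub, sub_eq_zero]
      calc e w = ∑ V : SphericalRep K, e (V.proj w) :=
            he'.trans (Finset.sum_congr rfl fun V _ => (h1 V _ (V.proj_mem w)).symm)
        _ = e (e w) := by rw [← map_sum, he']
    have h4 : (1 - e) w = v := hw
    rw [h4] at h3
    change v - e v = v
    rw [h3, sub_zero]
  apply h0
  rw [← h2]
  change v - e v = 0
  rw [h1 V v hv, sub_self]

lemma trace_proj : LinearMap.trace ℂ _ V.proj.toLinearMap = V.dim :=
  have h : LinearMap.IsProj V.1.toSubmodule V.proj.toLinearMap :=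
    ⟨fun w => V.proj_mem w, fun _ hv => V.proj_apply hv⟩
  h.trace

end SphericalRep

end Gelfand

end

noncomputable section

set_option linter.unusedSectionVars false

/-! ### Spherical functions as eigenvalues -/

section Spherical

open Representation

variable {G : Type*} [Group G] {K : Subgroup G}

/-- The basis vector of the trivial coset. -/
def baseVector (K : Subgroup G) : MonoidAlgebra ℂ (G ⧸ K) :=
  MonoidAlgebra.single ((1 : G) : G ⧸ K) 1

lemma inducedTrivial_baseVector (g : G) :
    inducedTrivial K g (baseVector K) = MonoidAlgebra.single (g : G ⧸ K) 1 := by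
  rw [baseVector, ofMulAction_single]
  simp

namespace Commutant

/-- Frobenius reciprocity: an intertwining operator on the induced representation is a free choice
of a K-fixed image of the base vector. -/
lemma exists_apply_baseVector {v : MonoidAlgebra ℂ (G ⧸ K)}
    (hv : ∀ k ∈ K, inducedTrivial K k v = v) : ∃ f : Commutant K, f (baseVector K) = v := by
  let L : MonoidAlgebra ℂ (G ⧸ K) →ₗ[ℂ] MonoidAlgebra ℂ (G ⧸ K) :=
    (MonoidAlgebra.basis (G ⧸ K) ℂ).constr ℂ fun x => inducedTrivial K x.out v
  have hL : ∀ g : G, L (MonoidAlgebra.single (g : G ⧸ K) 1) = inducedTrivial K g v := by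
    intro g
    have h1 : (MonoidAlgebra.single (g : G ⧸ K) 1 : MonoidAlgebra ℂ (G ⧸ K)) =
        MonoidAlgebra.basis (G ⧸ K) ℂ g := by simp
    rw [h1, Module.Basis.constr_basis]
    obtain ⟨k, hk⟩ := QuotientGroup.mk_out_eq_mul K g
    rw [hk, map_mul, Module.End.mul_apply, hv _ k.2]
  refine ⟨⟨L, fun g => MonoidAlgebra.lhom_ext' fun x => LinearMap.ext_ring ?_⟩, ?_⟩
  · induction x using QuotientGroup.induction_on with
    | H h =>
      change L (inducedTrivial K g (MonoidAlgebra.single (h : G ⧸ K) 1)) =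
        inducedTrivial K g (L (MonoidAlgebra.single (h : G ⧸ K) 1))
      rw [ofMulAction_single, hL, MulAction.Quotient.smul_mk, hL, smul_eq_mul, map_mul,
        Module.End.mul_apply]
  · exact (hL 1).trans (by simp)

end Commutant

open Classical in
/-- The uniform measure on the orbit under `K` of the coset of `x⁻¹`. -/
def orbitAverage [Fintype G] (K : Subgroup G) (x : G) : MonoidAlgebra ℂ (G ⧸ K) :=
  (Nat.card K : ℂ)⁻¹ • ∑ k : K, inducedTrivial K ((k : G) * x⁻¹) (baseVector K)

variable [Fintype G]

open Classical in
lemma sum_subgroup_mul_left {A : Type*} [AddCommMonoid A] (f : G → A) {k : G} (hk : k ∈ K) :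
    ∑ l : K, f (k * l) = ∑ l : K, f l :=
  Fintype.sum_equiv (Equiv.mulLeft (⟨k, hk⟩ : K)) _ _ fun _ => rfl

lemma inducedTrivial_orbitAverage (x : G) {k : G} (hk : k ∈ K) :
    inducedTrivial K k (orbitAverage K x) = orbitAverage K x := by
  classical
  unfold orbitAverage
  rw [map_smul, map_sum]
  congr 1
  rw [← sum_subgroup_mul_left (fun l => inducedTrivial K (l * x⁻¹) (baseVector K)) hk]
  refine Finset.sum_congr (by congr!) fun l _ => ?_
  rw [← Module.End.mul_apply, ← map_mul, mul_assoc]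

/-- The averaging operator over the orbital of `x⁻¹`. -/
def orbitalOperator (K : Subgroup G) (x : G) : Commutant K :=
  (Commutant.exists_apply_baseVector fun _ hk => inducedTrivial_orbitAverage (K := K) x hk).choose

lemma orbitalOperator_baseVector (x : G) :
    orbitalOperator K x (baseVector K) = orbitAverage K x :=
  (Commutant.exists_apply_baseVector fun _ hk =>
    inducedTrivial_orbitAverage (K := K) x hk).choose_spec

namespace SphericalRep

variable (V : SphericalRep K)

lemma proj_baseVector_ne_zero : V.proj (baseVector K) ≠ 0 := by
  intro h
  obtain ⟨v, hv, h0⟩ := V.exists_mem_ne_zero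
  have h1 : V.proj = 0 := by
    refine IntertwiningMap.ext (MonoidAlgebra.lhom_ext' fun x => LinearMap.ext_ring ?_)
    induction x using QuotientGroup.induction_on with
    | H g =>
      change V.proj (MonoidAlgebra.single (g : G ⧸ K) 1) = 0
      rw [← inducedTrivial_baseVector, IntertwiningMap.isIntertwining, h, map_zero]
  exact h0 ((V.proj_apply hv).symm.trans (by rw [h1]; rfl))

/-- An operator sending the base vector to v commutes with the projection onto V and is scalar on V.
So the K-fixed vectors of V form a line. -/
lemma exists_smul_of_invariant (hK : HasSwaps K) {v : MonoidAlgebra ℂ (G ⧸ K)}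
    (hv : v ∈ V.1.toSubmodule) (h : ∀ k ∈ K, inducedTrivial K k v = v) :
    ∃ c : ℂ, v = c • V.proj (baseVector K) := by
  obtain ⟨f, hf⟩ := Commutant.exists_apply_baseVector h
  obtain ⟨c, hc⟩ := V.exists_scalar hK f
  refine ⟨c, ?_⟩
  rw [← hc _ (V.proj_mem _), ← IntertwiningMap.mul_apply, Commutant.mul_comm hK,
    IntertwiningMap.mul_apply, hf, V.proj_apply hv]

open Classical in
/-- The average of a representation over `K`. -/
def average : V.1.toSubmodule →ₗ[ℂ] V.1.toSubmodule := (Nat.card K : ℂ)⁻¹ • ∑ k : K, V.rep (k : G)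

open Classical in
lemma average_apply (v : V.1.toSubmodule) : (V.average v : MonoidAlgebra ℂ (G ⧸ K)) =
    (Nat.card K : ℂ)⁻¹ • ∑ k : K, inducedTrivial K (k : G) v := by
  rw [average, LinearMap.smul_apply, LinearMap.sum_apply, Submodule.coe_smul,
    AddSubmonoidClass.coe_finsetSum]
  rfl

lemma inducedTrivial_average (v : V.1.toSubmodule) {k : G} (hk : k ∈ K) :
    inducedTrivial K k (V.average v) = V.average v := by
  classical
  rw [average_apply, map_smul, map_sum]
  congr 1
  rw [← sum_subgroup_mul_left (fun l => inducedTrivial K l (v : MonoidAlgebra ℂ (G ⧸ K))) hk]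
  refine Finset.sum_congr (by congr!) fun l _ => ?_
  rw [← Module.End.mul_apply, ← map_mul]

theorem sphericalFunction_eq (hK : HasSwaps K) (x : G) {c : ℂ}
    (hc : ∀ v ∈ V.1.toSubmodule, orbitalOperator K x v = c • v) :
    sphericalFunction V x = c := by
  classical
  let u : V.1.toSubmodule := ⟨V.proj (baseVector K), V.proj_mem _⟩
  have hu : u ≠ 0 := fun h => V.proj_baseVector_ne_zero (congrArg Subtype.val h)
  obtain ⟨φ, hφ⟩ := Module.Projective.exists_dual_eq_one ℂ hu
  have hav : ∀ v, V.average v = (φ ∘ₗ V.average) v • u := by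
    intro v
    obtain ⟨a, ha⟩ := V.exists_smul_of_invariant hK (V.average v).2
      fun k hk => V.inducedTrivial_average v hk
    have ha' : V.average v = a • u := Subtype.ext ha
    rw [LinearMap.comp_apply, ha', map_smul, hφ, smul_eq_mul, mul_one]
  have h1 : sphericalFunction V x =
      LinearMap.trace ℂ V.1.toSubmodule (V.rep x⁻¹ ∘ₗ V.average) := by
    unfold sphericalFunction average
    rw [← Module.End.mul_eq_comp, mul_smul_comm, map_smul, smul_eq_mul]
    congr 1
    rw [Finset.mul_sum, map_sum]
    refine Finset.sum_congr (by congr!) fun k _ => ?_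
    unfold Representation.character
    rw [map_mul]
  -- The K-average has rank one, with image spanned by u, so the trace is a single evaluation: φ at
  -- the K-average of x⁻¹u, which is the orbital operator applied to u.
  have h2 : V.rep x⁻¹ ∘ₗ V.average = (φ ∘ₗ V.average).smulRight (V.rep x⁻¹ u) := by
    refine LinearMap.ext fun v => ?_
    rw [LinearMap.comp_apply, hav, map_smul]; rfl
  have h3 : V.average (V.rep x⁻¹ u) = c • u := by
    refine Subtype.ext ?_
    rw [average_apply, Submodule.coe_smul, ← hc _ u.2]
    change _ = orbitalOperator K x (V.proj (baseVector K))
    rw [← IntertwiningMap.mul_apply, Commutant.mul_comm hK, IntertwiningMap.mul_apply,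
      orbitalOperator_baseVector, orbitAverage, map_smul, map_sum]
    congr 1
    refine Finset.sum_congr (by congr!) fun k _ => ?_
    rw [IntertwiningMap.isIntertwining, map_mul]; rfl
  rw [h1, h2, LinearMap.trace_smulRight, LinearMap.comp_apply, h3, map_smul, hφ, smul_eq_mul,
    mul_one]

/-- As f is scalar on each constituent, q(f) is the combination of the projections with coefficients
q(c_V). -/
lemma trace_aeval [Fintype (SphericalRep K)] (hK : HasSwaps K) (f : Commutant K)
    {c : SphericalRep K → ℂ} (hc : ∀ V : SphericalRep K, ∀ v ∈ V.1.toSubmodule, f v = c V • v)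
    (q : Polynomial ℂ) :
    LinearMap.trace ℂ _ (Polynomial.aeval (R := ℂ) (f.toLinearMap : Module.End ℂ _) q) =
      ∑ V : SphericalRep K, (V.dim : ℂ) * q.eval (c V) := by
  have h1 : ∀ V : SphericalRep K, ∀ v ∈ V.1.toSubmodule,
      Polynomial.aeval (R := ℂ) (f.toLinearMap : Module.End ℂ _) q v = q.eval (c V) • v := by
    intro V v hv
    by_cases h0 : v = 0
    · simp [h0]
    · exact Module.End.aeval_apply_of_hasEigenvector
        ⟨Module.End.mem_eigenspace_iff.2 (hc V v hv), h0⟩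
  have h2 : Polynomial.aeval (R := ℂ) (f.toLinearMap : Module.End ℂ _) q =
      ∑ V : SphericalRep K, q.eval (c V) • V.proj.toLinearMap := by
    refine LinearMap.ext fun w => ?_
    have h3 : w = ∑ V : SphericalRep K, V.proj w := by
      rw [← IntertwiningMap.sum_apply, sum_proj hK]; rfl
    conv_lhs => rw [h3]
    rw [map_sum, LinearMap.sum_apply]
    exact Finset.sum_congr rfl fun V _ => h1 V _ (V.proj_mem w)
  rw [h2, map_sum]
  refine Finset.sum_congr rfl fun V _ => ?_
  rw [map_smul, trace_proj, smul_eq_mul, mul_comm]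

lemma sum_dim [Fintype (SphericalRep K)] (hK : HasSwaps K) :
    ∑ V : SphericalRep K, V.dim = Nat.card (G ⧸ K) := by
  have h := trace_aeval hK (1 : Commutant K) (c := fun _ => 1) (fun V v _ => (one_smul ℂ v).symm) 1
  simp only [map_one, Polynomial.eval_one, mul_one] at h
  rw [LinearMap.trace_one, Module.finrank_eq_nat_card_basis (MonoidAlgebra.basis (G ⧸ K) ℂ)] at h
  exact_mod_cast h.symm

end SphericalRep

lemma Matrix.IsHermitian.trace_pow_eq_sum {X : Type*} [Fintype X] [DecidableEq X]
    {P : Matrix X X ℝ} (hP : P.IsHermitian) (k : ℕ) :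
    (P ^ k).trace = ∑ j, hP.eigenvalues j ^ k := by
  simp only [Matrix.trace, Matrix.diag_apply, hP.pow_apply]
  rw [Finset.sum_comm]
  refine Finset.sum_congr rfl fun j _ => ?_
  rw [← Finset.mul_sum]
  simp only [← sq]
  rw [hP.sum_eigenvectorBasis_sq, mul_one]

lemma Matrix.IsHermitian.trace_aeval_map {X : Type*} [Fintype X] [DecidableEq X]
    {P : Matrix X X ℝ} (hP : P.IsHermitian) (q : Polynomial ℂ) :
    (Polynomial.aeval (P.map ((↑) : ℝ → ℂ)) q).trace = ∑ j, q.eval (hP.eigenvalues j : ℂ) := by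
  induction q using Polynomial.induction_on' with
  | add p q h1 h2 =>
    simp only [map_add, Matrix.trace_add, h1, h2, Polynomial.eval_add, Finset.sum_add_distrib]
  | monomial k a =>
    have h1 : P.map ((↑) : ℝ → ℂ) ^ k = (P ^ k).map ((↑) : ℝ → ℂ) :=
      (Matrix.map_pow P Complex.ofRealHom k).symm
    have h2 : ((P ^ k).map ((↑) : ℝ → ℂ)).trace = ((P ^ k).trace : ℂ) :=
      (AddMonoidHom.map_trace Complex.ofRealHom (P ^ k)).symm
    rw [Polynomial.aeval_monomial, ← Algebra.smul_def, Matrix.trace_smul, h1, h2,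
      hP.trace_pow_eq_sum]
    simp [Finset.mul_sum]

/-- The weighted eigenvalue distribution of an intertwining operator on the constituents agrees with
the eigenvalue distribution of its matrix. -/
lemma sum_dim_filter_eq [Fintype (SphericalRep K)] (hK : HasSwaps K) (f : Commutant K)
    {c : SphericalRep K → ℂ} (hc : ∀ V : SphericalRep K, ∀ v ∈ V.1.toSubmodule, f v = c V • v)
    {X : Type*} [Fintype X] [DecidableEq X] (e : X ≃ G ⧸ K) {P : Matrix X X ℝ}
    (hP : P.IsHermitian) (hPf : ∀ x y, f.kernel (e x) (e y) = P x y)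
    (p : ℂ → Prop) [DecidablePred p] :
    ∑ V : SphericalRep K with p (c V), V.dim =
      (Finset.univ.filter fun j => p (hP.eigenvalues j)).card := by
  have h1 : ∀ q : Polynomial ℂ, ∑ V : SphericalRep K, (V.dim : ℂ) * q.eval (c V) =
      ∑ j, q.eval (hP.eigenvalues j : ℂ) := by
    intro q
    rw [← SphericalRep.trace_aeval hK f hc q, ← hP.trace_aeval_map q]
    let b := (MonoidAlgebra.basis (G ⧸ K) ℂ).reindex e.symm
    have h2 : LinearMap.toMatrixAlgEquiv b f.toLinearMap = P.map ((↑) : ℝ → ℂ) := by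
      ext x y
      rw [LinearMap.toMatrixAlgEquiv_apply, Matrix.map_apply, ← hPf]
      simp [b, Commutant.kernel, MonoidAlgebra.basis]
    rw [← h2, Polynomial.aeval_algHom_apply]
    rw [LinearMap.trace_eq_matrix_trace ℂ b]
    rfl
  -- Both spectra are finite, so a polynomial interpolates the indicator of p on their union, and
  -- equality of polynomial sums becomes equality of counts.
  let S : Finset ℂ := Finset.univ.image c ∪ Finset.univ.image fun j => (hP.eigenvalues j : ℂ)
  let q := Lagrange.interpolate S id fun z => if p z then (1 : ℂ) else 0
  have hq : ∀ z ∈ S, q.eval z = if p z then 1 else 0 := fun z hz =>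
    Lagrange.eval_interpolate_at_node _ Function.injective_id.injOn hz
  have h2 := h1 q
  rw [Finset.sum_congr rfl fun V _ => by
      rw [hq (c V) (Finset.mem_union_left _ (Finset.mem_image_of_mem _ (Finset.mem_univ V)))],
    Finset.sum_congr rfl fun j _ => hq _ (Finset.mem_union_right _
      (Finset.mem_image_of_mem _ (Finset.mem_univ j)))] at h2
  simp only [mul_ite, mul_one, mul_zero] at h2
  rw [← Finset.sum_filter, Finset.sum_boole] at h2
  exact_mod_cast h2

end Spherical

end

noncomputable section

set_option linter.unusedSectionVars false

/-! ### The Gelfand pair of the hyperoctahedral group -/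

namespace PerfectMatching

open Representation

variable {n i : ℕ}

/-- The image of a matching under a permutation of its vertices. -/
def conj (M : PerfectMatching n) (g : Equiv.Perm (Fin (2 * n))) : PerfectMatching n :=
  ofPerm (g * M.partner * g⁻¹) (M.isMatchingPerm.conj g)

lemma conj_eq_iff {M M' : PerfectMatching n} {g : Equiv.Perm (Fin (2 * n))} :
    M.conj g = M' ↔ ∀ v, g (M.partner v) = M'.partner (g v) := by
  rw [← partner_injective.eq_iff, conj, partner_ofPerm, mul_inv_eq_iff_eq_mul, Equiv.ext_iff]
  rfl

lemma conj_apply (M : PerfectMatching n) (g : Equiv.Perm (Fin (2 * n))) (v : Fin (2 * n)) :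
    g (M.partner v) = (M.conj g).partner (g v) := conj_eq_iff.1 rfl v

lemma conj_mul (M : PerfectMatching n) (g h : Equiv.Perm (Fin (2 * n))) :
    M.conj (g * h) = (M.conj h).conj g := by
  rw [conj_eq_iff]
  intro v
  rw [Equiv.Perm.mul_apply, Equiv.Perm.mul_apply, conj_apply M h, conj_apply _ g]

lemma conj_injective (g : Equiv.Perm (Fin (2 * n))) :
    Function.Injective fun M : PerfectMatching n => M.conj g := by
  intro M M' h
  have h' := congrArg (fun N : PerfectMatching n => N.conj g⁻¹) h
  simp only [← conj_mul, inv_mul_cancel] at h'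
  have h1 : ∀ N : PerfectMatching n, N.conj 1 = N := fun N => conj_eq_iff.2 fun _ => rfl
  rwa [h1, h1] at h'

lemma hookRel_conj {M M' : PerfectMatching n} (g : Equiv.Perm (Fin (2 * n))) :
    HookRel i (M.conj g).partner (M'.conj g).partner ↔ HookRel i M.partner M'.partner := by
  refine ⟨fun h => ?_, fun h => h.conj g (M.conj_apply g) (M'.conj_apply g)⟩
  refine h.conj g⁻¹ (fun v => ?_) fun v => ?_
  · rw [Equiv.Perm.inv_eq_iff_eq, conj_apply M g, ← Equiv.Perm.mul_apply g g⁻¹, mul_inv_cancel, Equiv.Perm.one_apply]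
  · rw [Equiv.Perm.inv_eq_iff_eq, conj_apply M' g, ← Equiv.Perm.mul_apply g g⁻¹, mul_inv_cancel, Equiv.Perm.one_apply]

/-- `matchingOf` pulls back along w whereas `conj` pushes forward, hence the inverse. -/
lemma matchingOf_eq (w : Equiv.Perm (Fin (2 * n))) : matchingOf w = ((identity n).conj w⁻¹).1 := by
  ext a b
  change (identity n).1.Adj (w a) (w b) ↔ _
  rw [adj_iff, adj_iff]
  have h := (identity n).conj_apply w⁻¹ (w a)
  rw [← Equiv.Perm.mul_apply w⁻¹ w, inv_mul_cancel, Equiv.Perm.one_apply] at h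
  rw [← h, Equiv.Perm.inv_eq_iff_eq]

lemma mem_hyperoctahedral {w : Equiv.Perm (Fin (2 * n))} :
    w ∈ hyperoctahedral n ↔ (identity n).conj w = identity n := by
  rw [← inv_mem_iff]
  change matchingOf w⁻¹ = (identity n).1 ↔ _
  rw [matchingOf_eq, inv_inv, Subtype.ext_iff]

/-- Cosets of the hyperoctahedral group correspond to perfect matchings. -/
def ofCoset : Equiv.Perm (Fin (2 * n)) ⧸ hyperoctahedral n → PerfectMatching n :=
  Quotient.lift (fun g => (identity n).conj g) fun a b h => by
    have h1 := mem_hyperoctahedral.1 (QuotientGroup.leftRel_apply.1 h)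
    calc (identity n).conj a = ((identity n).conj (a⁻¹ * b)).conj a := by rw [h1]
      _ = (identity n).conj b := by rw [← conj_mul, mul_inv_cancel_left]

lemma ofCoset_mk (g : Equiv.Perm (Fin (2 * n))) :
    ofCoset (g : Equiv.Perm (Fin (2 * n)) ⧸ hyperoctahedral n) = (identity n).conj g := rfl

lemma ofCoset_smul (g : Equiv.Perm (Fin (2 * n)))
    (x : Equiv.Perm (Fin (2 * n)) ⧸ hyperoctahedral n) :
    ofCoset (g • x) = (ofCoset x).conj g := by
  induction x using QuotientGroup.induction_on with
  | H h => rw [MulAction.Quotient.smul_mk, ofCoset_mk, ofCoset_mk, smul_eq_mul, conj_mul]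

lemma ofCoset_bijective : Function.Bijective (ofCoset (n := n)) := by
  constructor
  · intro x y
    induction x using QuotientGroup.induction_on with
    | H g =>
      induction y using QuotientGroup.induction_on with
      | H h =>
        intro heq
        rw [ofCoset_mk, ofCoset_mk] at heq
        refine QuotientGroup.eq.2 (mem_hyperoctahedral.2 ?_)
        apply conj_injective g
        change ((identity n).conj (g⁻¹ * h)).conj g = (identity n).conj g
        rw [← conj_mul, mul_inv_cancel_left, heq]
  · intro M
    obtain ⟨c, hc, -⟩ := (identity n).isMatchingPerm.exists_conj (Fintype.card_fin _)
      M.isMatchingPerm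
    exact ⟨(c : Equiv.Perm (Fin (2 * n)) ⧸ hyperoctahedral n), conj_eq_iff.2 hc⟩

/-- The bijection between perfect matchings and cosets. -/
def cosetEquiv (n : ℕ) :
    PerfectMatching n ≃ Equiv.Perm (Fin (2 * n)) ⧸ hyperoctahedral n :=
  (Equiv.ofBijective _ ofCoset_bijective).symm

lemma ofCoset_cosetEquiv (M : PerfectMatching n) : ofCoset (cosetEquiv n M) = M :=
  (Equiv.ofBijective _ ofCoset_bijective).apply_symm_apply M

lemma cosetEquiv_conj (M : PerfectMatching n) (g : Equiv.Perm (Fin (2 * n))) :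
    cosetEquiv n (M.conj g) = g • cosetEquiv n M := by
  apply ofCoset_bijective.1
  rw [ofCoset_smul, ofCoset_cosetEquiv, ofCoset_cosetEquiv]

lemma cosetEquiv_identity : cosetEquiv n (identity n) =
    ((1 : Equiv.Perm (Fin (2 * n))) : Equiv.Perm (Fin (2 * n)) ⧸ hyperoctahedral n) := by
  apply ofCoset_bijective.1
  rw [ofCoset_cosetEquiv, ofCoset_mk, eq_comm, conj_eq_iff]
  exact fun _ => rfl

lemma hasSwaps_hyperoctahedral (n : ℕ) : HasSwaps (hyperoctahedral n) := by
  intro x y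
  obtain ⟨g, h1, h2⟩ := (ofCoset x).isMatchingPerm.exists_swap (Fintype.card_fin _)
    (ofCoset y).isMatchingPerm
  refine ⟨g, ofCoset_bijective.1 ?_, ofCoset_bijective.1 ?_⟩
  · rw [ofCoset_smul]; exact conj_eq_iff.2 h1
  · rw [ofCoset_smul]; exact conj_eq_iff.2 h2

open Classical in
/-- The number of ways of moving one matching to another while fixing the identity matching. -/
def transport (M N : PerfectMatching n) : ℕ :=
  ∑ k : hyperoctahedral n, if M.conj k = N then 1 else 0

lemma transport_conj {k : Equiv.Perm (Fin (2 * n))} (hk : k ∈ hyperoctahedral n)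
    (M N : PerfectMatching n) : transport M (N.conj k) = transport M N := by
  classical
  unfold transport
  rw [← sum_subgroup_mul_left (fun l => if M.conj l = N.conj k then 1 else 0) hk]
  refine Finset.sum_congr (by congr!) fun l _ => ?_
  simp only [conj_mul, (conj_injective k).eq_iff]

lemma transport_eq_zero {M N : PerfectMatching n} (hM : HookRel i (identity n).partner M.partner)
    (hN : ¬ HookRel i (identity n).partner N.partner) : transport M N = 0 := by
  classical
  unfold transport
  refine Finset.sum_eq_zero fun k _ => if_neg ?_
  rintro rfl
  apply hN
  rw [← hookRel_conj (k : Equiv.Perm (Fin (2 * n))), mem_hyperoctahedral.1 k.2] at hM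
  exact hM

/-- K acts transitively on the neighbours of the identity matching, so each neighbour is hit by the
same number of elements of K. -/
lemma hookDegree_mul_transport (hi : 2 ≤ i) {M N : PerfectMatching n}
    (hM : HookRel i (identity n).partner M.partner)
    (hN : HookRel i (identity n).partner N.partner) :
    hookDegree n i * transport M N = Nat.card (hyperoctahedral n) := by
  classical
  have h1 : ∀ N' : PerfectMatching n, HookRel i (identity n).partner N'.partner →
      transport M N' = transport M N := by
    intro N' hN'
    obtain ⟨k, hk, hk'⟩ := HookRel.exists_perm (Fintype.card_fin _) hi
      (identity n).isMatchingPerm N.isMatchingPerm (identity n).isMatchingPerm N'.isMatchingPerm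
      hN hN'
    rw [← conj_eq_iff.2 hk', transport_conj (mem_hyperoctahedral.2 (conj_eq_iff.2 hk))]
  have h2 : ∑ N' : PerfectMatching n, transport M N' = Nat.card (hyperoctahedral n) := by
    unfold transport
    rw [Finset.sum_comm, Nat.card_eq_fintype_card, ← Finset.card_univ, Finset.card_eq_sum_ones]
    refine Finset.sum_congr (by congr!) fun k _ => ?_
    rw [Finset.sum_ite_eq, if_pos (Finset.mem_univ _)]
  rw [← h2, ← card_neighbors hi (identity n), ← smul_eq_mul, ← Finset.sum_const,
    Finset.sum_filter]
  refine Finset.sum_congr (by congr!) fun N' _ => ?_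
  split_ifs with h
  · exact (h1 N' h).symm
  · exact (transport_eq_zero hM h).symm

lemma coeff_orbitAverage (g : Equiv.Perm (Fin (2 * n))) (N : PerfectMatching n) :
    (orbitAverage (hyperoctahedral n) g).coeff (cosetEquiv n N) =
      (Nat.card (hyperoctahedral n) : ℂ)⁻¹ * transport ((identity n).conj g⁻¹) N := by
  classical
  unfold orbitAverage transport
  rw [MonoidAlgebra.coeff_smul, Finsupp.smul_apply, smul_eq_mul, MonoidAlgebra.coeff_sum,
    Finsupp.finsetSum_apply, Nat.cast_sum]
  congr 1
  refine Finset.sum_congr (by congr!) fun k _ => ?_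
  rw [inducedTrivial_baseVector, MonoidAlgebra.coeff_single, Finsupp.single_apply, Nat.cast_ite,
    Nat.cast_one, Nat.cast_zero]
  refine if_congr ?_ rfl rfl
  rw [← ofCoset_bijective.1.eq_iff, ofCoset_mk, ofCoset_cosetEquiv, conj_mul]

/-- By invariance M' may be taken to be the identity matching. Its column is the K-orbit average,
which is uniform on the neighbours. -/
lemma kernel_orbitalOperator (hi : 2 ≤ i) (hin : i ≤ n) {g : Equiv.Perm (Fin (2 * n))}
    (hg : matchingType (identityMatching n) (matchingOf g) = hookType n i)
    (M M' : PerfectMatching n) :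
    (orbitalOperator (hyperoctahedral n) g).kernel (cosetEquiv n M) (cosetEquiv n M') =
      (walkMatrix (matchingGraph n i) M M' : ℂ) := by
  have hM₁ : HookRel i (identity n).partner ((identity n).conj g⁻¹).partner := by
    rw [matchingOf_eq] at hg
    exact (matchingType_eq_hookType_iff hi hin (identity n) _).1 hg
  obtain ⟨x, rfl⟩ : ∃ x : Equiv.Perm (Fin (2 * n)), (identity n).conj x = M' := by
    obtain ⟨c, hc, -⟩ := (identity n).isMatchingPerm.exists_conj (Fintype.card_fin _)
      M'.isMatchingPerm
    exact ⟨c, conj_eq_iff.2 hc⟩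
  obtain ⟨N, rfl⟩ : ∃ N : PerfectMatching n, N.conj x = M :=
    ⟨M.conj x⁻¹, by rw [← conj_mul, mul_inv_cancel]; exact conj_eq_iff.2 fun _ => rfl⟩
  rw [cosetEquiv_conj, cosetEquiv_conj, Commutant.kernel_smul, cosetEquiv_identity,
    walkMatrix_apply hi hin, hookRel_conj, hookRel_comm]
  change (orbitalOperator (hyperoctahedral n) g (baseVector _)).coeff _ = _
  rw [orbitalOperator_baseVector, coeff_orbitAverage]
  have hk : (hookDegree n i : ℂ) ≠ 0 := by exact_mod_cast (hookDegree_pos hin).ne'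
  have hK : (Nat.card (hyperoctahedral n) : ℂ) ≠ 0 := by exact_mod_cast Nat.card_pos.ne'
  split_ifs with h
  · have h1 : (hookDegree n i : ℂ) * transport ((identity n).conj g⁻¹) N =
        Nat.card (hyperoctahedral n) := by
      exact_mod_cast hookDegree_mul_transport hi hM₁ h
    rw [← h1, Complex.ofReal_inv, Complex.ofReal_natCast]
    rw [← h1] at hK
    have := right_ne_zero_of_mul hK
    field_simp
  · rw [transport_eq_zero hM₁ h]; simp

end PerfectMatching

/-! ### The Plancherel measure and the law of the spherical function -/

section Plancherel

variable {G : Type*} [Group G] [Fintype G] {K : Subgroup G}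

open Classical in
lemma plancherelMeasure_real [Fintype (SphericalRep K)] (S : Set (SphericalRep K)) :
    (plancherelMeasure K).real S =
      ((∑ V : SphericalRep K with V ∈ S, V.dim : ℕ) : ℝ) / Nat.card (G ⧸ K) := by
  have hG : (Nat.card G : ℝ) = Nat.card (G ⧸ K) * Nat.card K := by
    exact_mod_cast K.card_eq_card_quotient_mul_card_subgroup
  have hK : (Nat.card K : ℝ) ≠ 0 := by exact_mod_cast Nat.card_pos.ne'
  have h1 : ∀ V : SphericalRep K, (V.dim : ℝ) * Nat.card K / Nat.card G =
      V.dim / Nat.card (G ⧸ K) := fun V => by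
    rw [hG, mul_div_mul_right _ _ hK]
  have hS : MeasurableSet S := MeasurableSpace.measurableSet_top
  unfold plancherelMeasure MeasureTheory.Measure.real
  rw [MeasureTheory.Measure.sum_apply _ hS, tsum_fintype, ENNReal.toReal_sum]
  · rw [Nat.cast_sum, Finset.sum_div, Finset.sum_filter]
    refine Finset.sum_congr rfl fun V _ => ?_
    rw [MeasureTheory.Measure.smul_apply, MeasureTheory.Measure.dirac_apply' _ hS,
      smul_eq_mul, ENNReal.toReal_mul, ENNReal.toReal_ofReal (by positivity), h1]
    by_cases h : V ∈ S <;> simp [h]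
  · intro V _
    rw [MeasureTheory.Measure.smul_apply, MeasureTheory.Measure.dirac_apply' _ hS, smul_eq_mul]
    refine ENNReal.mul_ne_top ENNReal.ofReal_ne_top ?_
    by_cases h : V ∈ S <;> simp [h]

lemma isGelfandPair_of_hasSwaps (hK : HasSwaps K) : IsGelfandPair K :=
  fun V V' ⟨T⟩ => V.eq_of_equiv V' hK T

lemma isProbabilityMeasure_plancherelMeasure (hK : HasSwaps K) :
    MeasureTheory.IsProbabilityMeasure (plancherelMeasure K) := by
  classical
  have := SphericalRep.finite hK
  have := Fintype.ofFinite (SphericalRep K)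
  have h := plancherelMeasure_real (K := K) Set.univ
  simp only [Set.mem_univ, Finset.filter_true] at h
  rw [SphericalRep.sum_dim hK, div_self (by exact_mod_cast Nat.card_pos.ne')] at h
  refine ⟨?_⟩
  rw [MeasureTheory.Measure.real, ENNReal.toReal_eq_one_iff] at h
  exact h

end Plancherel

namespace PerfectMatching

variable {n i : ℕ}

lemma card_quotient_hyperoctahedral (n : ℕ) :
    Nat.card (Equiv.Perm (Fin (2 * n)) ⧸ hyperoctahedral n) = Fintype.card (PerfectMatching n) := by
  rw [← Nat.card_eq_fintype_card]
  exact Nat.card_congr (cosetEquiv n).symm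

/-- Equality of weighted counts is used for two predicates. Nonzero imaginary part has count zero
for a real symmetric matrix, which excludes it for constituents of positive dimension; the half line
yields the distribution function. -/
theorem sphericalFunction_law (hi : 2 ≤ i) (hin : i ≤ n) {g : Equiv.Perm (Fin (2 * n))}
    (hg : matchingType (identityMatching n) (matchingOf g) = hookType n i) :
    (∀ V : SphericalRep (hyperoctahedral n), (sphericalFunction V g).im = 0) ∧
      ∀ x₀ : ℝ, (plancherelMeasure (hyperoctahedral n)).real
        {V | scaling n i * (sphericalFunction V g).re ≤ x₀} =
          walkSpectralCDF (matchingGraph n i) (scaling n i) x₀ := by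
  classical
  have hK := hasSwaps_hyperoctahedral n
  have := SphericalRep.finite hK
  have := Fintype.ofFinite (SphericalRep (hyperoctahedral n))
  have hP := isHermitian_walkMatrix hi hin
  choose c hc using fun V : SphericalRep (hyperoctahedral n) =>
    V.exists_scalar hK (orbitalOperator (hyperoctahedral n) g)
  have hω : ∀ V : SphericalRep (hyperoctahedral n), sphericalFunction V g = c V := fun V =>
    V.sphericalFunction_eq hK g (hc V)
  have hlaw := fun (p : ℂ → Prop) => sum_dim_filter_eq hK _ hc (cosetEquiv n) hP
    (kernel_orbitalOperator hi hin hg) p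
  refine ⟨fun V => ?_, fun x₀ => ?_⟩
  · rw [hω]
    by_contra h
    have h1 := hlaw fun z => z.im ≠ 0
    simp only [Complex.ofReal_im, ne_eq, not_true_eq_false, Finset.filter_false,
      Finset.card_empty, Finset.sum_eq_zero_iff] at h1
    exact V.dim_pos.ne' (h1 V (Finset.mem_filter.2 ⟨Finset.mem_univ _, h⟩))
  · have h1 := hlaw fun z => scaling n i * z.re ≤ x₀
    rw [plancherelMeasure_real]
    simp only [Set.mem_ofPred_eq, hω]
    rw [h1, card_quotient_hyperoctahedral]
    unfold walkSpectralCDF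
    congr 2
    have h2 := congrArg (fun s => Multiset.card (s.filter (scaling n i * · ≤ x₀)))
      hP.roots_charpoly_eq_eigenvalues
    simp only [Multiset.filter_map, Multiset.card_map, Function.comp_def] at h2
    convert! h2.symm using 1
    congr!

end PerfectMatching

end

theorem mainTheorem3 (i : ℕ) (hi : 2 ≤ i) :
    ∃ A : ℝ, ∀ n : ℕ, i ≤ n →
      -- `(S_{2n}, K)` is a Gelfand pair, and its Plancherel measure is a probability measure
      IsGelfandPair (hyperoctahedral n) ∧
      MeasureTheory.IsProbabilityMeasure (plancherelMeasure (hyperoctahedral n)) ∧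
      -- central limit theorem for the spherical functions
      (∀ g : Equiv.Perm (Fin (2 * n)),
        matchingType (identityMatching n) (matchingOf g) = hookType n i →
        (∀ V : SphericalRep (hyperoctahedral n), (sphericalFunction V g).im = 0) ∧
        ∀ x₀ : ℝ,
          |(plancherelMeasure (hyperoctahedral n)).real
              {V | scaling n i * (sphericalFunction V g).re ≤ x₀} - normalCDF x₀|
            ≤ A * (n : ℝ) ^ (-(1 / 4) : ℝ) ∧
          -- the law of `W` is the rescaled spectral distribution of the matching graph
          (plancherelMeasure (hyperoctahedral n)).real
              {V | scaling n i * (sphericalFunction V g).re ≤ x₀} =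
            walkSpectralCDF (matchingGraph n i) (scaling n i) x₀) ∧
      -- central limit theorem for the spectrum of the matching graph
      ∀ x₀ : ℝ,
        |walkSpectralCDF (matchingGraph n i) (scaling n i) x₀ - normalCDF x₀|
          ≤ A * (n : ℝ) ^ (-(1 / 4) : ℝ) := by
  refine ⟨PerfectMatching.cltConst i, fun n hin => ?_⟩
  have hK := PerfectMatching.hasSwaps_hyperoctahedral n
  have hclt := PerfectMatching.abs_walkSpectralCDF_sub_le hi hin
  refine ⟨isGelfandPair_of_hasSwaps hK, isProbabilityMeasure_plancherelMeasure hK,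
    fun g hg => ?_, hclt⟩
  obtain ⟨h1, h2⟩ := PerfectMatching.sphericalFunction_law hi hin hg
  exact ⟨h1, fun x₀ => ⟨(h2 x₀).symm ▸ hclt x₀, h2 x₀⟩⟩
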